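/- Let $n\ge 1$ and let $P\in\mathbb C[x]$ be a monic polynomial of degree $n$ with $P(-x)=(-1)^nP(x)$ and $\overline P(-x)=(-1)^nP(x)$ (equivalently, $P$ has real coefficients and $P(-x)=(-1)^nP(x)$), all of whose roots $\alpha$ satisfy $|\mathrm{Re}\,\alpha|<\frac12$. Let $\mathcal A=\mathcal A_P$ be the algebra over $\mathbb C$ generated by $u,v,z$ with relations $[z,u]=-u$, $[z,v]=v$, $vu=P(z-\frac12)$, $uv=P(z+\frac12)$, filtered by $\deg u=\deg v=n$, $\deg z=2$. Let $s$ be the automorphism of $\mathcal A$ with $s(u)=(-1)^nu$, $s(v)=(-1)^nv$, $s(z)=z$; let $\sigma$ be the antiautomorphism with $\sigma(u)=\mathrm i^nu$, $\sigma(v)=\mathrm i^nv$, $\sigma(z)=-z$; and let $\rho_\pm$ be the antilinear automorphisms with $\rho_\pm(v)=\lambda u$, $\rho_\pm(u)=(-1)^n\lambda^{-1}v$, $\rho_\pm(z)=-z$, where $\lambda=\pm\mathrm i^{-n}e^{-\pi\mathrm ic}$ with $c=0$ for $n$ even and $c=\frac12$ for $n$ odd. For $\rho\in\{\rho_+,\rho_-\}$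 let $\mathcal C_+^{\rm even}$ be the convex cone of linear functionals $T:\mathcal A\to\mathbb C$ such that $T(ab)=T(b\,s(a))$, $T(\sigma(a))=T(a)$, and $(a,b)\mapsto T(a\rho(b))$ is a positive definite Hermitian form on $\mathcal A$. Its dimension modulo scaling is the dimension of its real span minus $1$, where a negative value means that the cone is empty. (1) The dimension of $\mathcal C_+^{\rm even}$ modulo scaling is $\frac{n-3}2$ if $\rho=\rho_-$ and $n$ is odd; $\frac{n-1}2$ if $\rho=\rho_+$ and $n$ is odd; $\frac{n-2}2$ if $\rho=\rho_-$ and $n$ is even; $\frac{n-4}2$ if $\rho=\rho_+$ and $n$ is even. Let $A=\mathbb C[p,q]^{\mathbb Z/n}$, where $\mathbb Z/n$ acts by $p\mapsto e^{2\pi\mathrm i/n}p$, $q\mapsto e^{-2\pi\mathrm i/n}q$, with the grading $\deg p=\deg q=1$, the Poisson bracket $\{p,q\}=\frac1n$, the elements $u=p^n$, $v=q^n$, $z=pq$, and the canonical conjugation $\rho_A$, which is the restriction to $A$ of the antilinear ring automorphism $p\mapsto q$, $q\mapsto -p$ of $\mathbb C[p,q]$. A star-product on $A$ is an associative bilinear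 product $*$ such that for $a\in A_i$, $b\in A_j$ one has $a*b=\sum_{k\ge0}C_k(a,b)$ with $C_k(a,b)\in A_{i+j-2k}$, $C_0(a,b)=ab$ and $C_1(a,b)-C_1(b,a)=\{a,b\}$. It is short if $C_k(a,b)=0$ for $k>\min(i,j)$; even if $C_k(a,b)=(-1)^kC_k(b,a)$; and unitary if $\rho_A(a*b)=\rho_A(a)*\rho_A(b)$ and $(a,b)\mapsto \mathrm{CT}(a*\rho_A(b))$ is a positive definite Hermitian form on $A$, where $\mathrm{CT}$ is the constant term. The canonical quaternionic structure on $\mathcal A$ consists of $\sigma$ and of $\rho=\rho_+$ if $n\equiv0,1 \bmod 4$, $\rho=\rho_-$ if $n\equiv2,3\bmod 4$. The star-product is a star-product for the quantization $\mathcal A$ with this structure if there is a linear isomorphism $\varphi:A\to\mathcal A$ of filtered spaces with $\mathrm{gr}\,\varphi=\mathrm{id}$ (under $u\mapsto u$, $v\mapsto v$, $z\mapsto z$), $\varphi(a*b)=\varphi(a)\varphi(b)$, $\sigma(\varphi(a))=\mathrm i^d\varphi(a)$ for $a\in A_d$, and $\rho\circ\varphi=\varphi\circ\rho_A$. (2)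 If $n\le4$, there is exactly one unitary even short star-product for $\mathcal A$ with its canonical quaternionic structure. (3) If $n\ge5$ (in particular if $n=5$), there are at least two different unitary even short star-products for $\mathcal A$ with its canonical quaternionic structure. -/

import Mathlib

noncomputable section

namespace Kleinian

/-! ### The quantizations `𝒜_P` -/

/-- Names for the three generators `u, v, z`. -/
inductive Gen
  | u
  | v
  | z

/-- The degrees `deg u = deg v = n`, `deg z = 2`. -/
def Gen.degree (n : ℕ) : Gen → ℕ
  | Gen.u => n
  | Gen.v => n
  | Gen.z => 2

/-- The defining relations `[z,u] = -u`, `[z,v] = v`, `vu = P(z - 1/2)`, `uv = P(z + 1/2)`. -/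
inductive Rel (P : Polynomial ℂ) : FreeAlgebra ℂ Gen → FreeAlgebra ℂ Gen → Prop
  | zu : Rel P (FreeAlgebra.ι ℂ Gen.z * FreeAlgebra.ι ℂ Gen.u
      - FreeAlgebra.ι ℂ Gen.u * FreeAlgebra.ι ℂ Gen.z) (-FreeAlgebra.ι ℂ Gen.u)
  | zv : Rel P (FreeAlgebra.ι ℂ Gen.z * FreeAlgebra.ι ℂ Gen.v
      - FreeAlgebra.ι ℂ Gen.v * FreeAlgebra.ι ℂ Gen.z) (FreeAlgebra.ι ℂ Gen.v)
  | vu : Rel P (FreeAlgebra.ι ℂ Gen.v * FreeAlgebra.ι ℂ Gen.u)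
      (Polynomial.aeval (FreeAlgebra.ι ℂ Gen.z - algebraMap ℂ _ (1 / 2)) P)
  | uv : Rel P (FreeAlgebra.ι ℂ Gen.u * FreeAlgebra.ι ℂ Gen.v)
      (Polynomial.aeval (FreeAlgebra.ι ℂ Gen.z + algebraMap ℂ _ (1 / 2)) P)

/-- The generalized Weyl algebra `𝒜_P`. -/
def Quant (P : Polynomial ℂ) : Type := RingQuot (Rel P)

instance (P : Polynomial ℂ) : Ring (Quant P) := inferInstanceAs (Ring (RingQuot (Rel P)))

instance (P : Polynomial ℂ) : Algebra ℂ (Quant P) :=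
  inferInstanceAs (Algebra ℂ (RingQuot (Rel P)))

/-- The quotient map from the free algebra. -/
def mk (P : Polynomial ℂ) : FreeAlgebra ℂ Gen →ₐ[ℂ] Quant P := RingQuot.mkAlgHom ℂ (Rel P)

lemma mk_rel {P : Polynomial ℂ} {x y : FreeAlgebra ℂ Gen} (h : Rel P x y) : mk P x = mk P y :=
  RingQuot.mkAlgHom_rel ℂ h

/-- The generators of `𝒜_P`. -/
def gen (P : Polynomial ℂ) (x : Gen) : Quant P := mk P (FreeAlgebra.ι ℂ x)

lemma gen_zu (P : Polynomial ℂ) :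
    gen P Gen.z * gen P Gen.u - gen P Gen.u * gen P Gen.z = -gen P Gen.u := by
  simpa [gen] using mk_rel (Rel.zu (P := P))

lemma gen_zv (P : Polynomial ℂ) :
    gen P Gen.z * gen P Gen.v - gen P Gen.v * gen P Gen.z = gen P Gen.v := by
  simpa [gen] using mk_rel (Rel.zv (P := P))

lemma gen_vu (P : Polynomial ℂ) :
    gen P Gen.v * gen P Gen.u =
      Polynomial.aeval (gen P Gen.z - algebraMap ℂ _ (1 / 2)) P := by
  have h := mk_rel (Rel.vu (P := P))
  rw [map_mul, ← Polynomial.aeval_algHom_apply, map_sub, AlgHom.commutes] at h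
  exact h

lemma gen_uv (P : Polynomial ℂ) :
    gen P Gen.u * gen P Gen.v =
      Polynomial.aeval (gen P Gen.z + algebraMap ℂ _ (1 / 2)) P := by
  have h := mk_rel (Rel.uv (P := P))
  rw [map_mul, ← Polynomial.aeval_algHom_apply, map_add, AlgHom.commutes] at h
  exact h

lemma zu_smul {B : Type} [Ring B] [Algebra ℂ B] {x y : B} (c : ℂ) (h : x * y - y * x = -y) :
    x * (c • y) - (c • y) * x = -(c • y) := by
  rw [Algebra.mul_smul_comm, Algebra.smul_mul_assoc, ← smul_sub, h, smul_neg]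

lemma zv_smul {B : Type} [Ring B] [Algebra ℂ B] {x y : B} (c : ℂ) (h : x * y - y * x = y) :
    x * (c • y) - (c • y) * x = c • y := by
  rw [Algebra.mul_smul_comm, Algebra.smul_mul_assoc, ← smul_sub, h]

lemma lift_rel (P : Polynomial ℂ) {B : Type} [Ring B] [Algebra ℂ B] (f : Gen → B)
    (hzu : f Gen.z * f Gen.u - f Gen.u * f Gen.z = -f Gen.u)
    (hzv : f Gen.z * f Gen.v - f Gen.v * f Gen.z = f Gen.v)
    (hvu : f Gen.v * f Gen.u = Polynomial.aeval (f Gen.z - algebraMap ℂ _ (1 / 2)) P)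
    (huv : f Gen.u * f Gen.v = Polynomial.aeval (f Gen.z + algebraMap ℂ _ (1 / 2)) P)
    ⦃x y : FreeAlgebra ℂ Gen⦄ (h : Rel P x y) :
    FreeAlgebra.lift ℂ f x = FreeAlgebra.lift ℂ f y := by
  cases h with
  | zu => simpa using hzu
  | zv => simpa using hzv
  | vu =>
    rw [map_mul, ← Polynomial.aeval_algHom_apply, map_sub, AlgHom.commutes]
    simpa using hvu
  | uv =>
    rw [map_mul, ← Polynomial.aeval_algHom_apply, map_add, AlgHom.commutes]
    simpa using huv

/-- The universal property of `𝒜_P`. -/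
def lift (P : Polynomial ℂ) {B : Type} [Ring B] [Algebra ℂ B] (f : Gen → B)
    (hzu : f Gen.z * f Gen.u - f Gen.u * f Gen.z = -f Gen.u)
    (hzv : f Gen.z * f Gen.v - f Gen.v * f Gen.z = f Gen.v)
    (hvu : f Gen.v * f Gen.u = Polynomial.aeval (f Gen.z - algebraMap ℂ _ (1 / 2)) P)
    (huv : f Gen.u * f Gen.v = Polynomial.aeval (f Gen.z + algebraMap ℂ _ (1 / 2)) P) :
    Quant P →ₐ[ℂ] B :=
  RingQuot.liftAlgHom ℂ ⟨FreeAlgebra.lift ℂ f, lift_rel P f hzu hzv hvu huv⟩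

lemma lift_gen (P : Polynomial ℂ) {B : Type} [Ring B] [Algebra ℂ B] (f : Gen → B)
    (hzu hzv hvu huv) (x : Gen) : lift P f hzu hzv hvu huv (gen P x) = f x := by
  have h := RingQuot.liftAlgHom_mkAlgHom_apply ℂ (FreeAlgebra.lift ℂ f) (s := Rel P)
    (lift_rel P f hzu hzv hvu huv) (FreeAlgebra.ι ℂ x)
  rw [FreeAlgebra.lift_ι_apply] at h
  exact h

/-- The subspace `F_{<d}` of `𝒜_P` spanned by the words in `u, v, z` of total degree `< d`. The
filtration of `𝒜_P` is `F_{≤ d} = F_{<d+1}`. -/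
def filtLT (n : ℕ) (P : Polynomial ℂ) (d : ℕ) : Submodule ℂ (Quant P) :=
  Submodule.span ℂ {a | ∃ w : List Gen, (w.map (Gen.degree n)).sum < d ∧ (w.map (gen P)).prod = a}

/-- The parameters of the quantizations carrying a quaternionic structure: monic `P` of degree `n`
with `P(-x) = (-1)^n P(x)` (so that `𝒜_P` is even) and `P̄(-x) = (-1)^n P(x)` (so that `𝒜_P` has
conjugations). -/
structure Parameter (n : ℕ) where
  /-- the polynomial `P` -/
  poly : Polynomial ℂ
  monic : poly.Monic
  natDegree_eq : poly.natDegree = n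
  even : poly.comp (-Polynomial.X) = (-1) ^ n * poly
  conj : (poly.map (starRingEnd ℂ)).comp (-Polynomial.X) = (-1) ^ n * poly

/-- The automorphism `s` of `𝒜_P`: `u ↦ (-1)^n u`, `v ↦ (-1)^n v`, `z ↦ z`. -/
def sAut {n : ℕ} (P : Parameter n) : Quant P.poly →ₐ[ℂ] Quant P.poly :=
  lift P.poly
    (fun x => match x with
      | Gen.u => (-1 : ℂ) ^ n • gen P.poly Gen.u
      | Gen.v => (-1 : ℂ) ^ n • gen P.poly Gen.v
      | Gen.z => gen P.poly Gen.z)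
    (zu_smul _ (gen_zu P.poly))
    (zv_smul _ (gen_zv P.poly))
    (by
      simp only [mul_smul_comm, smul_mul_assoc, smul_smul, ← mul_pow]
      simpa using gen_vu P.poly)
    (by
      simp only [mul_smul_comm, smul_mul_assoc, smul_smul, ← mul_pow]
      simpa using gen_uv P.poly)

/-- Evaluation form of `P(-x) = (-1)^n P(x)`. -/
lemma Parameter.aeval_neg {n : ℕ} (P : Parameter n) {B : Type} [Ring B] [Algebra ℂ B] (x : B) :
    Polynomial.aeval (-x) P.poly = (-1 : ℂ) ^ n • Polynomial.aeval x P.poly := by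
  have h := congrArg (Polynomial.aeval x) P.even
  rw [Polynomial.aeval_comp] at h
  rw [Algebra.smul_def]
  simpa using h

/-- Evaluation form of `P̄(-x) = (-1)^n P(x)`. -/
lemma Parameter.aeval_conj_neg {n : ℕ} (P : Parameter n) {B : Type} [Ring B] [Algebra ℂ B]
    (x : B) :
    Polynomial.aeval (-x) (P.poly.map (starRingEnd ℂ)) =
      (-1 : ℂ) ^ n • Polynomial.aeval x P.poly := by
  have h := congrArg (Polynomial.aeval x) P.conj
  rw [Polynomial.aeval_comp] at h
  rw [Algebra.smul_def]
  simpa using h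

/-- The images under `σ` of the generators: `u ↦ i^n u`, `v ↦ i^n v`, `z ↦ -z`. -/
def sigmaGen {n : ℕ} (P : Parameter n) : Gen → (Quant P.poly)ᵐᵒᵖ
  | Gen.u => MulOpposite.op (Complex.I ^ n • gen P.poly Gen.u)
  | Gen.v => MulOpposite.op (Complex.I ^ n • gen P.poly Gen.v)
  | Gen.z => MulOpposite.op (-gen P.poly Gen.z)

lemma aeval_op {B : Type} [Ring B] [Algebra ℂ B] (x : B) (Q : Polynomial ℂ) :
    Polynomial.aeval (MulOpposite.op x) Q = MulOpposite.op (Polynomial.aeval x Q) := by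
  induction Q using Polynomial.induction_on' with
  | add p q hp hq => simp [hp, hq]
  | monomial k c =>
    simp only [Polynomial.aeval_monomial, MulOpposite.algebraMap_apply, ← MulOpposite.op_pow,
      ← MulOpposite.op_mul]
    rw [Algebra.commutes]

/-- The antiautomorphism `σ` of `𝒜_P`: `u ↦ i^n u`, `v ↦ i^n v`, `z ↦ -z`, as an algebra
homomorphism to the opposite algebra. -/
def sigma {n : ℕ} (P : Parameter n) : Quant P.poly →ₐ[ℂ] (Quant P.poly)ᵐᵒᵖ :=
  lift P.poly (sigmaGen P)
    (by
      simp only [sigmaGen, ← MulOpposite.op_mul, ← MulOpposite.op_sub, ← MulOpposite.op_neg]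
      congr 1
      rw [← zu_smul (Complex.I ^ n) (gen_zu P.poly), neg_mul, mul_neg]
      abel)
    (by
      simp only [sigmaGen, ← MulOpposite.op_mul, ← MulOpposite.op_sub]
      congr 1
      refine Eq.trans ?_ (zv_smul (Complex.I ^ n) (gen_zv P.poly))
      rw [neg_mul, mul_neg]
      abel)
    (by
      simp only [sigmaGen, ← MulOpposite.op_mul, MulOpposite.algebraMap_apply,
        ← MulOpposite.op_sub, aeval_op]
      congr 1
      rw [show -gen P.poly Gen.z - algebraMap ℂ _ (1 / 2 : ℂ) =
        -(gen P.poly Gen.z + algebraMap ℂ _ (1 / 2 : ℂ)) by abel, P.aeval_neg, ← gen_uv,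
        smul_mul_smul_comm, ← mul_pow, Complex.I_mul_I])
    (by
      simp only [sigmaGen, ← MulOpposite.op_mul, MulOpposite.algebraMap_apply,
        ← MulOpposite.op_add, aeval_op]
      congr 1
      rw [show -gen P.poly Gen.z + algebraMap ℂ _ (1 / 2 : ℂ) =
        -(gen P.poly Gen.z - algebraMap ℂ _ (1 / 2 : ℂ)) by abel, P.aeval_neg, ← gen_vu,
        smul_mul_smul_comm, ← mul_pow, Complex.I_mul_I])

lemma conj_half : starRingEnd ℂ (1 / 2 : ℂ) = 1 / 2 := by
  rw [map_div₀, map_one, Complex.conj_ofNat]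

/-- `𝒜_P` with the complex conjugate scalar multiplication. -/
def ConjQuant (P : Polynomial ℂ) : Type := Quant P

instance (P : Polynomial ℂ) : Ring (ConjQuant P) := inferInstanceAs (Ring (Quant P))

instance (P : Polynomial ℂ) : Algebra ℂ (ConjQuant P) :=
  RingHom.toAlgebra' ((algebraMap ℂ (Quant P)).comp (starRingEnd ℂ))
    (fun c x => Algebra.commutes (A := Quant P) (starRingEnd ℂ c) x)

lemma aeval_conjQuant (P Q : Polynomial ℂ) (x : Quant P) :
    Polynomial.aeval (A := ConjQuant P) x Q =
      Polynomial.aeval (A := Quant P) x (Q.map (starRingEnd ℂ)) :=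
  (Polynomial.eval₂_map (p := Q) (starRingEnd ℂ) (algebraMap ℂ (Quant P)) x).symm

/-- The images under `ρ` of the generators: `v ↦ lam u`, `u ↦ (-1)^n lam⁻¹ v`, `z ↦ -z`. -/
def conjGen {n : ℕ} (P : Parameter n) (lam : ℂ) : Gen → Quant P.poly
  | Gen.u => ((-1) ^ n * lam⁻¹) • gen P.poly Gen.v
  | Gen.v => lam • gen P.poly Gen.u
  | Gen.z => -gen P.poly Gen.z

/-- The antilinear automorphism `ρ` of `𝒜_P` with `ρ(v) = lam u`, `ρ(u) = (-1)^n lam⁻¹ v`,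
`ρ(z) = -z`, as an algebra homomorphism to the conjugate algebra. -/
def conjHom {n : ℕ} (P : Parameter n) (lam : ℂ) (hlam : lam ≠ 0) :
    Quant P.poly →ₐ[ℂ] ConjQuant P.poly :=
  lift (B := ConjQuant P.poly) P.poly (conjGen P lam)
    (by
      change (-gen P.poly Gen.z) * (((-1) ^ n * lam⁻¹) • gen P.poly Gen.v) -
        (((-1) ^ n * lam⁻¹) • gen P.poly Gen.v) * (-gen P.poly Gen.z) =
        -(((-1) ^ n * lam⁻¹) • gen P.poly Gen.v)
      conv_rhs => rw [← zv_smul _ (gen_zv P.poly)]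
      rw [neg_mul, mul_neg]
      abel)
    (by
      change (-gen P.poly Gen.z) * (lam • gen P.poly Gen.u) -
        (lam • gen P.poly Gen.u) * (-gen P.poly Gen.z) = lam • gen P.poly Gen.u
      conv_rhs => rw [← neg_neg (lam • gen P.poly Gen.u), ← zu_smul lam (gen_zu P.poly)]
      rw [neg_mul, mul_neg]
      abel)
    (by
      change (lam • gen P.poly Gen.u) * (((-1) ^ n * lam⁻¹) • gen P.poly Gen.v) =
        Polynomial.aeval (A := ConjQuant P.poly) (-gen P.poly Gen.z -
          algebraMap ℂ (Quant P.poly) (starRingEnd ℂ (1 / 2 : ℂ)) : Quant P.poly) P.poly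
      rw [aeval_conjQuant, show -gen P.poly Gen.z -
          algebraMap ℂ (Quant P.poly) (starRingEnd ℂ (1 / 2 : ℂ)) =
          -(gen P.poly Gen.z + algebraMap ℂ (Quant P.poly) (1 / 2 : ℂ)) by
            rw [conj_half]; abel,
        P.aeval_conj_neg, ← gen_uv, smul_mul_smul_comm]
      congr 1
      field_simp)
    (by
      change (((-1) ^ n * lam⁻¹) • gen P.poly Gen.v) * (lam • gen P.poly Gen.u) =
        Polynomial.aeval (A := ConjQuant P.poly) (-gen P.poly Gen.z +
          algebraMap ℂ (Quant P.poly) (starRingEnd ℂ (1 / 2 : ℂ)) : Quant P.poly) P.poly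
      rw [aeval_conjQuant, show -gen P.poly Gen.z +
          algebraMap ℂ (Quant P.poly) (starRingEnd ℂ (1 / 2 : ℂ)) =
          -(gen P.poly Gen.z - algebraMap ℂ (Quant P.poly) (1 / 2 : ℂ)) by
            rw [conj_half]; abel,
        P.aeval_conj_neg, ← gen_vu, smul_mul_smul_comm]
      congr 1
      field_simp)

/-- `c ∈ [0,1)` with `exp (2πic) = (-1)^n`. -/
def cParam (n : ℕ) : ℂ := if Even n then 0 else 1 / 2

/-- The constant `λ = ε i^{-n} e^{-πic}` of the conjugation `ρ_ε`. -/
def conjConst (n : ℕ) (ε : ℤˣ) : ℂ :=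
  ((ε : ℤ) : ℂ) * (Complex.I ^ n)⁻¹ * Complex.exp (-(Real.pi * Complex.I * cParam n))

lemma conjConst_ne_zero (n : ℕ) (ε : ℤˣ) : conjConst n ε ≠ 0 := by
  simp [conjConst, Complex.exp_ne_zero]

/-- The conjugation `ρ_ε` of `𝒜_P` with `ρ_ε² = s`; `ρ_+` is `ε = 1` and `ρ_-` is `ε = -1`. It is
antilinear. -/
def rho {n : ℕ} (P : Parameter n) (ε : ℤˣ) : Quant P.poly →ₛₗ[starRingEnd ℂ] Quant P.poly where
  toFun a := conjHom P (conjConst n ε) (conjConst_ne_zero n ε) a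
  map_add' a b := map_add (conjHom P (conjConst n ε) (conjConst_ne_zero n ε)) a b
  map_smul' c a := by
    refine (map_smul (conjHom P (conjConst n ε) (conjConst_ne_zero n ε)) c a).trans ?_
    exact (Algebra.smul_def (A := ConjQuant P.poly) c _).trans
      (Algebra.smul_def (A := Quant P.poly) (starRingEnd ℂ c) _).symm

/-! ### Positive traces -/

/-- The cone `𝒞₊^even`: the linear functionals `T` on `𝒜_P` that are `s`-twisted traces,
`σ`-stable, and such that `(a, b) ↦ T(a ρ_ε(b))` is a positive definite Hermitian form. -/
def positiveEvenTraces {n : ℕ} (P : Parameter n) (ε : ℤˣ) :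
    ConvexCone ℝ (Quant P.poly →ₗ[ℂ] ℂ) where
  carrier := {T |
    (∀ a b, T (a * b) = T (b * sAut P a)) ∧
    (∀ a, T (sigma P a).unop = T a) ∧
    (∀ a b, T (b * rho P ε a) = starRingEnd ℂ (T (a * rho P ε b))) ∧
    (∀ a, a ≠ 0 → 0 < (T (a * rho P ε a)).re)}
  smul_mem' := by
    rintro r hr T ⟨h1, h2, h3, h4⟩
    refine ⟨fun a b => ?_, fun a => ?_, fun a b => ?_, fun a ha => ?_⟩
    · simp [h1 a b]
    · simp [h2 a]
    · simp [h3 a b]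
    · simpa using mul_pos hr (h4 a ha)
  add_mem' := by
    rintro T ⟨h1, h2, h3, h4⟩ T' ⟨h1', h2', h3', h4'⟩
    refine ⟨fun a b => ?_, fun a => ?_, fun a b => ?_, fun a ha => ?_⟩
    · simp [h1 a b, h1' a b]
    · simp [h2 a, h2' a]
    · simp [h3 a b, h3' a b]
    · simpa using add_pos (h4 a ha) (h4' a ha)

/-- A convex cone `K` has dimension `d` modulo scaling: its real span has dimension `d + 1`, where
a negative value of `d` means that `K` is empty. -/
def HasDimModScaling {V : Type} [AddCommGroup V] [Module ℝ V] (K : ConvexCone ℝ V) (d : ℤ) :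
    Prop :=
  FiniteDimensional ℝ (Submodule.span ℝ (K : Set V)) ∧
    (Module.finrank ℝ (Submodule.span ℝ (K : Set V)) : ℤ) = d + 1 ∧
    (d < 0 → (K : Set V) = ∅)

/-! ### The Poisson algebra `A = ℂ[p,q]^{ℤ/n}` and star-products on it -/

/-- `e^{2πi/n}`. -/
def zeta (n : ℕ) : ℂ := Complex.exp (2 * Real.pi * Complex.I / n)

/-- The generator of `ℤ/n` acting on `ℂ[p,q]` by `p ↦ e^{2πi/n} p`, `q ↦ e^{-2πi/n} q`, where
`p = X 0` and `q = X 1`. -/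
def rot (n : ℕ) : MvPolynomial (Fin 2) ℂ →ₐ[ℂ] MvPolynomial (Fin 2) ℂ :=
  MvPolynomial.aeval ![zeta n • MvPolynomial.X 0, (zeta n)⁻¹ • MvPolynomial.X 1]

/-- `A = ℂ[p,q]^{ℤ/n}`. -/
def Inv (n : ℕ) : Subalgebra ℂ (MvPolynomial (Fin 2) ℂ) :=
  AlgHom.equalizer (rot n) (AlgHom.id ℂ _)

/-- `u = p^n`, `v = q^n`, `z = pq` as elements of `A`. -/
def genInv (n : ℕ) (hn : 1 ≤ n) : Gen → Inv n
  | Gen.u => ⟨MvPolynomial.X 0 ^ n, by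
      have h : zeta n ^ n = 1 :=
        (Complex.isPrimitiveRoot_exp n (by omega)).pow_eq_one
      change rot n _ = _
      simp [rot, smul_pow, h]⟩
  | Gen.v => ⟨MvPolynomial.X 1 ^ n, by
      have h : zeta n ^ n = 1 :=
        (Complex.isPrimitiveRoot_exp n (by omega)).pow_eq_one
      change rot n _ = _
      simp [rot, smul_pow, h]⟩
  | Gen.z => ⟨MvPolynomial.X 0 * MvPolynomial.X 1, by
      change rot n _ = _
      simp [rot, smul_smul, zeta]⟩

/-- The Poisson bracket on `ℂ[p,q]` with `{p,q} = 1/n`. -/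
def bracket (n : ℕ) (f g : MvPolynomial (Fin 2) ℂ) : MvPolynomial (Fin 2) ℂ :=
  (1 / n : ℂ) • (MvPolynomial.pderiv 0 f * MvPolynomial.pderiv 1 g
    - MvPolynomial.pderiv 1 f * MvPolynomial.pderiv 0 g)

/-- The antilinear ring endomorphism of `ℂ[p,q]` with `p ↦ q`, `q ↦ -p`. -/
def quatHom : MvPolynomial (Fin 2) ℂ →+* MvPolynomial (Fin 2) ℂ :=
  (MvPolynomial.aeval (R := ℂ) ![MvPolynomial.X 1, -MvPolynomial.X 0] :
    MvPolynomial (Fin 2) ℂ →ₐ[ℂ] MvPolynomial (Fin 2) ℂ).toRingHom.comp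
      (MvPolynomial.map (starRingEnd ℂ))

lemma conj_zeta (n : ℕ) : starRingEnd ℂ (zeta n) = (zeta n)⁻¹ := by
  rw [zeta, ← Complex.exp_conj, ← Complex.exp_neg]
  congr 1
  simp [neg_div, Complex.conj_ofNat]

lemma quatHom_rot (n : ℕ) (f : MvPolynomial (Fin 2) ℂ) :
    rot n (quatHom f) = quatHom (rot n f) := by
  have : (rot n).toRingHom.comp quatHom = quatHom.comp (rot n).toRingHom := by
    apply MvPolynomial.ringHom_ext
    · intro r
      simp [rot, quatHom]
    · intro i
      fin_cases i <;>
        simp [rot, quatHom, MvPolynomial.smul_eq_C_mul, conj_zeta]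
  exact congrArg (fun g => g f) this

/-- The canonical conjugation of `A`: the restriction of `p ↦ q`, `q ↦ -p` to invariants. -/
def quat (n : ℕ) (f : Inv n) : Inv n :=
  ⟨quatHom f.1, by
    change rot n _ = _
    rw [quatHom_rot]
    exact congrArg quatHom f.2⟩

/-- A star-product on the graded Poisson algebra `A`: an associative bilinear product which for
`a ∈ A_i`, `b ∈ A_j` has the form `a * b = ∑_{k ≥ 0} C_k(a,b)` with `C_k(a,b)` of degree
`i + j - 2k`, `C_0(a,b) = ab` and `C_1(a,b) - C_1(b,a) = {a,b}`. -/
@[ext] structure StarProduct (n : ℕ) where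
  /-- the product -/
  mul : Inv n →ₗ[ℂ] Inv n →ₗ[ℂ] Inv n
  assoc : ∀ a b c, mul (mul a b) c = mul a (mul b c)
  degree : ∀ (i j : ℕ) (a b : Inv n), a.1.IsHomogeneous i → b.1.IsHomogeneous j →
    ∀ d, MvPolynomial.homogeneousComponent d (mul a b).1 ≠ 0 → ∃ k, d + 2 * k = i + j
  leading : ∀ (i j : ℕ) (a b : Inv n), a.1.IsHomogeneous i → b.1.IsHomogeneous j →
    MvPolynomial.homogeneousComponent (i + j) (mul a b).1 = a.1 * b.1
  poisson : ∀ (i j : ℕ) (a b : Inv n), a.1.IsHomogeneous i → b.1.IsHomogeneous j →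
    ∀ d, d + 2 = i + j → MvPolynomial.homogeneousComponent d (mul a b).1 -
      MvPolynomial.homogeneousComponent d (mul b a).1 = bracket n a.1 b.1

/-- Shortness: `C_k(a,b) = 0` for `a ∈ A_i`, `b ∈ A_j` and `k > min(i,j)`. -/
def StarProduct.IsShort {n : ℕ} (S : StarProduct n) : Prop :=
  ∀ (i j : ℕ) (a b : Inv n), a.1.IsHomogeneous i → b.1.IsHomogeneous j →
    ∀ k d, d + 2 * k = i + j → min i j < k →
      MvPolynomial.homogeneousComponent d (S.mul a b).1 = 0

/-- Evenness: `C_k(a,b) = (-1)^k C_k(b,a)`. -/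
def StarProduct.IsEven {n : ℕ} (S : StarProduct n) : Prop :=
  ∀ (i j : ℕ) (a b : Inv n), a.1.IsHomogeneous i → b.1.IsHomogeneous j →
    ∀ k d, d + 2 * k = i + j →
      MvPolynomial.homogeneousComponent d (S.mul a b).1 =
        (-1) ^ k * MvPolynomial.homogeneousComponent d (S.mul b a).1

/-- Unitarity with respect to the canonical conjugation `ρ` of `A`: `ρ` is an automorphism of the
star-product, and `(a, b) ↦ CT(a * ρ(b))` is a positive definite Hermitian form, where `CT` is the
constant term. -/
def StarProduct.IsUnitary {n : ℕ} (S : StarProduct n) : Prop :=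
  (∀ a b, quat n (S.mul a b) = S.mul (quat n a) (quat n b)) ∧
  (∀ a b, MvPolynomial.constantCoeff (S.mul b (quat n a)).1 =
    starRingEnd ℂ (MvPolynomial.constantCoeff (S.mul a (quat n b)).1)) ∧
  (∀ a, a ≠ 0 → 0 < (MvPolynomial.constantCoeff (S.mul a (quat n a)).1).re)

/-- The sign `ε` such that `ρ_ε` quantizes the canonical conjugation of `A`: `+` if
`n ≡ 0, 1 mod 4` and `-` if `n ≡ 2, 3 mod 4`. -/
def canonicalSign (n : ℕ) : ℤˣ := if n % 4 = 0 ∨ n % 4 = 1 then 1 else -1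

/-- The star-product comes from the quantization `𝒜_P` with its canonical quaternionic structure:
`(A, *)` is isomorphic to `𝒜_P` through a quantization map `φ`, i.e. a linear isomorphism with
`gr φ = id` (first condition; it makes `φ` strictly compatible with the filtrations), in such a way
that `σ` corresponds to `i^deg` and `ρ` to the canonical conjugation of `A`. -/
def StarProduct.Quantizes {n : ℕ} (hn : 1 ≤ n) (P : Parameter n) (S : StarProduct n) : Prop :=
  ∃ φ : Inv n ≃ₗ[ℂ] Quant P.poly,
    (∀ w : List Gen, φ (w.map (genInv n hn)).prod - (w.map (gen P.poly)).prod ∈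
      filtLT n P.poly (w.map (Gen.degree n)).sum) ∧
    (∀ a b, φ (S.mul a b) = φ a * φ b) ∧
    (∀ (d : ℕ) (a : Inv n), a.1.IsHomogeneous d →
      (sigma P (φ a)).unop = Complex.I ^ d • φ a) ∧
    (∀ a, rho P (canonicalSign n) (φ a) = φ (quat n a))

/-- Unitary even short star-products for the quantization `𝒜_P`. -/
def StarProduct.IsUnitaryEvenShort {n : ℕ} (hn : 1 ≤ n) (P : Parameter n) (S : StarProduct n) :
    Prop :=
  S.Quantizes hn P ∧ S.IsShort ∧ S.IsEven ∧ S.IsUnitary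

end Kleinian

end

/-! Traces. Since s fixes z, a twisted trace kills every vector of nonzero weight for ad z
(`isTrace_weight`). By the PBW basis (`coeffs`) it is therefore a functional τ on ℂ[z]; the trace
and σ conditions become a difference equation involving P and the evenness of τ. Positivity has to
be checked only in weights 0 and 1: the difference equation carries weight k to weight k + 2
(`IsPositive.string`), and the trace property together with ρ² = s turns negative weights into
positive ones.

The difference equation is solved by the integrals τ_h(R) = ∫ R(iy) h(cosh 2πy) / ∏ cos π(iy - α)
dy, with h a real polynomial of degree less than n/2 and α running over the roots of P. Because the
roots lie in the open strip, a suitable integrand is holomorphic on |Re z| ≤ 1/2. Comparing its two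
edges gives the trace relation (`isEvenTrace_momentFunctional`); comparing an edge with the axis
turns positivity in weight 1 into positivity of a density containing h(-cosh 2πy)
(`momentFunctional_shift`). An even trace is determined by the moments τ(z^(2j)) with 2j < n
(`IsEvenTrace.eq_zero`), and h has exactly as many coefficients, so every positive τ is some τ_h
(`IsPositive.exists_eq`).

The dimension. High moments see only the sign of the densities at infinity. Hence positivity forces
h to have positive leading coefficient and (-1)^(deg h) to equal the sign of ρ relative to the
canonical one (`leadingCoeff_pos_of_isPositive`). Conversely, if m has this parity, p + C X^m gives
a positive trace for deg p ≤ m and C large. So the cone spans all polynomials up to the largest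
admissible degree (`span_positiveEvenTraces`).

Star-products. Given a normalized positive trace T for the canonical ρ, Gram-Schmidt along the
filtration gives a unique quantization map φ making the graded pieces T-orthogonal. Orthogonality
gives shortness, σ gives evenness, and ρ with T gives unitarity (`exists_starProduct`). Conversely
the constant term of a unitary even short star-product is such a trace, from which the product is
recovered (`constantTerm_mem`, `starProduct_eq_of_constantTerm_eq`). For the canonical ρ the degree
of h is even, so n ≤ 4 leaves only constants, while n ≥ 5 also allows h = X². Two traces that differ
on ℂ[z] give different products because φ(z) = z is forced for n ≥ 2 (`map_genInv_z`). -/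

noncomputable section

namespace Kleinian

open Polynomial

/-! ### The PBW basis of `𝒜_P` -/

section PBW

variable (P : ℂ[X])

/-- Induction along words in the generators. -/
lemma Quant.induction {p : Quant P → Prop} (hs : ∀ c : ℂ, p (algebraMap ℂ _ c))
    (hg : ∀ x, p (gen P x)) (hm : ∀ a b, p a → p b → p (a * b))
    (ha : ∀ a b, p a → p b → p (a + b)) (a : Quant P) : p a := by
  obtain ⟨x, rfl⟩ := RingQuot.mkAlgHom_surjective ℂ (Rel P) a
  change p (mk P x)
  induction x with
  | grade0 r => simpa using hs r
  | grade1 x => exact hg x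
  | mul a b h1 h2 => rw [map_mul]; exact hm _ _ h1 h2
  | add a b h1 h2 => rw [map_add]; exact ha _ _ h1 h2

/-- The substitution `R ↦ R(z)`. -/
abbrev zev (R : ℂ[X]) : Quant P := aeval (gen P Gen.z) R

lemma gen_v_mul_zev (R : ℂ[X]) :
    gen P Gen.v * zev P R = zev P (taylor (-1) R) * gen P Gen.v := by
  induction R using Polynomial.induction_on with
  | C a => simp [zev, Algebra.commutes]
  | add p q hp hq => simp only [zev, map_add, mul_add, add_mul] at *; rw [hp, hq]
  | monomial k a h =>
    have hz : gen P Gen.v * gen P Gen.z = (gen P Gen.z - 1) * gen P Gen.v := by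
      have := gen_zv P
      rw [sub_eq_iff_eq_add] at this
      rw [sub_mul, one_mul, this]; abel
    rw [pow_succ, ← mul_assoc, zev, map_mul, ← mul_assoc, h, taylor_mul, zev, map_mul, mul_assoc,
      aeval_X, hz]
    simp [mul_assoc, sub_eq_add_neg]

lemma gen_u_mul_zev (R : ℂ[X]) :
    gen P Gen.u * zev P R = zev P (taylor 1 R) * gen P Gen.u := by
  induction R using Polynomial.induction_on with
  | C a => simp [zev, Algebra.commutes]
  | add p q hp hq => simp only [zev, map_add, mul_add, add_mul] at *; rw [hp, hq]
  | monomial k a h =>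
    have hz : gen P Gen.u * gen P Gen.z = (gen P Gen.z + 1) * gen P Gen.u := by
      have := gen_zu P
      rw [add_mul, one_mul]
      rw [sub_eq_iff_eq_add] at this
      rw [this]; abel
    rw [pow_succ, ← mul_assoc, zev, map_mul, ← mul_assoc, h, taylor_mul, zev, map_mul, mul_assoc,
      aeval_X, hz]
    simp [mul_assoc]

lemma zev_taylor (a : ℂ) (R : ℂ[X]) :
    zev P (taylor a R) = aeval (gen P Gen.z + algebraMap ℂ _ a) R := by
  simp [zev, taylor_apply, aeval_comp]

lemma gen_vu' : gen P Gen.v * gen P Gen.u = zev P (taylor (-(1 / 2)) P) := by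
  rw [zev_taylor, gen_vu, map_neg, sub_eq_add_neg]

lemma gen_uv' : gen P Gen.u * gen P Gen.v = zev P (taylor (1 / 2) P) := by
  rw [zev_taylor, gen_uv]

/-- The basis element of weight `k` over `ℂ[z]`: `v ^ k` for `k ≥ 0` and `u ^ (-k)` for `k ≤ 0`. -/
def wt (k : ℤ) : Quant P := gen P Gen.v ^ k.toNat * gen P Gen.u ^ (-k).toNat

/-- The structure constants of the left multiplication by `v`. -/
def cocycleV (k : ℤ) : ℂ[X] := if 0 ≤ k then 1 else taylor (-(1 / 2)) P

/-- The structure constants of the left multiplication by `u`. -/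
def cocycleU (k : ℤ) : ℂ[X] := if k ≤ 0 then 1 else taylor (1 / 2) P

lemma wt_ofNat (k : ℕ) : wt P k = gen P Gen.v ^ k := by simp [wt]

lemma wt_neg_ofNat (k : ℕ) : wt P (-k) = gen P Gen.u ^ k := by simp [wt]

lemma wt_zero : wt P 0 = 1 := by simp [wt]

/-- For k ≥ 0 the power of v just grows; for k < 0 the new v meets a u, and vu = P(z - 1/2) replaces
the pair by a polynomial in z. -/
lemma gen_v_mul_wt (k : ℤ) : gen P Gen.v * wt P k = zev P (cocycleV P k) * wt P (k + 1) := by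
  obtain ⟨m, rfl⟩ | ⟨m, rfl⟩ : (∃ m : ℕ, k = m) ∨ ∃ m : ℕ, k = -((m + 1 : ℕ) : ℤ) := by
    rcases Int.le_total 0 k with h | h
    · exact Or.inl ⟨k.toNat, by omega⟩
    · rcases h.eq_or_lt with h | h
      · exact Or.inl ⟨0, by omega⟩
      · exact Or.inr ⟨(-k - 1).toNat, by omega⟩
  · have : (m : ℤ) + 1 = ((m + 1 : ℕ) : ℤ) := by push_cast; ring
    rw [this, wt_ofNat, wt_ofNat, cocycleV, if_pos (by positivity)]
    simp [zev, pow_succ']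
  · have : -((m + 1 : ℕ) : ℤ) + 1 = -(m : ℤ) := by push_cast; ring
    rw [this, wt_neg_ofNat, wt_neg_ofNat, cocycleV, if_neg (by push_cast; omega), pow_succ',
      ← mul_assoc, gen_vu']

lemma gen_u_mul_wt (k : ℤ) : gen P Gen.u * wt P k = zev P (cocycleU P k) * wt P (k - 1) := by
  obtain ⟨m, rfl⟩ | ⟨m, rfl⟩ : (∃ m : ℕ, k = -m) ∨ ∃ m : ℕ, k = ((m + 1 : ℕ) : ℤ) := by
    rcases Int.le_total k 0 with h | h
    · exact Or.inl ⟨(-k).toNat, by omega⟩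
    · rcases h.eq_or_lt with h | h
      · exact Or.inl ⟨0, by omega⟩
      · exact Or.inr ⟨(k - 1).toNat, by omega⟩
  · have : -(m : ℤ) - 1 = -((m + 1 : ℕ) : ℤ) := by push_cast; ring
    rw [this, wt_neg_ofNat, wt_neg_ofNat, cocycleU, if_pos (by omega)]
    simp [zev, pow_succ']
  · have : ((m + 1 : ℕ) : ℤ) - 1 = (m : ℤ) := by push_cast; ring
    rw [this, wt_ofNat, wt_ofNat, cocycleU, if_neg (by push_cast; omega), pow_succ',
      ← mul_assoc, gen_uv']

/-- Left multiplication by the generators in the PBW basis. -/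
def regularGen : Gen → Module.End ℂ (ℤ →₀ ℂ[X])
  | Gen.u => Finsupp.lsum ℂ fun k => Finsupp.lsingle (k - 1) ∘ₗ
      LinearMap.mulRight ℂ (cocycleU P k) ∘ₗ taylor 1
  | Gen.v => Finsupp.lsum ℂ fun k => Finsupp.lsingle (k + 1) ∘ₗ
      LinearMap.mulRight ℂ (cocycleV P k) ∘ₗ taylor (-1)
  | Gen.z => Finsupp.lsum ℂ fun k => Finsupp.lsingle k ∘ₗ LinearMap.mulRight ℂ X

lemma regularGen_u (k : ℤ) (R : ℂ[X]) : regularGen P Gen.u (Finsupp.single k R) =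
    Finsupp.single (k - 1) (taylor 1 R * cocycleU P k) := by
  simp [regularGen]

lemma regularGen_v (k : ℤ) (R : ℂ[X]) : regularGen P Gen.v (Finsupp.single k R) =
    Finsupp.single (k + 1) (taylor (-1) R * cocycleV P k) := by
  simp [regularGen]

lemma regularGen_z (k : ℤ) (R : ℂ[X]) : regularGen P Gen.z (Finsupp.single k R) =
    Finsupp.single k (R * X) := by
  simp [regularGen]

lemma aeval_regularGen_z (Q : ℂ[X]) (k : ℤ) (R : ℂ[X]) :
    aeval (regularGen P Gen.z) Q (Finsupp.single k R) = Finsupp.single k (Q * R) := by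
  induction Q using Polynomial.induction_on with
  | C a => simp [Polynomial.smul_eq_C_mul]
  | add p q hp hq => simp [add_mul, hp, hq]
  | monomial m a h =>
    rw [pow_succ', mul_left_comm, map_mul, Module.End.mul_apply, h, aeval_X, regularGen_z]
    congr 1; ring

lemma aeval_regularGen_z_taylor (a : ℂ) (k : ℤ) (R : ℂ[X]) :
    aeval (regularGen P Gen.z + algebraMap ℂ _ a) P (Finsupp.single k R) =
      Finsupp.single k (taylor a P * R) := by
  rw [← aeval_regularGen_z P, taylor_apply, aeval_comp]
  simp

/-- This makes v u act by the same polynomial in every weight: exactly one of the two cocycles is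
nontrivial, and the shift by -1 carries P(z + 1/2) to P(z - 1/2). -/
lemma taylor_cocycleU (k : ℤ) :
    taylor (-1) (cocycleU P k) * cocycleV P (k - 1) = taylor (-(1 / 2)) P := by
  rcases le_or_gt k 0 with h | h
  · rw [cocycleU, if_pos h, cocycleV, if_neg (by omega)]; simp
  · rw [cocycleU, if_neg (by omega), cocycleV, if_pos (by omega), taylor_taylor, mul_one]
    norm_num

lemma taylor_cocycleV (k : ℤ) :
    taylor 1 (cocycleV P k) * cocycleU P (k + 1) = taylor (1 / 2) P := by
  rcases le_or_gt 0 k with h | h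
  · rw [cocycleV, if_pos h, cocycleU, if_neg (by omega)]; simp
  · rw [cocycleV, if_neg (by omega), cocycleU, if_pos (by omega), taylor_taylor, mul_one]
    norm_num

lemma regularGen_zu : regularGen P Gen.z * regularGen P Gen.u - regularGen P Gen.u *
    regularGen P Gen.z = -regularGen P Gen.u := by
  refine Finsupp.lhom_ext fun k R => ?_
  simp only [LinearMap.sub_apply, Module.End.mul_apply, regularGen_u, regularGen_z,
    LinearMap.neg_apply, ← Finsupp.single_sub, ← Finsupp.single_neg]
  congr 1
  rw [taylor_mul, taylor_X, map_one]
  ring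

lemma regularGen_zv : regularGen P Gen.z * regularGen P Gen.v - regularGen P Gen.v *
    regularGen P Gen.z = regularGen P Gen.v := by
  refine Finsupp.lhom_ext fun k R => ?_
  simp only [LinearMap.sub_apply, Module.End.mul_apply, regularGen_v, regularGen_z,
    ← Finsupp.single_sub]
  congr 1
  rw [taylor_mul, taylor_X, map_neg, map_one]
  ring

lemma regularGen_vu : regularGen P Gen.v * regularGen P Gen.u =
    aeval (regularGen P Gen.z - algebraMap ℂ _ (1 / 2)) P := by
  have h : regularGen P Gen.z - algebraMap ℂ _ (1 / 2) =
      regularGen P Gen.z + algebraMap ℂ _ (-(1 / 2)) := by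
    rw [map_neg]; abel
  refine Finsupp.lhom_ext fun k R => ?_
  rw [h, aeval_regularGen_z_taylor, Module.End.mul_apply, regularGen_u, regularGen_v,
    ← taylor_cocycleU P k, taylor_mul, taylor_taylor, sub_add_cancel, neg_add_cancel, taylor_zero]
  congr 1
  ring

lemma regularGen_uv : regularGen P Gen.u * regularGen P Gen.v =
    aeval (regularGen P Gen.z + algebraMap ℂ _ (1 / 2)) P := by
  refine Finsupp.lhom_ext fun k R => ?_
  rw [aeval_regularGen_z_taylor, Module.End.mul_apply, regularGen_v, regularGen_u,
    ← taylor_cocycleV P k, taylor_mul, taylor_taylor, add_sub_cancel_right, add_neg_cancel,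
    taylor_zero]
  congr 1
  ring

/-- The left regular representation in the PBW basis. -/
def regular : Quant P →ₐ[ℂ] Module.End ℂ (ℤ →₀ ℂ[X]) :=
  lift P (regularGen P) (regularGen_zu P) (regularGen_zv P) (regularGen_vu P) (regularGen_uv P)

lemma regular_gen (x : Gen) : regular P (gen P x) = regularGen P x := lift_gen _ _ _ _ _ _ _

/-- The map `R e_k ↦ R(z) e_k`. -/
def ofCoeffs : (ℤ →₀ ℂ[X]) →ₗ[ℂ] Quant P :=
  Finsupp.lsum ℂ fun k => LinearMap.mulRight ℂ (wt P k) ∘ₗ (aeval (gen P Gen.z)).toLinearMap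

lemma ofCoeffs_single (k : ℤ) (R : ℂ[X]) :
    ofCoeffs P (Finsupp.single k R) = zev P R * wt P k := by
  simp [ofCoeffs]

/-- The explicit action intertwines with left multiplication because its formulas were read off from
the commutation rules. Applied to e_0 = 1, this gives one half of the bijection `coeffs`, namely
that the R(z) e_k span. -/
lemma ofCoeffs_regular (a : Quant P) (f : ℤ →₀ ℂ[X]) :
    ofCoeffs P (regular P a f) = a * ofCoeffs P f := by
  induction a using Quant.induction generalizing f with
  | hs c => simp [Algebra.smul_def]
  | hg x =>
    rw [regular_gen]
    induction f using Finsupp.induction_linear with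
    | zero => simp
    | add f g hf hg => rw [map_add, map_add, map_add, hf, hg, mul_add]
    | single k R =>
      cases x with
      | u => rw [regularGen_u, ofCoeffs_single, ofCoeffs_single, ← mul_assoc, gen_u_mul_zev,
          mul_assoc (zev P _), gen_u_mul_wt, ← mul_assoc, zev, map_mul]
      | v => rw [regularGen_v, ofCoeffs_single, ofCoeffs_single, ← mul_assoc, gen_v_mul_zev,
          mul_assoc (zev P _), gen_v_mul_wt, ← mul_assoc, zev, map_mul]
      | z => rw [regularGen_z, ofCoeffs_single, ofCoeffs_single, ← mul_assoc, mul_comm R X, zev,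
          map_mul, aeval_X]
  | hm a b h1 h2 => rw [map_mul, Module.End.mul_apply, h1, h2, mul_assoc]
  | ha a b h1 h2 => rw [map_add, LinearMap.add_apply, map_add, h1, h2, add_mul]

lemma regular_zev (Q : ℂ[X]) (k : ℤ) (R : ℂ[X]) :
    regular P (zev P Q) (Finsupp.single k R) = Finsupp.single k (Q * R) := by
  rw [← aeval_regularGen_z P, zev, ← aeval_algHom_apply, regular_gen]

lemma regular_v_pow (k : ℕ) : regular P (gen P Gen.v ^ k) (Finsupp.single 0 1) =
    Finsupp.single (k : ℤ) 1 := by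
  induction k with
  | zero => simp
  | succ k ih =>
    rw [pow_succ', map_mul, Module.End.mul_apply, ih, regular_gen, regularGen_v]
    simp [cocycleV]

lemma regular_u_pow (k : ℕ) : regular P (gen P Gen.u ^ k) (Finsupp.single 0 1) =
    Finsupp.single (-k : ℤ) 1 := by
  induction k with
  | zero => simp
  | succ k ih =>
    rw [pow_succ', map_mul, Module.End.mul_apply, ih, regular_gen, regularGen_u]
    have : -(k : ℤ) - 1 = -((k + 1 : ℕ) : ℤ) := by push_cast; ring
    rw [this]
    simp [cocycleU]

lemma regular_wt (k : ℤ) : regular P (wt P k) (Finsupp.single 0 1) = Finsupp.single k 1 := by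
  rcases Int.le_total 0 k with h | h
  · lift k to ℕ using h
    rw [wt_ofNat, regular_v_pow]
  · obtain ⟨m, rfl⟩ : ∃ m : ℕ, k = -m := ⟨(-k).toNat, by omega⟩
    rw [wt_neg_ofNat, regular_u_pow]

/-- The PBW theorem: `𝒜_P` is free over `ℂ[z]` with basis `e_k`. -/
def coeffs : Quant P ≃ₗ[ℂ] (ℤ →₀ ℂ[X]) where
  toFun a := regular P a (Finsupp.single 0 1)
  map_add' a b := by simp
  map_smul' c a := by simp
  invFun := ofCoeffs P
  left_inv a := by
    rw [ofCoeffs_regular, ofCoeffs_single]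
    simp [zev, wt_zero]
  right_inv f := by
    change regular P (ofCoeffs P f) (Finsupp.single 0 1) = f
    induction f using Finsupp.induction_linear with
    | zero => simp
    | add f g hf hg => rw [map_add, map_add, LinearMap.add_apply, hf, hg]
    | single k R =>
      rw [ofCoeffs_single, map_mul, Module.End.mul_apply, regular_wt, regular_zev, mul_one]

lemma coeffs_symm (f : ℤ →₀ ℂ[X]) : (coeffs P).symm f = ofCoeffs P f := rfl

lemma coeffs_zev_mul_wt (R : ℂ[X]) (k : ℤ) :
    coeffs P (zev P R * wt P k) = Finsupp.single k R := by
  rw [← ofCoeffs_single, ← coeffs_symm, LinearEquiv.apply_symm_apply]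

/-- Induction along the PBW basis. -/
lemma Quant.induction_pbw {p : Quant P → Prop} (h0 : p 0)
    (ha : ∀ a b, p a → p b → p (a + b)) (hb : ∀ R k, p (zev P R * wt P k)) (a : Quant P) :
    p a := by
  obtain ⟨f, rfl⟩ := (coeffs P).symm.surjective a
  rw [coeffs_symm]
  induction f using Finsupp.induction_linear with
  | zero => simpa using h0
  | add f g hf hg => rw [map_add]; exact ha _ _ hf hg
  | single k R => rw [ofCoeffs_single]; exact hb R k

end PBW

end Kleinian

end

noncomputable section

namespace Kleinian

open Polynomial

/-! ### The adjoint of a polynomial -/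

/-- The adjoint polynomial `R̄(-X)`, whose values on the imaginary axis are conjugate to those of
`R`. -/
def adj (R : ℂ[X]) : ℂ[X] := (R.map (starRingEnd ℂ)).comp (-X)

lemma adj_mul (R S : ℂ[X]) : adj (R * S) = adj R * adj S := by simp [adj]

lemma adj_add (R S : ℂ[X]) : adj (R + S) = adj R + adj S := by simp [adj]

lemma adj_C (c : ℂ) : adj (C c) = C (starRingEnd ℂ c) := by simp [adj]

lemma adj_X : adj X = -X := by simp [adj]

lemma eval_adj (R : ℂ[X]) (x : ℂ) :
    (adj R).eval x = starRingEnd ℂ (R.eval (-starRingEnd ℂ x)) := by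
  have h : x = starRingEnd ℂ (starRingEnd ℂ x) := by simp
  rw [adj, eval_comp, eval_neg, eval_X]
  conv_lhs => rw [h, ← map_neg (starRingEnd ℂ), eval_map_apply]

lemma adj_adj (R : ℂ[X]) : adj (adj R) = R := by
  refine Polynomial.funext fun x => ?_
  simp [eval_adj]

lemma adj_ne_zero {R : ℂ[X]} (h : R ≠ 0) : adj R ≠ 0 := fun h' => h (by
  rw [← adj_adj R, h']; simp [adj])

/-- Reflection in the imaginary axis reverses real translations. -/
lemma adj_taylor (a : ℝ) (R : ℂ[X]) : adj (taylor (a : ℂ) R) = taylor (-a : ℂ) (adj R) := by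
  refine Polynomial.funext fun x => ?_
  simp only [eval_adj, taylor_eval]
  congr 2
  simp; ring

lemma taylor_ne_zero {a : ℂ} {R : ℂ[X]} (h : R ≠ 0) : taylor a R ≠ 0 := fun h' =>
  h (taylor_injective a (by simpa using h'))

lemma Parameter.adj_poly {n : ℕ} (P : Parameter n) : adj P.poly = (-1) ^ n * P.poly := P.conj

/-! ### Weights -/

section Weights

variable (P : ℂ[X])

/-- The coefficient in `ℂ[z]` of the basis element `e_k`. -/
def coeffAt (k : ℤ) : Quant P →ₗ[ℂ] ℂ[X] := Finsupp.lapply k ∘ₗ (coeffs P).toLinearMap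

lemma coeffAt_basis (k j : ℤ) (R : ℂ[X]) :
    coeffAt P k (zev P R * wt P j) = if j = k then R else 0 := by
  simp only [coeffAt, LinearMap.comp_apply, LinearEquiv.coe_coe, coeffs_zev_mul_wt,
    Finsupp.lapply_apply, Finsupp.single_apply]

lemma coeffAt_zev (R : ℂ[X]) : coeffAt P 0 (zev P R) = R := by
  have := coeffAt_basis P 0 0 R
  rwa [wt_zero, mul_one, if_pos rfl] at this

lemma eq_sum_coeffAt (a : Quant P) :
    a = ∑ k ∈ (coeffs P a).support, zev P (coeffAt P k a) * wt P k := by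
  conv_lhs => rw [← (coeffs P).symm_apply_apply a, coeffs_symm, ofCoeffs, Finsupp.lsum_apply,
    Finsupp.sum]
  rfl

variable {P}

/-- `a` has weight `k` with respect to `ad z`. -/
def HasWeight (k : ℤ) (a : Quant P) : Prop :=
  gen P Gen.z * a - a * gen P Gen.z = (k : ℂ) • a

lemma HasWeight.mul {k l : ℤ} {a b : Quant P} (ha : HasWeight k a) (hb : HasWeight l b) :
    HasWeight (k + l) (a * b) := by
  have : gen P Gen.z * (a * b) - a * b * gen P Gen.z =
      (gen P Gen.z * a - a * gen P Gen.z) * b + a * (gen P Gen.z * b - b * gen P Gen.z) := by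
    noncomm_ring
  rw [HasWeight, this, ha, hb]
  simp [add_smul]

lemma hasWeight_one : HasWeight 0 (1 : Quant P) := by simp [HasWeight]

lemma HasWeight.pow {k : ℤ} {a : Quant P} (ha : HasWeight k a) (m : ℕ) :
    HasWeight (m * k) (a ^ m) := by
  induction m with
  | zero => simpa using hasWeight_one
  | succ m ih =>
    rw [pow_succ]
    convert ih.mul ha using 1
    push_cast; ring

lemma hasWeight_u : HasWeight (-1) (gen P Gen.u) := by simpa [HasWeight] using gen_zu P

lemma hasWeight_v : HasWeight 1 (gen P Gen.v) := by simpa [HasWeight] using gen_zv P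

lemma hasWeight_zev (R : ℂ[X]) : HasWeight 0 (zev P R) := by
  have h1 : gen P Gen.z * zev P R = zev P (X * R) := by rw [zev, zev, map_mul, aeval_X]
  have h2 : zev P R * gen P Gen.z = zev P (R * X) := by rw [zev, zev, map_mul, aeval_X]
  rw [HasWeight, h1, h2, mul_comm, sub_self, Int.cast_zero, zero_smul]

lemma hasWeight_wt (k : ℤ) : HasWeight k (wt P k) := by
  rw [wt]
  convert (hasWeight_v.pow k.toNat).mul (hasWeight_u.pow (-k).toNat) using 1
  omega

lemma hasWeight_basis (R : ℂ[X]) (k : ℤ) : HasWeight k (zev P R * wt P k) := by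
  simpa using (hasWeight_zev R).mul (hasWeight_wt k)

/-- Commutation with z multiplies the coefficient of e_j by j; on an element of weight k it must
also multiply it by k. -/
lemma coeffAt_eq_zero {k j : ℤ} (h : j ≠ k) {a : Quant P} (ha : HasWeight k a) :
    coeffAt P j a = 0 := by
  have key : ∀ b : Quant P, coeffAt P j (gen P Gen.z * b - b * gen P Gen.z) =
      (j : ℂ) • coeffAt P j b := by
    intro b
    induction b using Quant.induction_pbw with
    | h0 => simp
    | ha a b h1 h2 =>
      rw [map_add, smul_add, ← h1, ← h2, ← map_add]
      congr 1; noncomm_ring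
    | hb R k =>
      rw [hasWeight_basis R k, map_smul, coeffAt_basis]
      split_ifs with h
      · rw [h]
      · simp
  have h1 := key a
  rw [ha, map_smul, ← sub_eq_zero, ← sub_smul, smul_eq_zero, sub_eq_zero] at h1
  exact h1.resolve_left fun h2 => h (by exact_mod_cast h2.symm)

end Weights

/-! ### The automorphism `s`, the antiautomorphism `σ` and the conjugation `ρ` -/

section Maps

variable {n : ℕ} (P : Parameter n)

lemma sAut_u : sAut P (gen P.poly Gen.u) = (-1 : ℂ) ^ n • gen P.poly Gen.u :=
  lift_gen _ _ _ _ _ _ _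

lemma sAut_v : sAut P (gen P.poly Gen.v) = (-1 : ℂ) ^ n • gen P.poly Gen.v :=
  lift_gen _ _ _ _ _ _ _

lemma sAut_z : sAut P (gen P.poly Gen.z) = gen P.poly Gen.z :=
  lift_gen _ _ _ _ _ _ _

lemma sigma_gen (x : Gen) : sigma P (gen P.poly x) = sigmaGen P x := lift_gen _ _ _ _ _ _ _

lemma sigma_mul (a b : Quant P.poly) :
    (sigma P (a * b)).unop = (sigma P b).unop * (sigma P a).unop := by
  rw [map_mul, MulOpposite.unop_mul]

lemma sigma_zev (R : ℂ[X]) : (sigma P (zev P.poly R)).unop = zev P.poly (R.comp (-X)) := by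
  rw [zev, ← aeval_algHom_apply, sigma_gen, sigmaGen, aeval_op, MulOpposite.unop_op, zev,
    aeval_comp]
  simp

lemma sigma_weight {k : ℤ} {a : Quant P.poly} (ha : HasWeight k a) :
    HasWeight k (sigma P a).unop := by
  have h : sigma P (gen P.poly Gen.z) = MulOpposite.op (-gen P.poly Gen.z) := sigma_gen P _
  have := congrArg (fun x => (sigma P x).unop) ha
  simp only [map_sub, map_mul, MulOpposite.unop_sub, MulOpposite.unop_mul, map_smul,
    MulOpposite.unop_smul, h, MulOpposite.unop_op] at this
  rw [HasWeight, ← this]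
  noncomm_ring

/-- This ties the twist to the grading: where σ acts by i^d, the automorphism s acts by (-1)^d. -/
lemma sAut_eq_sigma_sigma (a : Quant P.poly) :
    (sigma P (sigma P a).unop).unop = sAut P a := by
  have hI : Complex.I ^ n * Complex.I ^ n = (-1 : ℂ) ^ n := by
    rw [← mul_pow, Complex.I_mul_I]
  induction a using Quant.induction with
  | hs c =>
    rw [AlgHom.commutes, AlgHom.commutes, MulOpposite.algebraMap_apply, MulOpposite.unop_op,
      AlgHom.commutes, MulOpposite.algebraMap_apply, MulOpposite.unop_op]
  | hg x =>
    cases x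
    · rw [sAut_u, sigma_gen, sigmaGen, MulOpposite.unop_op, map_smul, sigma_gen, sigmaGen,
        MulOpposite.unop_smul, MulOpposite.unop_op, smul_smul, hI]
    · rw [sAut_v, sigma_gen, sigmaGen, MulOpposite.unop_op, map_smul, sigma_gen, sigmaGen,
        MulOpposite.unop_smul, MulOpposite.unop_op, smul_smul, hI]
    · rw [sAut_z, sigma_gen, sigmaGen, MulOpposite.unop_op, map_neg, sigma_gen, sigmaGen,
        MulOpposite.unop_neg, MulOpposite.unop_op, neg_neg]
  | hm a b h1 h2 => rw [sigma_mul, sigma_mul, h1, h2, map_mul]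
  | ha a b h1 h2 => rw [map_add, MulOpposite.unop_add, map_add, MulOpposite.unop_add, h1, h2,
      map_add]

variable (ε : ℤˣ)

lemma rho_mul (a b : Quant P.poly) : rho P ε (a * b) = rho P ε a * rho P ε b :=
  map_mul (conjHom P (conjConst n ε) (conjConst_ne_zero n ε)) a b

lemma rho_one : rho P ε 1 = 1 := map_one (conjHom P (conjConst n ε) (conjConst_ne_zero n ε))

lemma rho_gen (x : Gen) : rho P ε (gen P.poly x) = conjGen P (conjConst n ε) x :=
  lift_gen (B := ConjQuant P.poly) P.poly (conjGen P (conjConst n ε)) _ _ _ _ x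

lemma rho_algebraMap (c : ℂ) : rho P ε (algebraMap ℂ _ c) = algebraMap ℂ _ (starRingEnd ℂ c) := by
  rw [Algebra.algebraMap_eq_smul_one, map_smulₛₗ, rho_one, Algebra.algebraMap_eq_smul_one]

lemma rho_zev (R : ℂ[X]) : rho P ε (zev P.poly R) = zev P.poly (adj R) := by
  induction R using Polynomial.induction_on with
  | C a => rw [zev, aeval_C, rho_algebraMap, adj_C, zev, aeval_C]
  | add p q hp hq => simp only [zev, map_add, adj_add] at *; rw [hp, hq]
  | monomial k a h =>
    rw [pow_succ, ← mul_assoc, zev, map_mul, rho_mul, h, adj_mul _ X, zev, zev, map_mul _ _ (adj X), aeval_X,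
      rho_gen, adj_X, map_neg, aeval_X, conjGen]

lemma rho_weight {k : ℤ} {a : Quant P.poly} (ha : HasWeight k a) :
    HasWeight (-k) (rho P ε a) := by
  have := congrArg (rho P ε) ha
  rw [map_sub, rho_mul, rho_mul, rho_gen, map_smulₛₗ, conjGen, map_intCast] at this
  rw [HasWeight, Int.cast_neg, neg_smul, ← this]
  noncomm_ring

/-- The constant `λ` is the sign of `ε` relative to the canonical sign, times `(-1)^n`. -/
lemma conjConst_eq : conjConst n ε = ((ε * canonicalSign n : ℤˣ) : ℤ) * (-1) ^ n := by
  -- Both sides depend only on n mod 4, so four cases remain.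
  obtain ⟨q, r, hr, rfl⟩ : ∃ q r, r < 4 ∧ n = 4 * q + r :=
    ⟨n / 4, n % 4, Nat.mod_lt _ (by norm_num), by omega⟩
  have hI : Complex.I ^ (4 * q + r) = Complex.I ^ r := by
    rw [pow_add, pow_mul, Complex.I_pow_four, one_pow, one_mul]
  have h1 : (-1 : ℂ) ^ (4 * q + r) = (-1) ^ r := by
    rw [pow_add, pow_mul]; norm_num
  have he : Complex.exp (-(Complex.I * (Real.pi * 2⁻¹))) = -Complex.I := by
    rw [show -(Complex.I * (Real.pi * 2⁻¹) : ℂ) = ((-(Real.pi / 2) : ℝ) : ℂ) * Complex.I by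
      push_cast; ring, Complex.exp_mul_I, ← Complex.ofReal_cos, ← Complex.ofReal_sin]
    simp
  have hm : (4 * q + r) % 4 = r := by omega
  have hp : Even (4 * q + r) ↔ Even r := by
    rw [Nat.even_add, iff_true_left (Even.mul_right (by decide) q)]
  rw [conjConst, cParam, canonicalSign, hI, h1, hm]
  simp only [hp]
  interval_cases r
  · simp
  · simp [mul_assoc, mul_left_comm, he]
  · simp
  · have : ¬ Even 3 := by decide
    simp [this, pow_succ, mul_assoc, mul_left_comm, he]

/-- The constant is a sign, so its k-th power depends only on the parity of k. This is why two
weights of the same parity impose compatible positivity conditions. -/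
lemma conjConst_mul_self : conjConst n ε * conjConst n ε = 1 := by
  rw [conjConst_eq]
  rcases Int.units_eq_one_or (ε * canonicalSign n) with h | h <;> rw [h] <;>
    simp [← mul_pow]

lemma conj_conjConst : starRingEnd ℂ (conjConst n ε) = conjConst n ε := by
  rw [conjConst_eq]; simp

lemma conjConst_inv : (conjConst n ε)⁻¹ = conjConst n ε :=
  inv_eq_of_mul_eq_one_left (conjConst_mul_self ε)

lemma rho_rho (a : Quant P.poly) : rho P ε (rho P ε a) = sAut P a := by
  induction a using Quant.induction with
  | hs c => rw [rho_algebraMap, rho_algebraMap, Complex.conj_conj, AlgHom.commutes]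
  | hg x =>
    cases x
    · rw [sAut_u, rho_gen, conjGen, map_smulₛₗ, rho_gen, conjGen, smul_smul, conjConst_inv,
        map_mul, conj_conjConst, mul_assoc, conjConst_mul_self]
      simp
    · rw [sAut_v, rho_gen, conjGen, map_smulₛₗ, rho_gen, conjGen, smul_smul, conjConst_inv,
        conj_conjConst, mul_left_comm, conjConst_mul_self, mul_one]
    · rw [sAut_z, rho_gen, conjGen, map_neg, rho_gen, conjGen, neg_neg]
  | hm a b h1 h2 => rw [rho_mul, rho_mul, h1, h2, map_mul]
  | ha a b h1 h2 => rw [map_add, map_add, h1, h2, map_add]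

lemma sAut_sAut (a : Quant P.poly) : sAut P (sAut P a) = a := by
  have hI : (-1 : ℂ) ^ n * (-1 : ℂ) ^ n = 1 := by rw [← mul_pow]; simp
  induction a using Quant.induction with
  | hs c => rw [AlgHom.commutes, AlgHom.commutes]
  | hg x =>
    cases x
    · rw [sAut_u, map_smul, sAut_u, smul_smul, hI, one_smul]
    · rw [sAut_v, map_smul, sAut_v, smul_smul, hI, one_smul]
    · rw [sAut_z, sAut_z]
  | hm a b h1 h2 => rw [map_mul, map_mul, h1, h2]
  | ha a b h1 h2 => rw [map_add, map_add, h1, h2]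

end Maps

end Kleinian

end

noncomputable section

namespace Kleinian

open Polynomial

/-! ### Traces on `𝒜_P` in terms of functionals on `ℂ[z]` -/

section Traces

variable {n : ℕ} (P : Parameter n)

/-- The extension by zero of a functional on the weight zero part `ℂ[z]`. -/
def extend (τ : ℂ[X] →ₗ[ℂ] ℂ) : Quant P.poly →ₗ[ℂ] ℂ := τ ∘ₗ coeffAt P.poly 0

variable {P}

lemma extend_zev (τ : ℂ[X] →ₗ[ℂ] ℂ) (R : ℂ[X]) : extend P τ (zev P.poly R) = τ R := by
  rw [extend, LinearMap.comp_apply, coeffAt_zev]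

lemma extend_weight (τ : ℂ[X] →ₗ[ℂ] ℂ) {k : ℤ} (hk : k ≠ 0) {a : Quant P.poly}
    (ha : HasWeight k a) : extend P τ a = 0 := by
  rw [extend, LinearMap.comp_apply, coeffAt_eq_zero hk.symm ha, map_zero]

variable (P) in
/-- The functionals on `ℂ[z]` corresponding to the even `s`-twisted traces. -/
structure IsEvenTrace (τ : ℂ[X] →ₗ[ℂ] ℂ) : Prop where
  trace : ∀ S, τ (taylor (1 / 2) (S * P.poly)) = (-1) ^ n * τ (taylor (-(1 / 2)) (S * P.poly))
  even : ∀ R, τ (R.comp (-X)) = τ R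

variable (P) in
/-- The functionals on `ℂ[z]` corresponding to the even positive traces. -/
structure IsPositive (ε : ℤˣ) (τ : ℂ[X] →ₗ[ℂ] ℂ) : Prop extends IsEvenTrace P τ where
  hermitian : ∀ R, τ (adj R) = starRingEnd ℂ (τ R)
  pos : ∀ M, M ≠ 0 → 0 < (τ (M * adj M)).re
  pos_shift : ∀ M, M ≠ 0 →
    0 < (conjConst n ε * τ (taylor (-(1 / 2)) (M * adj M * P.poly))).re

lemma v_zev_u (S : ℂ[X]) : gen P.poly Gen.v * zev P.poly S * gen P.poly Gen.u =
    zev P.poly (taylor (-1) S * taylor (-(1 / 2)) P.poly) := by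
  rw [gen_v_mul_zev, mul_assoc, gen_vu', zev, zev, zev, map_mul]

lemma u_zev_v (S : ℂ[X]) : gen P.poly Gen.u * zev P.poly S * gen P.poly Gen.v =
    zev P.poly (taylor 1 S * taylor (1 / 2) P.poly) := by
  rw [gen_u_mul_zev, mul_assoc, gen_uv', zev, zev, zev, map_mul]

/-- Since s fixes z, the trace relation for z says that T kills commutators with z, and on weight k
such a commutator is multiplication by k. -/
lemma isTrace_weight {T : Quant P.poly →ₗ[ℂ] ℂ} (hT : ∀ a b, T (a * b) = T (b * sAut P a))
    {k : ℤ} (hk : k ≠ 0) {a : Quant P.poly} (ha : HasWeight k a) : T a = 0 := by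
  have h := hT (gen P.poly Gen.z) a
  rw [sAut_z, ← sub_eq_zero, ← map_sub, ha, map_smul, smul_eq_mul, mul_eq_zero] at h
  exact h.resolve_left (by exact_mod_cast hk)

/-- The conditions on τ are those on T tested on a few elements: the trace relation on u against
ℂ[z]v, and positivity on ℂ[z] and on ℂ[z]v. -/
lemma isPositive_of_mem {ε : ℤˣ} {T : Quant P.poly →ₗ[ℂ] ℂ} (hT : T ∈ positiveEvenTraces P ε) :
    ∃ τ, T = extend P τ ∧ IsPositive P ε τ := by
  obtain ⟨h1, h2, h3, h4⟩ := hT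
  refine ⟨T ∘ₗ (aeval (gen P.poly Gen.z)).toLinearMap, ?_, ⟨⟨fun S => ?_, fun R => ?_⟩,
    fun R => ?_, fun M hM => ?_, fun M hM => ?_⟩⟩
  · ext a
    induction a using Quant.induction_pbw with
    | h0 => simp
    | ha a b h1 h2 => rw [map_add, h1, h2, map_add]
    | hb R k =>
      by_cases hk : k = 0
      · subst hk
        rw [wt_zero, mul_one, extend_zev]
        rfl
      · rw [isTrace_weight h1 hk (hasWeight_basis R k), extend_weight _ hk (hasWeight_basis R k)]
  -- The half shift of S makes the relation symmetric about the imaginary axis.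
  · have h := h1 (gen P.poly Gen.u) (zev P.poly (taylor (-(1 / 2)) S) * gen P.poly Gen.v)
    rw [← mul_assoc, u_zev_v, sAut_u, mul_smul_comm, map_smul, mul_assoc, gen_vu', taylor_taylor,
      zev, zev, zev, ← map_mul] at h
    norm_num at h
    simpa [taylor_mul] using h
  · have h := h2 (zev P.poly R)
    rwa [sigma_zev] at h
  · have h := h3 (zev P.poly R) 1
    rw [one_mul, rho_zev, rho_one, mul_one] at h
    exact h
  · have h := h4 (zev P.poly M) (fun h => hM (by rw [← coeffAt_zev P.poly M, h, map_zero]))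
    rw [rho_zev, zev, zev, ← map_mul] at h
    exact h
  -- Taking M(z - 1/2) v makes M, its adjoint and P all appear with the same shift by -1/2.
  · have hM' : taylor (-(1 / 2)) M ≠ 0 := taylor_ne_zero hM
    have h := h4 (zev P.poly (taylor (-(1 / 2)) M) * wt P.poly 1) (fun h => hM' (by
      have := coeffAt_basis P.poly 1 1 (taylor (-(1 / 2)) M)
      rw [h, map_zero, if_pos rfl] at this
      exact this.symm))
    have hw : wt P.poly 1 = gen P.poly Gen.v := by simp [wt]
    have ha := adj_taylor (-(1 / 2)) M
    push_cast at ha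
    rw [hw, rho_mul, rho_zev, rho_gen, conjGen, mul_smul_comm, mul_smul_comm, map_smul, mul_assoc,
      ← mul_assoc (gen P.poly Gen.v), v_zev_u, ha, taylor_taylor, zev, zev, ← map_mul] at h
    norm_num at h
    simpa [taylor_mul, mul_assoc] using h

/-- Because s is multiplicative, the relation for two elements gives it for their product, so a may
be a generator. Against PBW elements, z is immediate by weights, and u and v only see weights 1 and
-1, where the relation is the difference equation for τ. -/
lemma isTrace_extend {τ : ℂ[X] →ₗ[ℂ] ℂ} (h : IsEvenTrace P τ) (a b : Quant P.poly) :
    extend P τ (a * b) = extend P τ (b * sAut P a) := by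
  have hI : (-1 : ℂ) ^ n * (-1 : ℂ) ^ n = 1 := by rw [← mul_pow]; simp
  induction a using Quant.induction generalizing b with
  | hs c => rw [AlgHom.commutes, Algebra.commutes]
  | hm a a' h1 h2 => rw [mul_assoc, h1, mul_assoc, h2, mul_assoc, map_mul (sAut P)]
  | ha a a' h1 h2 => rw [add_mul, map_add, h1, h2, map_add, mul_add, map_add]
  | hg x =>
    induction b using Quant.induction_pbw with
    | h0 => simp
    | ha b b' h1 h2 => rw [mul_add, map_add, h1, h2, ← map_add, ← add_mul]
    | hb R k =>
      have hb := hasWeight_basis (P := P.poly) R k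
      cases x with
      | z =>
        rw [sAut_z, ← sub_eq_zero, ← map_sub, hb, map_smul]
        by_cases hk : k = 0
        · simp [hk]
        · rw [extend_weight τ hk hb, smul_zero]
      | u =>
        rw [sAut_u, mul_smul_comm, map_smul]
        by_cases hk : k = 1
        · subst hk
          have hw : wt P.poly 1 = gen P.poly Gen.v := by simp [wt]
          have := h.trace (taylor (1 / 2) R)
          rw [hw, ← mul_assoc, u_zev_v, mul_assoc, gen_vu', zev, zev, zev, ← map_mul, ← zev, ← zev,
            extend_zev, extend_zev]
          rw [taylor_mul, taylor_mul, taylor_taylor, taylor_taylor] at this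
          norm_num at this ⊢
          exact this
        · rw [extend_weight τ _ (hasWeight_u.mul hb), extend_weight τ _ (hb.mul hasWeight_u),
            smul_zero] <;> omega
      | v =>
        rw [sAut_v, mul_smul_comm, map_smul]
        by_cases hk : k = -1
        · subst hk
          have hw : wt P.poly (-1) = gen P.poly Gen.u := by simp [wt]
          have := h.trace (taylor (-(1 / 2)) R)
          rw [hw, ← mul_assoc, v_zev_u, mul_assoc, gen_uv', zev, zev, zev, ← map_mul, ← zev, ← zev,
            extend_zev, extend_zev]
          rw [taylor_mul, taylor_mul, taylor_taylor, taylor_taylor] at this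
          norm_num at this ⊢
          rw [this, ← mul_assoc, hI, one_mul]
        · rw [extend_weight τ _ (hasWeight_v.mul hb), extend_weight τ _ (hb.mul hasWeight_v),
            smul_zero] <;> omega

lemma extend_sigma {τ : ℂ[X] →ₗ[ℂ] ℂ} (h : IsEvenTrace P τ) (a : Quant P.poly) :
    extend P τ (sigma P a).unop = extend P τ a := by
  induction a using Quant.induction_pbw with
  | h0 => simp
  | ha b b' h1 h2 => rw [map_add, MulOpposite.unop_add, map_add, h1, h2, map_add]
  | hb R k =>
    by_cases hk : k = 0
    · subst hk
      rw [wt_zero, mul_one, sigma_zev, extend_zev, extend_zev, h.even]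
    · have hb := hasWeight_basis (P := P.poly) R k
      rw [extend_weight τ hk hb, extend_weight τ hk (sigma_weight P hb)]

lemma extend_rho {ε : ℤˣ} {τ : ℂ[X] →ₗ[ℂ] ℂ} (h : ∀ R, τ (adj R) = starRingEnd ℂ (τ R))
    (a : Quant P.poly) :
    extend P τ (rho P ε a) = starRingEnd ℂ (extend P τ a) := by
  induction a using Quant.induction_pbw with
  | h0 => simp
  | ha b b' h1 h2 => rw [map_add, map_add, h1, h2, map_add, map_add]
  | hb R k =>
    by_cases hk : k = 0
    · subst hk
      rw [wt_zero, mul_one, rho_zev, extend_zev, extend_zev, h]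
    · have hb := hasWeight_basis (P := P.poly) R k
      rw [extend_weight τ hk hb, extend_weight τ (neg_ne_zero.2 hk) (rho_weight P ε hb), map_zero]

variable (P) in
/-- The polynomial with `v ^ k * u ^ k = Π_k(z - k/2)`. -/
def stringPoly (k : ℕ) : ℂ[X] := ∏ j ∈ Finset.range k, taylor ((k - 1 : ℂ) / 2 - j) P.poly

lemma taylor_prod {ι : Type} (s : Finset ι) (f : ι → ℂ[X]) (a : ℂ) :
    taylor a (∏ i ∈ s, f i) = ∏ i ∈ s, taylor a (f i) :=
  map_prod (taylorAlgHom a) f s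

lemma v_pow_mul_u_pow (k : ℕ) : gen P.poly Gen.v ^ k * gen P.poly Gen.u ^ k =
    zev P.poly (taylor (-(k / 2 : ℂ)) (stringPoly P k)) := by
  -- The induction produces the uncentred product of the P(z - 1/2 - j); translating by k/2 makes it
  -- symmetric.
  have key : ∀ k : ℕ, gen P.poly Gen.v ^ k * gen P.poly Gen.u ^ k =
      zev P.poly (∏ j ∈ Finset.range k, taylor (-(1 / 2) - j : ℂ) P.poly) := by
    intro k
    induction k with
    | zero => simp
    | succ k ih =>
      rw [pow_succ', pow_succ, mul_assoc, ← mul_assoc (_ ^ k), ih, ← mul_assoc, v_zev_u,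
        taylor_prod, Finset.prod_range_succ']
      simp only [taylor_taylor]
      congr 2
      · refine Finset.prod_congr rfl fun j _ => ?_
        congr 2; push_cast; ring
      · norm_num
  rw [key, stringPoly, taylor_prod]
  simp only [taylor_taylor]
  congr 1
  refine Finset.prod_congr rfl fun j _ => ?_
  congr 2; ring

/-- Going from k to k + 2 adds one factor at each end. These two are adjoint to each other up to
(-1)^n, so together they can be absorbed into a product M * adj M. -/
lemma stringPoly_add_two (k : ℕ) : stringPoly P (k + 2) =
    taylor ((k + 1) / 2 : ℂ) P.poly * taylor (-((k + 1) / 2 : ℂ)) P.poly * stringPoly P k := by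
  rw [stringPoly, Finset.prod_range_succ, Finset.prod_range_succ', stringPoly]
  have h : ∀ j : ℕ, ((((k + 2 : ℕ) : ℂ) - 1) / 2 - ((j + 1 : ℕ) : ℂ)) = ((k - 1 : ℂ) / 2 - j) := by
    intro j; push_cast; ring
  simp only [h]
  have h1 : (((k + 2 : ℕ) : ℂ) - 1) / 2 - ((0 : ℕ) : ℂ) = (k + 1) / 2 := by push_cast; ring
  have h2 : (k - 1 : ℂ) / 2 - k = -((k + 1) / 2) := by ring
  rw [h1, h2]
  ring

/-- In the step from k to k + 2, positivity for k is applied to M times the new outer factor Q, and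
the trace relation then moves the argument by one unit. The signs (-1)^n coming from adj Q and from
the trace relation cancel, and λ² = 1. -/
lemma IsPositive.string {ε : ℤˣ} {τ : ℂ[X] →ₗ[ℂ] ℂ} (h : IsPositive P ε τ) (k : ℕ) (M : ℂ[X])
    (hM : M ≠ 0) :
    0 < (conjConst n ε ^ k * τ (taylor (-(k / 2 : ℂ)) (M * adj M * stringPoly P k))).re := by
  induction k using Nat.twoStepInduction generalizing M with
  | zero => simpa [stringPoly] using h.pos M hM
  | one => simpa [stringPoly] using h.pos_shift M hM
  | more k ih _ =>
    have hI : (-1 : ℂ) ^ n * (-1 : ℂ) ^ n = 1 := by rw [← mul_pow]; simp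
    set Q := taylor ((k + 1) / 2 : ℂ) P.poly with hQ
    have hQ0 : Q ≠ 0 := taylor_ne_zero P.monic.ne_zero
    have hadj : adj Q = (-1) ^ n * taylor (-((k + 1) / 2 : ℂ)) P.poly := by
      have := adj_taylor ((k + 1) / 2) P.poly
      push_cast at this
      rw [hQ, this, P.adj_poly, taylor_mul]
      congr 1
      rcases neg_one_pow_eq_or ℂ[X] n with h | h <;> rw [h] <;> simp
    have := ih (M * Q) (mul_ne_zero hM hQ0)
    have h2 : conjConst n ε ^ (k + 2) = conjConst n ε ^ k := by
      rw [pow_add, pow_two, conjConst_mul_self, mul_one]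
    rw [h2]
    -- With this test polynomial the two sides of the trace relation are centred at -k/2 and
    -- -(k+2)/2, the centres for the strings of length k and k + 2.
    have h3 := h.trace (taylor (-((k + 1) / 2 : ℂ))
      (M * adj M * taylor (-((k + 1) / 2 : ℂ)) P.poly * stringPoly P k))
    have h4 : taylor (-((k + 1) / 2 : ℂ))
        (M * adj M * taylor (-((k + 1) / 2 : ℂ)) P.poly * stringPoly P k) * P.poly =
        taylor (-((k + 1) / 2 : ℂ)) (M * adj M * stringPoly P (k + 2)) := by
      rw [stringPoly_add_two]
      simp only [taylor_mul, taylor_taylor, neg_add_cancel, taylor_zero]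
      ring
    have h5 : M * Q * adj (M * Q) * stringPoly P k =
        ((-1 : ℂ) ^ n) • (M * adj M * stringPoly P (k + 2)) := by
      rw [stringPoly_add_two, adj_mul, hadj, smul_eq_C_mul]
      simp only [map_pow, map_neg, map_one]
      ring
    rw [h4, taylor_taylor, taylor_taylor] at h3
    rw [h5, map_smul, map_smul, smul_eq_mul] at this
    have h6 : (1 / 2 : ℂ) + -((k + 1) / 2) = -(k / 2) := by ring
    have h7 : -(1 / 2 : ℂ) + -((k + 1) / 2) = -(((k + 2 : ℕ) : ℂ) / 2) := by push_cast; ring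
    rw [h6, h7] at h3
    rwa [h3, ← mul_assoc ((-1) ^ n), hI, one_mul] at this

/-- In weight m ≥ 0 this is `IsPositive.string` after moving polynomials past v^m and recentring by
m/2. In negative weight, T(a ρ(a)) = T(ρ(a) s(a)) = T(ρ(a) ρ(ρ(a))), and ρ(a) has nonnegative
weight. -/
lemma extend_mul_rho_pos {ε : ℤˣ} {τ : ℂ[X] →ₗ[ℂ] ℂ} (h : IsPositive P ε τ) (k : ℤ) (R : ℂ[X])
    (hR : R ≠ 0) : 0 < (extend P τ (zev P.poly R * wt P.poly k *
      rho P ε (zev P.poly R * wt P.poly k))).re := by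
  have key : ∀ (m : ℕ) (M : ℂ[X]), M ≠ 0 → 0 < (extend P τ (zev P.poly M * gen P.poly Gen.v ^ m *
      rho P ε (zev P.poly M * gen P.poly Gen.v ^ m))).re := by
    intro m M hM
    have hM' : taylor (m / 2 : ℂ) M ≠ 0 := taylor_ne_zero hM
    have hr : rho P ε (gen P.poly Gen.v ^ m) = conjConst n ε ^ m • gen P.poly Gen.u ^ m := by
      induction m with
      | zero => simp [rho_one]
      | succ m ih => rw [pow_succ, rho_mul, ih (taylor_ne_zero hM), rho_gen, conjGen,
          smul_mul_smul_comm, pow_succ,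
          pow_succ]
    have hv : ∀ (m : ℕ) (S : ℂ[X]), gen P.poly Gen.v ^ m * zev P.poly S =
        zev P.poly (taylor (-m : ℂ) S) * gen P.poly Gen.v ^ m := by
      intro m
      induction m with
      | zero => simp
      | succ m ih =>
        intro S
        rw [pow_succ, mul_assoc, gen_v_mul_zev, ← mul_assoc, ih, mul_assoc, taylor_taylor]
        congr 3
        push_cast; ring_nf
    have hadj := adj_taylor (m / 2) M
    push_cast at hadj
    have h1 := h.string m _ hM'
    rw [rho_mul, rho_zev, hr, mul_smul_comm, mul_smul_comm, map_smul, smul_eq_mul]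
    rw [show zev P.poly M * gen P.poly Gen.v ^ m * (zev P.poly (adj M) * gen P.poly Gen.u ^ m) =
      zev P.poly M * (gen P.poly Gen.v ^ m * zev P.poly (adj M)) * gen P.poly Gen.u ^ m by
        noncomm_ring, hv, ← mul_assoc, mul_assoc, v_pow_mul_u_pow, zev, zev, zev, ← map_mul,
        ← map_mul, extend_zev]
    rw [hadj, taylor_mul, taylor_mul, taylor_taylor, taylor_taylor] at h1
    convert h1 using 6
    · rw [neg_add_cancel, taylor_zero]
    · congr 2; ring
  rcases Int.le_total 0 k with hk | hk
  · lift k to ℕ using hk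
    rw [wt_ofNat]
    exact key k R hR
  · obtain ⟨m, rfl⟩ : ∃ m : ℕ, k = -m := ⟨(-k).toNat, by omega⟩
    rw [wt_neg_ofNat]
    set a := zev P.poly R * gen P.poly Gen.u ^ m with ha
    have h2 : ∃ c : ℂ, c ≠ 0 ∧ rho P ε (gen P.poly Gen.u ^ m) = c • gen P.poly Gen.v ^ m := by
      refine ⟨((-1) ^ n * (conjConst n ε)⁻¹) ^ m, by simp [conjConst_ne_zero], ?_⟩
      induction m with
      | zero => simp [rho_one]
      | succ m ih => rw [pow_succ, rho_mul, ih (by omega) rfl, rho_gen, conjGen, smul_mul_smul_comm,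
          pow_succ, pow_succ]
    obtain ⟨c, hc, h2⟩ := h2
    have h3 : rho P ε a = zev P.poly (c • adj R) * gen P.poly Gen.v ^ m := by
      rw [ha, rho_mul, h2, rho_zev, zev, zev, map_smul, smul_mul_assoc, mul_smul_comm]
    have h4 := key m (c • adj R) (smul_ne_zero hc (adj_ne_zero hR))
    rwa [← h3, rho_rho, ← isTrace_extend h.toIsEvenTrace] at h4

/-- Since ρ negates weights, different weight spaces are orthogonal, and definiteness reduces to the
diagonal terms of `extend_mul_rho_pos`. -/
lemma extend_mem {ε : ℤˣ} {τ : ℂ[X] →ₗ[ℂ] ℂ} (h : IsPositive P ε τ) :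
    extend P τ ∈ positiveEvenTraces P ε := by
  refine ⟨isTrace_extend h.toIsEvenTrace, extend_sigma h.toIsEvenTrace, fun a b => ?_,
    fun a ha => ?_⟩
  -- Conjugation becomes ρ inside T, then ρ² = s, and the trace property moves s(b) to the front as
  -- b.
  · rw [← extend_rho (ε := ε) h.hermitian, rho_mul, rho_rho, ← isTrace_extend h.toIsEvenTrace]
  · have h0 : extend P τ (a * rho P ε a) = ∑ k ∈ (coeffs P.poly a).support,
        extend P τ (zev P.poly (coeffAt P.poly k a) * wt P.poly k *
          rho P ε (zev P.poly (coeffAt P.poly k a) * wt P.poly k)) := by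
      conv_lhs => rw [eq_sum_coeffAt P.poly a, map_sum, Finset.sum_mul, map_sum]
      refine Finset.sum_congr rfl fun k hk => ?_
      rw [Finset.mul_sum, map_sum, Finset.sum_eq_single_of_mem k hk]
      intro l _ hl
      exact extend_weight τ (by omega : k + -l ≠ 0)
        ((hasWeight_basis _ _).mul (rho_weight P ε (hasWeight_basis _ _)))
    rw [h0, Complex.re_sum]
    refine Finset.sum_pos (fun k hk => extend_mul_rho_pos h k _ (Finsupp.mem_support_iff.1 hk)) ?_
    rw [Finsupp.support_nonempty_iff]
    exact fun h => ha ((coeffs P.poly).map_eq_zero_iff.1 h)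

end Traces

end Kleinian

end

noncomputable section

namespace Kleinian

open Polynomial MeasureTheory Filter Topology

/-! ### Exponential bounds on vertical strips -/

/-- `‖G z‖ ≤ C exp (κ |Im z|)` on `U`. -/
def ExpBound (U : Set ℂ) (κ : ℝ) (G : ℂ → ℂ) : Prop :=
  ∃ C : ℝ, ∀ z ∈ U, ‖G z‖ ≤ C * Real.exp (κ * |z.im|)

namespace ExpBound

variable {U : Set ℂ} {κ κ' : ℝ} {G G' : ℂ → ℂ}

lemma mul (h : ExpBound U κ G) (h' : ExpBound U κ' G') :
    ExpBound U (κ + κ') fun z => G z * G' z := by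
  obtain ⟨C, hC⟩ := h
  obtain ⟨C', hC'⟩ := h'
  refine ⟨C * C', fun z hz => ?_⟩
  rw [norm_mul, add_mul, Real.exp_add, mul_mul_mul_comm]
  exact mul_le_mul (hC z hz) (hC' z hz) (norm_nonneg _) ((norm_nonneg _).trans (hC z hz))

lemma add (h : ExpBound U κ G) (h' : ExpBound U κ G') :
    ExpBound U κ fun z => G z + G' z := by
  obtain ⟨C, hC⟩ := h
  obtain ⟨C', hC'⟩ := h'
  refine ⟨C + C', fun z hz => ?_⟩
  rw [add_mul]
  exact (norm_add_le _ _).trans (add_le_add (hC z hz) (hC' z hz))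

lemma mono (h : ExpBound U κ G) (hk : κ ≤ κ') : ExpBound U κ' G := by
  obtain ⟨C, hC⟩ := h
  refine ⟨|C|, fun z hz => (hC z hz).trans ?_⟩
  exact mul_le_mul (le_abs_self C) (Real.exp_le_exp.2 (by gcongr)) (by positivity) (by positivity)

lemma subset {V : Set ℂ} (h : ExpBound U κ G) (hV : V ⊆ U) : ExpBound V κ G := by
  obtain ⟨C, hC⟩ := h
  exact ⟨C, fun z hz => hC z (hV hz)⟩

lemma const (U : Set ℂ) (c : ℂ) : ExpBound U 0 fun _ => c := ⟨‖c‖, fun z _ => by simp⟩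

lemma congr (h : ExpBound U κ G) (hG : ∀ z ∈ U, G z = G' z) : ExpBound U κ G' := by
  obtain ⟨C, hC⟩ := h
  exact ⟨C, fun z hz => by rw [← hG z hz]; exact hC z hz⟩

lemma multiset_prod (s : Multiset ℂ) {G : ℂ → ℂ → ℂ} (h : ∀ α ∈ s, ExpBound U κ (G α)) :
    ExpBound U (s.card * κ) fun z => (s.map fun α => G α z).prod := by
  induction s using Multiset.induction_on with
  | empty => simpa using const U 1
  | cons a s ih =>
    have h1 := (h a (Multiset.mem_cons_self a s)).mul
      (ih fun α hα => h α (Multiset.mem_cons_of_mem hα))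
    simp only [Multiset.map_cons, Multiset.prod_cons, Multiset.card_cons]
    convert h1 using 1
    push_cast; ring

lemma comp_sub {V : Set ℂ} (α : ℂ) (h : ExpBound V κ G) (hU : ∀ z ∈ U, z - α ∈ V) :
    ExpBound U κ fun z => G (z - α) := by
  obtain ⟨C, hC⟩ := h
  refine ⟨|C| * Real.exp (|κ| * |α.im|), fun z hz => (hC _ (hU z hz)).trans ?_⟩
  rw [mul_assoc, ← Real.exp_add]
  refine mul_le_mul (le_abs_self C) (Real.exp_le_exp.2 ?_) (by positivity) (by positivity)
  have h1 : |(|(z - α).im| - |z.im|)| ≤ |α.im| := by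
    refine (abs_abs_sub_abs_le_abs_sub _ _).trans ?_
    simp
  have h2 : κ * (|(z - α).im| - |z.im|) ≤ |κ| * |α.im| := by
    refine (le_abs_self _).trans ?_
    rw [abs_mul]
    gcongr
  linarith

end ExpBound

lemma one_add_le_exp_mul {δ : ℝ} (hδ : 0 < δ) {t : ℝ} (ht : 0 ≤ t) :
    1 + t ≤ (1 + δ⁻¹) * Real.exp (δ * t) := by
  have h1 : δ * t + 1 ≤ Real.exp (δ * t) := Real.add_one_le_exp _
  have h2 : (1 + δ⁻¹) * (δ * t + 1) = 1 + t + δ * t + δ⁻¹ := by field_simp; ring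
  have h3 : (1 + δ⁻¹) * (δ * t + 1) ≤ (1 + δ⁻¹) * Real.exp (δ * t) := by gcongr
  have : 0 ≤ δ * t := by positivity
  have : 0 < δ⁻¹ := by positivity
  linarith

/-- The closed strip `|Re z| ≤ r`. -/
def strip (r : ℝ) : Set ℂ := {z | |z.re| ≤ r}

/-- A polynomial costs an arbitrarily small exponential rate. Each further factor X takes half of
the available δ, hence the induction over all δ. -/
lemma expBound_eval (R : ℂ[X]) (r : ℝ) {δ : ℝ} (hδ : 0 < δ) :
    ExpBound (strip r) δ fun z => R.eval z := by
  induction R using Polynomial.induction_on generalizing δ with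
  | C a => simpa using (ExpBound.const (strip r) a).mono hδ.le
  | add p q hp hq => simpa using (hp hδ).add (hq hδ)
  | monomial k a h =>
    have hX : ExpBound (strip r) (δ / 2) fun z => z := by
      refine ⟨(1 + |r|) * (1 + (δ / 2)⁻¹), fun z hz => ?_⟩
      have hz' : |z.re| ≤ |r| := le_trans hz (le_abs_self r)
      have h1 : ‖z‖ ≤ |z.re| + |z.im| := Complex.norm_le_abs_re_add_abs_im z
      have h2 := one_add_le_exp_mul (half_pos hδ) (abs_nonneg z.im)
      rw [mul_assoc]
      have h3 : ‖z‖ ≤ (1 + |r|) * (1 + |z.im|) := by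
        nlinarith [abs_nonneg r, abs_nonneg z.im]
      exact h3.trans (by gcongr)
    have := (h (half_pos hδ)).mul hX
    rw [add_halves] at this
    refine this.congr fun z _ => ?_
    simp [pow_succ, mul_assoc]

lemma norm_cos_le (z : ℂ) : ‖Complex.cos z‖ ≤ Real.exp |z.im| := by
  rw [Complex.cos, norm_div, Complex.norm_two, div_le_iff₀ two_pos]
  refine (norm_add_le _ _).trans ?_
  rw [Complex.norm_exp, Complex.norm_exp]
  have h1 : Real.exp ((z * Complex.I).re) ≤ Real.exp |z.im| :=
    Real.exp_le_exp.2 (by simpa using neg_le_abs z.im)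
  have h2 : Real.exp ((-z * Complex.I).re) ≤ Real.exp |z.im| :=
    Real.exp_le_exp.2 (by simpa using le_abs_self z.im)
  linarith

lemma expBound_aeval_cos (h : ℝ[X]) {m : ℕ} (hm : h.natDegree ≤ m) (U : Set ℂ) (c : ℂ)
    (hc : ‖c‖ = 1) :
    ExpBound U (2 * Real.pi * m) fun z => aeval (c * Complex.cos (2 * Real.pi * z)) h := by
  refine ⟨∑ i ∈ Finset.range (m + 1), |h.coeff i|, fun z _ => ?_⟩
  beta_reduce
  rw [aeval_eq_sum_range' (Nat.lt_succ_of_le hm), Finset.sum_mul]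
  refine (norm_sum_le _ _).trans (Finset.sum_le_sum fun i hi => ?_)
  rw [norm_smul, Real.norm_eq_abs, norm_pow, norm_mul, hc, one_mul]
  gcongr
  have h1 := norm_cos_le (2 * Real.pi * z)
  have h2 : (2 * Real.pi * z : ℂ).im = 2 * Real.pi * z.im := by
    rw [show (2 * Real.pi * z : ℂ) = ((2 * Real.pi : ℝ) : ℂ) * z by push_cast; ring,
      Complex.im_ofReal_mul]
  rw [h2, abs_mul, abs_of_pos (by positivity : 0 < 2 * Real.pi)] at h1
  refine (pow_le_pow_left₀ (norm_nonneg _) h1 i).trans ?_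
  rw [← Real.exp_nat_mul]
  refine Real.exp_le_exp.2 ?_
  have hi' : (i : ℝ) ≤ m := by exact_mod_cast Finset.mem_range_succ_iff.1 hi
  have : 0 ≤ 2 * Real.pi * |z.im| := by positivity
  nlinarith

lemma norm_sq_cos (z : ℂ) :
    ‖Complex.cos z‖ ^ 2 = Real.cos z.re ^ 2 + Real.sinh z.im ^ 2 := by
  have h := Complex.cos_add_mul_I z.re z.im
  rw [Complex.re_add_im] at h
  rw [Complex.sq_norm, h, ← Complex.ofReal_cos, ← Complex.ofReal_sin, ← Complex.ofReal_cosh,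
    ← Complex.ofReal_sinh, Complex.normSq_apply]
  simp only [Complex.sub_re, Complex.sub_im, Complex.mul_re, Complex.mul_im, Complex.ofReal_re,
    Complex.ofReal_im, Complex.I_re, Complex.I_im]
  have h1 := Real.sin_sq_add_cos_sq z.re
  have h2 := Real.cosh_sq z.im
  linear_combination (Real.cos z.re ^ 2) * h2 + (Real.sinh z.im ^ 2) * h1

lemma sinh_le_norm_sin (z : ℂ) : Real.sinh |z.im| ≤ ‖Complex.sin z‖ := by
  have h := norm_sq_cos (Real.pi / 2 - z)
  rw [Complex.cos_pi_div_two_sub] at h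
  have him : (Real.pi / 2 - z : ℂ).im = -z.im := by
    rw [show (Real.pi / 2 - z : ℂ) = ((Real.pi / 2 : ℝ) : ℂ) - z by push_cast; ring]; simp
  refine abs_le_of_sq_le_sq' ?_ (norm_nonneg _) |>.2
  rw [h, him, Real.sinh_neg]
  have h2 : Real.sinh |z.im| ^ 2 = Real.sinh z.im ^ 2 := by
    rcases abs_choice z.im with h | h <;> rw [h]
    rw [Real.sinh_neg, neg_sq]
  rw [h2, neg_sq]
  linarith [sq_nonneg (Real.cos (Real.pi / 2 - z : ℂ).re)]

lemma exp_le_four_sinh {t : ℝ} (ht : 1 ≤ t) : Real.exp t ≤ 4 * Real.sinh t := by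
  rw [Real.sinh_eq]
  have h1 : t + 1 ≤ Real.exp t := Real.add_one_le_exp t
  have h2 : Real.exp t * Real.exp (-t) = 1 := by rw [← Real.exp_add]; simp
  nlinarith [Real.exp_pos t, Real.exp_pos (-t)]

/-- The entire function `sin(πy)/y`. -/
def sincPi (y : ℂ) : ℂ := dslope (fun y => Complex.sin (Real.pi * y)) 0 y

lemma differentiable_sincPi : Differentiable ℂ sincPi := by
  have h : DifferentiableOn ℂ (fun y => Complex.sin (Real.pi * y)) Set.univ := by fun_prop
  exact differentiableOn_univ.1 ((Complex.differentiableOn_dslope univ_mem).2 h)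

lemma sincPi_mul (y : ℂ) : sincPi y * y = Complex.sin (Real.pi * y) := by
  have := sub_smul_dslope (fun y => Complex.sin (Real.pi * y)) 0 y
  simp only [sub_zero, mul_zero, Complex.sin_zero, smul_eq_mul] at this
  rw [sincPi, mul_comm, this]

lemma sincPi_zero : sincPi 0 = Real.pi := by
  rw [sincPi, dslope_same]
  have h : HasDerivAt (fun y : ℂ => Complex.sin (Real.pi * y))
      (Complex.cos (Real.pi * 0) * (Real.pi * 1)) 0 :=
    ((hasDerivAt_id (0 : ℂ)).const_mul (Real.pi : ℂ)).csin
  simpa using h.deriv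

lemma sincPi_eq {y : ℂ} (hy : y ≠ 0) : sincPi y = Complex.sin (Real.pi * y) / y := by
  rw [eq_div_iff hy, sincPi_mul]

lemma sincPi_neg (y : ℂ) : sincPi (-y) = sincPi y := by
  by_cases hy : y = 0
  · simp [hy]
  · rw [sincPi_eq hy, sincPi_eq (neg_ne_zero.2 hy)]; simp

lemma sincPi_conj (y : ℂ) : sincPi (starRingEnd ℂ y) = starRingEnd ℂ (sincPi y) := by
  by_cases hy : y = 0
  · simp [hy, sincPi_zero]
  · rw [sincPi_eq hy, sincPi_eq (by simpa using hy), map_div₀, ← Complex.sin_conj]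
    simp

lemma sincPi_ne_zero {y : ℂ} (hy : |y.re| < 1) : sincPi y ≠ 0 := by
  by_cases h0 : y = 0
  · rw [h0, sincPi_zero]; exact_mod_cast Real.pi_ne_zero
  · rw [sincPi_eq h0]
    refine div_ne_zero (fun h => ?_) h0
    obtain ⟨k, hk⟩ := Complex.sin_eq_zero_iff.1 h
    have hy' : y = k := by
      have : (Real.pi : ℂ) ≠ 0 := by exact_mod_cast Real.pi_ne_zero
      rw [mul_comm] at hk
      exact mul_right_cancel₀ this hk
    rw [hy', Complex.intCast_re] at hy
    have : k = 0 := Int.abs_lt_one_iff.1 (by exact_mod_cast hy)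
    exact h0 (by rw [hy', this]; simp)

/-- On the compact rectangle |Im y| ≤ 1 the function has no zero because r < 1. Beyond it 1/|sin πy|
≤ 4 exp(-π|Im y|), and the factor y costs δ. -/
lemma expBound_inv_sincPi {r : ℝ} (hr : r < 1) {δ : ℝ} (hδ : 0 < δ) :
    ExpBound (strip r) (-Real.pi + δ) fun y => (sincPi y)⁻¹ := by
  have hK : IsCompact (Set.Icc (-r) r ×ℂ Set.Icc (-1) 1) := isCompact_Icc.reProdIm isCompact_Icc
  have hc : ContinuousOn (fun y => (sincPi y)⁻¹) (Set.Icc (-r) r ×ℂ Set.Icc (-1) 1) := by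
    refine differentiable_sincPi.continuous.continuousOn.inv₀ fun y hy => sincPi_ne_zero ?_
    exact (abs_le.2 hy.1).trans_lt hr
  obtain ⟨C, hC⟩ := hK.exists_bound_of_continuousOn hc
  -- The sum of the constants for the two regions; the factor exp π compensates the decay over |Im
  -- y| ≤ 1.
  refine ⟨max C 0 * Real.exp Real.pi + 4 * (1 + δ⁻¹), fun y hy => ?_⟩
  have hpi := Real.pi_pos
  rcases le_or_gt |y.im| 1 with h1 | h1
  · have h2 : ‖(sincPi y)⁻¹‖ ≤ max C 0 := (hC y ⟨abs_le.1 hy, abs_le.1 h1⟩).trans (le_max_left _ _)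
    have h3 : 1 ≤ Real.exp Real.pi * Real.exp ((-Real.pi + δ) * |y.im|) := by
      rw [← Real.exp_add]
      refine Real.one_le_exp ?_
      nlinarith [abs_nonneg y.im, mul_nonneg hδ.le (abs_nonneg y.im)]
    have h4 : 0 ≤ 4 * (1 + δ⁻¹) * Real.exp ((-Real.pi + δ) * |y.im|) := by positivity
    have h5 := mul_le_mul_of_nonneg_left h3 (le_max_right C 0)
    rw [add_mul, mul_assoc]
    linarith
  · have hy0 : y ≠ 0 := by
      rintro rfl
      simp at h1
      linarith
    have him : (Real.pi * y : ℂ).im = Real.pi * y.im := Complex.im_ofReal_mul _ _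
    have h2 := sinh_le_norm_sin (Real.pi * y)
    rw [him, abs_mul, abs_of_pos hpi] at h2
    have h3 := exp_le_four_sinh (t := Real.pi * |y.im|) (by nlinarith [Real.pi_gt_three])
    have h4 : ‖y‖ ≤ 1 + |y.im| := (Complex.norm_le_abs_re_add_abs_im y).trans
      (by have := le_trans hy hr.le; linarith)
    have h5 := one_add_le_exp_mul hδ (abs_nonneg y.im)
    have h6 : 0 < ‖Complex.sin (Real.pi * y)‖ := by
      have := Real.exp_pos (Real.pi * |y.im|)
      linarith
    have h7 : Real.exp ((-Real.pi + δ) * |y.im|) =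
        Real.exp (δ * |y.im|) / Real.exp (Real.pi * |y.im|) := by
      rw [← Real.exp_sub]; ring_nf
    have h8 : ‖(sincPi y)⁻¹‖ ≤ 4 * (1 + δ⁻¹) * Real.exp ((-Real.pi + δ) * |y.im|) := by
      rw [sincPi_eq hy0, inv_div, norm_div, h7, div_le_iff₀ h6]
      have h9 : 1 ≤ 4 * ‖Complex.sin (Real.pi * y)‖ / Real.exp (Real.pi * |y.im|) := by
        rw [one_le_div (Real.exp_pos _)]
        linarith
      calc ‖y‖ ≤ (1 + δ⁻¹) * Real.exp (δ * |y.im|) * 1 := by linarith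
        _ ≤ (1 + δ⁻¹) * Real.exp (δ * |y.im|) *
            (4 * ‖Complex.sin (Real.pi * y)‖ / Real.exp (Real.pi * |y.im|)) := by gcongr
        _ = _ := by ring
    have h9 : 0 ≤ max C 0 * Real.exp Real.pi * Real.exp ((-Real.pi + δ) * |y.im|) := by positivity
    rw [add_mul]
    linarith

/-- On this line |cos πz| ≥ cos(πr) cosh(π Im z), with cos(πr) > 0, so no rate is lost. -/
lemma expBound_inv_cos {r : ℝ} (hr : |r| < 1 / 2) :
    ExpBound {z | z.re = r} (-Real.pi) fun z => (Complex.cos (Real.pi * z))⁻¹ := by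
  have hpi := Real.pi_pos
  have hc : 0 < Real.cos (Real.pi * r) := by
    rw [abs_lt] at hr
    exact Real.cos_pos_of_mem_Ioo ⟨by nlinarith, by nlinarith⟩
  refine ⟨2 / Real.cos (Real.pi * r), fun z hz => ?_⟩
  have him : (Real.pi * z : ℂ).im = Real.pi * z.im := Complex.im_ofReal_mul _ _
  have hre : (Real.pi * z : ℂ).re = Real.pi * r := by rw [Complex.re_ofReal_mul, hz]
  have h1 := norm_sq_cos (Real.pi * z)
  rw [him, hre] at h1
  set t := Real.pi * z.im
  have ht : |t| = Real.pi * |z.im| := by rw [abs_mul, abs_of_pos hpi]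
  have h2 : Real.exp |t| ≤ 2 * Real.cosh t := by
    rw [← Real.cosh_abs, Real.cosh_eq]
    have := Real.exp_pos (-|t|)
    linarith
  have h3 : Real.cos (Real.pi * r) * Real.cosh t ≤ ‖Complex.cos (Real.pi * z)‖ := by
    refine abs_le_of_sq_le_sq' ?_ (norm_nonneg _) |>.2
    rw [h1, mul_pow, Real.cosh_sq]
    nlinarith [Real.cos_sq_le_one (Real.pi * r), sq_nonneg (Real.sinh t)]
  have h4 : 0 < ‖Complex.cos (Real.pi * z)‖ := lt_of_lt_of_le (by positivity) h3
  rw [norm_inv, neg_mul, ← ht, Real.exp_neg, ← div_eq_mul_inv, div_div, inv_eq_one_div,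
    div_le_div_iff₀ h4 (by positivity)]
  nlinarith

end Kleinian

end

noncomputable section

namespace Kleinian

open Polynomial MeasureTheory Filter Topology

/-! ### Integrals over vertical lines -/

lemma integrable_exp_mul_abs {κ : ℝ} (hκ : κ < 0) :
    Integrable fun x : ℝ => Real.exp (κ * |x|) := by
  rw [← integrableOn_univ, ← Set.Iic_union_Ioi (a := (0 : ℝ))]
  refine IntegrableOn.union ?_ ?_
  · refine (integrableOn_exp_mul_Iic (neg_pos.2 hκ) 0).congr_fun (fun x hx => ?_) measurableSet_Iic
    simp only [Set.mem_Iic] at hx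
    rw [abs_of_nonpos hx]; ring_nf
  · refine (integrableOn_exp_mul_Ioi hκ 0).congr_fun (fun x hx => ?_) measurableSet_Ioi
    simp only [Set.mem_Ioi] at hx
    rw [abs_of_pos hx]

lemma ExpBound.integrable {U : Set ℂ} {κ : ℝ} {G : ℂ → ℂ} (h : ExpBound U κ G) (hκ : κ < 0)
    {a : ℝ} (hU : ∀ y : ℝ, (a + y * Complex.I : ℂ) ∈ U)
    (hc : Continuous fun y : ℝ => G (a + y * Complex.I)) :
    Integrable fun y : ℝ => G (a + y * Complex.I) := by
  obtain ⟨C, hC⟩ := h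
  refine ((integrable_exp_mul_abs hκ).const_mul C).mono' hc.aestronglyMeasurable
    (Eventually.of_forall fun y => ?_)
  simpa using hC _ (hU y)

/-- Shifting the line of integration inside a strip. -/
lemma integral_vertical_line_eq {F : ℂ → ℂ} {r κ : ℝ} (hF : DifferentiableOn ℂ F (strip r))
    (hb : ExpBound (strip r) κ F) (hκ : κ < 0) {a b : ℝ} (ha : |a| ≤ r) (hbr : |b| ≤ r) :
    ∫ y : ℝ, F (a + y * Complex.I) = ∫ y : ℝ, F (b + y * Complex.I) := by
  have hmem : ∀ c : ℝ, |c| ≤ r → ∀ y : ℝ, (c + y * Complex.I : ℂ) ∈ strip r := by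
    intro c hc y; simpa [strip] using hc
  have hcont : ∀ c : ℝ, |c| ≤ r → Continuous fun y : ℝ => F (c + y * Complex.I) := fun c hc =>
    hF.continuousOn.comp_continuous (by fun_prop) (hmem c hc)
  have hint : ∀ c : ℝ, |c| ≤ r → Tendsto (fun T : ℝ => ∫ y in -T..T, F (c + y * Complex.I)) atTop
      (𝓝 (∫ y : ℝ, F (c + y * Complex.I))) := fun c hc =>
    intervalIntegral_tendsto_integral (hb.integrable hκ (hmem c hc) (hcont c hc))
      tendsto_neg_atTop_atBot tendsto_id
  obtain ⟨C, hC⟩ := hb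
  have hexp : Tendsto (fun T : ℝ => C * Real.exp (κ * T) * |b - a|) atTop (𝓝 0) := by
    have h1 : Tendsto (fun T : ℝ => Real.exp (κ * T)) atTop (𝓝 0) :=
      Real.tendsto_exp_atBot.comp (tendsto_id.const_mul_atTop_of_neg hκ)
    simpa using (h1.const_mul C).mul_const |b - a|
  have huIcc : ∀ x ∈ Set.uIcc a b, |x| ≤ r := by
    intro x hx
    rw [abs_le] at ha hbr ⊢
    rcases Set.mem_uIcc.1 hx with h | h <;> constructor <;> linarith [h.1, h.2, ha.1, ha.2]
  -- The horizontal edges, s = 1 above and s = -1 below, vanish in the limit by the exponential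
  -- decay.
  have hhor : ∀ s : ℝ, (s = 1 ∨ s = -1) → Tendsto (fun T : ℝ =>
      ∫ x : ℝ in a..b, F (x + (s * T : ℝ) * Complex.I)) atTop (𝓝 0) := by
    intro s hs
    refine squeeze_zero_norm' ?_ hexp
    filter_upwards [eventually_ge_atTop 0] with T hT
    refine intervalIntegral.norm_integral_le_of_norm_le_const fun x hx => ?_
    have h1 := hC (x + (s * T : ℝ) * Complex.I) (hmem x (huIcc x (Set.uIoc_subset_uIcc hx)) _)
    have h2 : |s * T| = T := by
      rcases hs with h | h <;> simp [h, abs_of_nonneg hT]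
    simpa only [Complex.add_im, Complex.ofReal_im, Complex.mul_im, Complex.ofReal_re,
      Complex.I_im, mul_one, Complex.I_re, mul_zero, add_zero, zero_add, h2] using h1
  have key : ∀ T : ℝ, (∫ x : ℝ in a..b, F (x + (-1 * T : ℝ) * Complex.I)) -
      (∫ x : ℝ in a..b, F (x + (1 * T : ℝ) * Complex.I)) +
      Complex.I • (∫ y in -T..T, F (b + y * Complex.I)) -
      Complex.I • (∫ y in -T..T, F (a + y * Complex.I)) = 0 := by
    intro T
    have := Complex.integral_boundary_rect_eq_zero_of_differentiableOn F
      (a + (-T : ℝ) * Complex.I) (b + T * Complex.I) (hF.mono (by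
        intro z hz
        refine huIcc _ ?_
        simpa using hz.1))
    simpa using this
  have hlim := ((((hhor (-1) (Or.inr rfl)).sub (hhor 1 (Or.inl rfl))).add
    ((hint b hbr).const_smul Complex.I)).sub ((hint a ha).const_smul Complex.I))
  simp only [key] at hlim
  have h0 := tendsto_nhds_unique hlim tendsto_const_nhds
  rw [sub_zero, zero_add, ← smul_sub, smul_eq_zero] at h0
  exact (sub_eq_zero.1 (h0.resolve_left Complex.I_ne_zero)).symm

/-! ### The weight functions -/

section Weight

open ComplexOrder

/-- Positivity of a product over a multiset invariant under an involution which acts on the factors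
by complex conjugation. -/
lemma multiset_prod_pos {ι : ℂ → ℂ} (hι : Function.Involutive ι) {f : ℂ → ℂ}
    (hf : ∀ α, f (ι α) = starRingEnd ℂ (f α)) (s : Multiset ℂ) (hs : s.map ι = s)
    (hfix : ∀ α ∈ s, ι α = α → 0 < f α) (hne : ∀ α ∈ s, f α ≠ 0) : 0 < (s.map f).prod := by
  induction hn : s.card using Nat.strong_induction_on generalizing s with
  | _ k ih =>
    rcases s.empty_or_exists_mem with rfl | ⟨a, ha⟩
    · simp
    · obtain ⟨t, rfl⟩ := Multiset.exists_cons_of_mem ha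
      rw [Multiset.map_cons] at hs
      by_cases hfa : ι a = a
      · rw [hfa, Multiset.cons_inj_right] at hs
        rw [Multiset.map_cons, Multiset.prod_cons]
        exact mul_pos (hfix a ha hfa) (ih t.card (by rw [← hn]; simp) t hs
          (fun α h => hfix α (Multiset.mem_cons_of_mem h))
          (fun α h => hne α (Multiset.mem_cons_of_mem h)) rfl)
      · have hmem : ι a ∈ a ::ₘ t := by rw [← hs]; exact Multiset.mem_cons_self _ _
        obtain ⟨t', rfl⟩ := Multiset.exists_cons_of_mem
          ((Multiset.mem_cons.1 hmem).resolve_left hfa)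
        rw [Multiset.map_cons, hι a, Multiset.cons_swap, Multiset.cons_inj_right,
          Multiset.cons_inj_right] at hs
        simp only [Multiset.map_cons, Multiset.prod_cons]
        -- A pair of distinct points swapped by the involution contributes |f(a)|².
        rw [← mul_assoc, hf, Complex.mul_conj]
        refine mul_pos ?_ (ih t'.card (by rw [← hn]; simp) t' hs
          (fun α h => hfix α (by simp [h])) (fun α h => hne α (by simp [h])) rfl)
        have := Complex.normSq_pos.2 (hne a ha)
        exact_mod_cast this

/-- The product of `cos π(z - α)`. -/
def cosProd (s : Multiset ℂ) (z : ℂ) : ℂ :=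
  (s.map fun α => Complex.cos (Real.pi * (z - α))).prod

/-- The product of `sin π(z - α) / (z - α)`. -/
def sincProd (s : Multiset ℂ) (z : ℂ) : ℂ := (s.map fun α => sincPi (z - α)).prod

variable {s : Multiset ℂ}

lemma differentiable_multiset_prod {f : ℂ → ℂ → ℂ} (hf : ∀ α, Differentiable ℂ (f α))
    (s : Multiset ℂ) : Differentiable ℂ fun z => (s.map fun α => f α z).prod := by
  induction s using Multiset.induction_on with
  | empty => simp
  | cons a s ih =>
    simp only [Multiset.map_cons, Multiset.prod_cons]
    exact (hf a).mul ih

lemma differentiable_cosProd : Differentiable ℂ (cosProd s) :=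
  differentiable_multiset_prod (fun α => by fun_prop) s

lemma differentiable_sincProd : Differentiable ℂ (sincProd s) :=
  differentiable_multiset_prod
    (fun α => differentiable_sincPi.comp (differentiable_id.sub_const α)) s

lemma cos_pi_ne_zero {z : ℂ} (hz : |z.re| < 1 / 2) : Complex.cos (Real.pi * z) ≠ 0 := by
  intro h
  obtain ⟨k, hk⟩ := Complex.cos_eq_zero_iff.1 h
  have hpi : (Real.pi : ℂ) ≠ 0 := by exact_mod_cast Real.pi_ne_zero
  have hz' : z = (((2 * k + 1 : ℤ) : ℝ) / 2 : ℝ) := by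
    refine mul_left_cancel₀ hpi (hk.trans ?_)
    push_cast; ring
  rw [hz', Complex.ofReal_re, abs_div, abs_two, div_lt_div_iff_of_pos_right two_pos] at hz
  have h1 : |2 * k + 1| < 1 := by exact_mod_cast hz
  have := Int.abs_lt_one_iff.1 h1
  omega

/-- For z in the closed strip and α in the open one, |Re(z - α)| < 1, where sin(πy)/y has no zeros.
This is how the hypothesis on the roots keeps poles out of the strip. -/
lemma sincProd_ne_zero (hs : ∀ α ∈ s, |α.re| < 1 / 2) {z : ℂ} (hz : |z.re| ≤ 1 / 2) :
    sincProd s z ≠ 0 := by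
  rw [sincProd, Ne, Multiset.prod_eq_zero_iff, Multiset.mem_map]
  rintro ⟨α, hα, h⟩
  refine sincPi_ne_zero ?_ h
  rw [Complex.sub_re]
  exact (abs_sub _ _).trans_lt (by linarith [hs α hα])

/-- On the imaginary axis α ↦ -ᾱ conjugates the factors, so they pair up into squared moduli; the
fixed α are imaginary and give values of cosh. -/
lemma cosProd_pos (hs : ∀ α ∈ s, |α.re| < 1 / 2)
    (hc : s.map (fun α => -starRingEnd ℂ α) = s) (x : ℝ) : 0 < cosProd s (x * Complex.I) := by
  refine multiset_prod_pos (ι := fun α => -starRingEnd ℂ α) (fun α => by simp) (fun α => ?_) s hc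
    (fun α _ h => ?_) (fun α hα => cos_pi_ne_zero (by simpa using hs α hα))
  · rw [← Complex.cos_conj, ← Complex.cos_neg]
    congr 1
    simp; ring
  · have h1 : α.re = 0 := by
      have := congrArg Complex.re h
      simp at this
      linarith
    have h2 : (Real.pi * (x * Complex.I - α) : ℂ) = (Real.pi * (x - α.im) : ℝ) * Complex.I := by
      apply Complex.ext <;> simp [h1]
    rw [h2, Complex.cos_mul_I, ← Complex.ofReal_cosh]
    exact_mod_cast Real.cosh_pos _

lemma sincProd_pos (hs : ∀ α ∈ s, |α.re| < 1 / 2)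
    (hc : s.map (fun α => -starRingEnd ℂ α) = s) (x : ℝ) : 0 < sincProd s (x * Complex.I) := by
  refine multiset_prod_pos (ι := fun α => -starRingEnd ℂ α) (fun α => by simp) (fun α => ?_) s hc
    (fun α _ h => ?_) (fun α hα => sincPi_ne_zero (by
      have := hs α hα
      simp; linarith))
  · rw [← sincPi_conj, ← sincPi_neg]
    congr 1
    simp; ring
  · have h1 : α.re = 0 := by
      have := congrArg Complex.re h
      simp at this
      linarith
    have h2 : (x * Complex.I - α : ℂ) = (x - α.im : ℝ) * Complex.I := by
      apply Complex.ext <;> simp [h1]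
    rw [h2]
    generalize x - α.im = t
    by_cases ht : t = 0
    · simp only [ht, Complex.ofReal_zero, zero_mul, sincPi_zero]
      exact_mod_cast Real.pi_pos
    · have ht' : (t : ℂ) * Complex.I ≠ 0 := by simp [ht]
      rw [sincPi_eq ht', ← mul_assoc, Complex.sin_mul_I, ← Complex.ofReal_mul,
        ← Complex.ofReal_sinh, mul_div_mul_right _ _ Complex.I_ne_zero, ← Complex.ofReal_div]
      refine Complex.zero_lt_real.2 ?_
      rcases lt_or_gt_of_ne ht with h | h
      · refine div_pos_of_neg_of_neg (Real.sinh_neg_iff.2 ?_) h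
        nlinarith [Real.pi_pos]
      · exact div_pos (Real.sinh_pos_iff.2 (by positivity)) h

lemma cosProd_neg (he : s.map (fun α => -α) = s) (z : ℂ) : cosProd s (-z) = cosProd s z := by
  rw [cosProd, cosProd]
  conv_rhs => rw [← he, Multiset.map_map]
  congr 1
  refine Multiset.map_congr rfl fun α _ => ?_
  rw [← Complex.cos_neg]
  congr 1
  simp; ring

lemma expBound_inv_cosProd (hs : ∀ α ∈ s, |α.re| < 1 / 2) :
    ExpBound {z | z.re = 0} (s.card * -Real.pi) fun z => (cosProd s z)⁻¹ := by
  refine (ExpBound.multiset_prod s (G := fun α z => (Complex.cos (Real.pi * (z - α)))⁻¹)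
    fun α hα => ?_).congr fun z _ => ?_
  · refine (expBound_inv_cos (r := -α.re) (by simpa using hs α hα)).comp_sub α fun z hz => ?_
    simp only [Set.mem_ofPred_eq] at hz ⊢
    simp [hz]
  · rw [cosProd, Multiset.prod_map_inv]

lemma expBound_inv_sincProd (hs : ∀ α ∈ s, |α.re| < 1 / 2) {δ : ℝ} (hδ : 0 < δ) :
    ExpBound (strip (1 / 2)) (s.card * (-Real.pi + δ)) fun z => (sincProd s z)⁻¹ := by
  refine (ExpBound.multiset_prod s (G := fun α z => (sincPi (z - α))⁻¹)
    fun α hα => ?_).congr fun z _ => ?_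
  · have h1 := hs α hα
    refine (expBound_inv_sincPi (r := 1 / 2 + |α.re|) (by linarith) hδ).comp_sub α fun z hz => ?_
    simp only [strip, Set.mem_ofPred_eq, Complex.sub_re] at hz ⊢
    exact (abs_sub _ _).trans (by linarith)
  · rw [sincProd, Multiset.prod_map_inv]

/-- On the edge of the strip sin π(z + 1/2 - α) = cos π(z - α), and the removed denominators
reappear as a numerator. For the roots of P that numerator is P(z + 1/2), which is how P enters the
trace relation. -/
lemma inv_sincProd_add_half (hs : ∀ α ∈ s, |α.re| < 1 / 2) {z : ℂ} (hz : z.re = 0) :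
    (sincProd s (z + 1 / 2))⁻¹ = (s.map fun α => z + 1 / 2 - α).prod * (cosProd s z)⁻¹ := by
  rw [sincProd, cosProd, ← Multiset.prod_map_inv, ← Multiset.prod_map_inv, ← Multiset.prod_map_mul]
  congr 1
  refine Multiset.map_congr rfl fun α hα => ?_
  have h1 : Complex.cos (Real.pi * (z - α)) ≠ 0 :=
    cos_pi_ne_zero (by simpa [hz] using hs α hα)
  have h2 : Complex.sin (Real.pi * (z + 1 / 2 - α)) = Complex.cos (Real.pi * (z - α)) := by
    rw [← Complex.sin_add_pi_div_two]; congr 1; ring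
  have h3 := sincPi_mul (z + 1 / 2 - α)
  rw [h2] at h3
  have h4 : sincPi (z + 1 / 2 - α) ≠ 0 := fun h => h1 (by rw [← h3, h, zero_mul])
  rw [← h3]
  have h5 : z + 1 / 2 - α ≠ 0 := fun h => h1 (by rw [← h3, h, mul_zero])
  generalize z + 1 / 2 - α = y at h4 h5 ⊢
  field_simp

lemma inv_sincProd_sub_half (hs : ∀ α ∈ s, |α.re| < 1 / 2) {z : ℂ} (hz : z.re = 0) :
    (sincProd s (z - 1 / 2))⁻¹ =
      (-1) ^ s.card * ((s.map fun α => z - 1 / 2 - α).prod * (cosProd s z)⁻¹) := by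
  have h0 : ((-1) ^ s.card : ℂ) = (s.map fun _ => (-1 : ℂ)).prod := by
    rw [Multiset.map_const', Multiset.prod_replicate]
  rw [sincProd, cosProd, ← Multiset.prod_map_inv, ← Multiset.prod_map_inv, ← Multiset.prod_map_mul,
    h0, ← Multiset.prod_map_mul]
  congr 1
  refine Multiset.map_congr rfl fun α hα => ?_
  have h1 : Complex.cos (Real.pi * (z - α)) ≠ 0 :=
    cos_pi_ne_zero (by simpa [hz] using hs α hα)
  have h2 : Complex.cos (Real.pi * (z - α)) = -Complex.sin (Real.pi * (z - 1 / 2 - α)) := by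
    rw [show (Real.pi * (z - 1 / 2 - α) : ℂ) = Real.pi * (z - α) - Real.pi / 2 by ring,
      Complex.sin_sub_pi_div_two, neg_neg]
  have h3 := sincPi_mul (z - 1 / 2 - α)
  have h5 : z - 1 / 2 - α ≠ 0 := fun h => h1 (by rw [h2, ← h3, h, mul_zero, neg_zero])
  have h4 : sincPi (z - 1 / 2 - α) ≠ 0 := fun h => h1 (by rw [h2, ← h3, h, zero_mul, neg_zero])
  rw [h2, ← h3]
  generalize z - 1 / 2 - α = y at h4 h5 ⊢
  field_simp

end Weight

end Kleinian

end

noncomputable section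

namespace Kleinian

open Polynomial MeasureTheory Filter Topology

/-! ### Moments of a density on the imaginary axis -/

lemma eval_mul_adj (M : ℂ[X]) (y : ℝ) :
    (M * adj M).eval (y * Complex.I) = ((‖M.eval (y * Complex.I)‖ ^ 2 : ℝ) : ℂ) := by
  rw [eval_mul, eval_adj, map_mul, Complex.conj_I, Complex.conj_ofReal, mul_neg, neg_neg,
    Complex.mul_conj, Complex.normSq_eq_norm_sq]

lemma re_integral_mul_adj (k : ℝ → ℝ) (M : ℂ[X]) :
    (∫ y : ℝ, (M * adj M).eval (y * Complex.I) * (k y : ℂ)).re =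
      ∫ y : ℝ, ‖M.eval (y * Complex.I)‖ ^ 2 * k y := by
  simp only [eval_mul_adj, ← Complex.ofReal_mul]
  rw [integral_complex_ofReal, Complex.ofReal_re]

lemma integrable_norm_sq_mul {k : ℝ → ℝ}
    (hk : ∀ R : ℂ[X], Integrable fun y : ℝ => R.eval (y * Complex.I) * (k y : ℂ)) (M : ℂ[X]) :
    Integrable fun y : ℝ => ‖M.eval (y * Complex.I)‖ ^ 2 * k y := by
  have := (hk (M * adj M)).re
  simpa only [eval_mul_adj, ← Complex.ofReal_mul, RCLike.re_to_complex, Complex.ofReal_re] using this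

lemma integral_norm_sq_mul_pos {k : ℝ → ℝ} (hc : Continuous k) (hpos : ∀ y, 0 < k y)
    (hk : ∀ R : ℂ[X], Integrable fun y : ℝ => R.eval (y * Complex.I) * (k y : ℂ)) {M : ℂ[X]}
    (hM : M ≠ 0) : 0 < ∫ y : ℝ, ‖M.eval (y * Complex.I)‖ ^ 2 * k y := by
  rw [integral_pos_iff_support_of_nonneg (fun y => mul_nonneg (sq_nonneg _) (hpos y).le)
    (integrable_norm_sq_mul hk M)]
  have hcont : Continuous fun y : ℝ => ‖M.eval (y * Complex.I)‖ ^ 2 * k y := by fun_prop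
  refine hcont.isOpen_support.measure_pos _ ?_
  have hfin : (M.roots.toFinset : Set ℂ).Finite := Finset.finite_toSet _
  have hinj : Function.Injective fun y : ℝ => (y * Complex.I : ℂ) := fun a b h => by
    simpa using h
  -- Only finitely many points of the axis are roots of M, so the continuous nonnegative integrand
  -- is somewhere positive.
  obtain ⟨y, hy⟩ := (hfin.preimage hinj.injOn).infinite_compl.nonempty
  refine ⟨y, mul_ne_zero (pow_ne_zero 2 (norm_ne_zero_iff.2 fun h => hy ?_)) (hpos y).ne'⟩
  simpa [hM] using h

/-- If `k` is positive far from the origin, some even moment of `k` is positive. -/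
lemma exists_moment_pos {k : ℝ → ℝ} (hc : Continuous k) {A : ℝ}
    (hpos : ∀ y, A ≤ |y| → 0 < k y)
    (hk : ∀ R : ℂ[X], Integrable fun y : ℝ => R.eval (y * Complex.I) * (k y : ℂ)) :
    ∃ N : ℕ, 0 < ∫ y : ℝ, ‖((X : ℂ[X]) ^ N).eval (y * Complex.I)‖ ^ 2 * k y := by
  set B := max A 1
  have hB1 : 1 ≤ B := le_max_right _ _
  have hB : ∀ y, B ≤ |y| → 0 < k y := fun y hy => hpos y ((le_max_left _ _).trans hy)
  have hnorm : ∀ (N : ℕ) (y : ℝ), ‖((X : ℂ[X]) ^ N).eval (y * Complex.I)‖ ^ 2 = (y ^ 2) ^ N := by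
    intro N y
    rw [eval_pow, eval_X, norm_pow, norm_mul, Complex.norm_I, mul_one, Complex.norm_real,
      Real.norm_eq_abs, ← pow_mul, mul_comm, pow_mul, sq_abs]
  simp only [hnorm]
  set a := ∫ y in Set.Icc (-B) B, |k y| with ha
  set b := ∫ y in Set.Icc (B + 1) (B + 2), k y with hb
  have hb0 : 0 < b := by
    rw [hb, integral_Icc_eq_integral_Ioc, ← intervalIntegral.integral_of_le (by linarith)]
    refine intervalIntegral.intervalIntegral_pos_of_pos_on (hc.intervalIntegrable _ _)
      (fun y hy => hB y ?_) (by linarith)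
    rw [abs_of_pos] <;> linarith [hy.1]
  have ha0 : 0 ≤ a := integral_nonneg fun y => abs_nonneg _
  -- The 2N-th power weighs the mass on [B+1, B+2] by at least (B+1)^(2N) and any negative part,
  -- confined to [-B, B], by at most B^(2N); a large N lets the former win.
  have hB2 : 1 < ((B + 1) / B) ^ 2 := by
    refine one_lt_pow₀ ?_ two_ne_zero
    rw [one_lt_div] <;> linarith
  obtain ⟨N, hN⟩ := pow_unbounded_of_one_lt (a / b) hB2
  refine ⟨N, ?_⟩
  have h1 : (B ^ 2) ^ N * a < ((B + 1) ^ 2) ^ N * b := by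
    rw [div_lt_iff₀ hb0, div_pow, div_pow, div_mul_eq_mul_div, lt_div_iff₀ (by positivity)] at hN
    linarith
  have hi1 : IntegrableOn (fun y => |k y|) (Set.Icc (-B) B) :=
    hc.abs.continuousOn.integrableOn_Icc
  have hi2 : IntegrableOn k (Set.Icc (B + 1) (B + 2)) := hc.continuousOn.integrableOn_Icc
  have h2 : ((B + 1) ^ 2) ^ N * b - (B ^ 2) ^ N * a ≤ ∫ y : ℝ, (y ^ 2) ^ N * k y := by
    rw [ha, hb, ← integral_indicator measurableSet_Icc, ← integral_indicator measurableSet_Icc,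
      ← integral_const_mul, ← integral_const_mul, ← integral_sub
        ((hi2.integrable_indicator measurableSet_Icc).const_mul _)
        ((hi1.integrable_indicator measurableSet_Icc).const_mul _)]
    have hint := integrable_norm_sq_mul hk (X ^ N)
    simp only [hnorm] at hint
    refine integral_mono (((hi2.integrable_indicator measurableSet_Icc).const_mul _).sub
        ((hi1.integrable_indicator measurableSet_Icc).const_mul _)) hint fun y => ?_
    by_cases hy1 : y ∈ Set.Icc (-B) B
    · have hy2 : y ∉ Set.Icc (B + 1) (B + 2) := fun h => by linarith [hy1.2, h.1]
      simp only [Set.indicator_of_mem hy1, Set.indicator_of_notMem hy2, mul_zero, zero_sub]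
      have h3 : (y ^ 2) ^ N ≤ (B ^ 2) ^ N :=
        pow_le_pow_left₀ (sq_nonneg y) (sq_le_sq' hy1.1 hy1.2) N
      have h4 : 0 ≤ (y ^ 2) ^ N := by positivity
      have h5 := neg_abs_le (k y)
      nlinarith [abs_nonneg (k y)]
    · have hy3 : B ≤ |y| := by
        by_contra h
        push Not at h
        exact hy1 ⟨(abs_lt.1 h).1.le, (abs_lt.1 h).2.le⟩
      have hky := hB y hy3
      by_cases hy2 : y ∈ Set.Icc (B + 1) (B + 2)
      · simp only [Set.indicator_of_notMem hy1, Set.indicator_of_mem hy2, mul_zero, sub_zero]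
        have h3 : ((B + 1) ^ 2) ^ N ≤ (y ^ 2) ^ N :=
          pow_le_pow_left₀ (by positivity) (pow_le_pow_left₀ (by linarith) hy2.1 2) N
        gcongr
      · simp only [Set.indicator_of_notMem hy1, Set.indicator_of_notMem hy2, mul_zero, sub_zero]
        positivity
  linarith

/-! ### The traces attached to polynomials in `cos 2πz` -/

section Tau

open ComplexOrder

variable {n : ℕ} (P : Parameter n)

variable {P}

lemma Parameter.eval_eq_prod (z : ℂ) :
    P.poly.eval z = (P.poly.roots.map fun α => z - α).prod :=
  (IsAlgClosed.splits P.poly).eval_eq_prod_roots_of_monic P.monic z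

lemma Parameter.card_roots : P.poly.roots.card = n := by
  rw [← (IsAlgClosed.splits P.poly).natDegree_eq_card_roots, P.natDegree_eq]

lemma Parameter.roots_map {f : ℂ → ℂ}
    (h : ∀ z, (P.poly.roots.map fun α => z - f α).prod = P.poly.eval z) :
    P.poly.roots.map f = P.poly.roots := by
  conv_rhs => rw [show P.poly = ((P.poly.roots.map f).map fun α => X - C α).prod by
    refine Polynomial.funext fun z => ?_
    rw [← h, eval_multiset_prod, Multiset.map_map, Multiset.map_map]
    simp [Function.comp_def]]
  rw [roots_multiset_prod_X_sub_C]

lemma Parameter.roots_neg : P.poly.roots.map (fun α => -α) = P.poly.roots := by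
  refine Parameter.roots_map fun z => ?_
  have h := congrArg (eval z) P.even
  have hI : (-1 : ℂ) ^ n * (-1 : ℂ) ^ n = 1 := by rw [← mul_pow]; simp
  rw [eval_comp, eval_neg, eval_X, eval_mul, eval_pow, eval_neg, eval_one, P.eval_eq_prod] at h
  rw [← one_mul (eval z P.poly), ← hI, mul_assoc, ← h]
  have h0 : ((-1) ^ n : ℂ) = (P.poly.roots.map fun _ => (-1 : ℂ)).prod := by
    rw [Multiset.map_const', Multiset.prod_replicate, P.card_roots]
  rw [h0, ← Multiset.prod_map_mul]
  congr 1
  refine Multiset.map_congr rfl fun α _ => ?_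
  ring

lemma Parameter.roots_neg_conj :
    P.poly.roots.map (fun α => -starRingEnd ℂ α) = P.poly.roots := by
  refine Parameter.roots_map fun z => ?_
  have h := congrArg (eval z) P.adj_poly
  have hI : (-1 : ℂ) ^ n * (-1 : ℂ) ^ n = 1 := by rw [← mul_pow]; simp
  rw [eval_adj, eval_mul, eval_pow, eval_neg, eval_one, P.eval_eq_prod] at h
  rw [← one_mul (eval z P.poly), ← hI, mul_assoc, ← h, map_multiset_prod, Multiset.map_map]
  have h0 : ((-1) ^ n : ℂ) = (P.poly.roots.map fun _ => (-1 : ℂ)).prod := by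
    rw [Multiset.map_const', Multiset.prod_replicate, P.card_roots]
  rw [h0, ← Multiset.prod_map_mul]
  congr 1
  refine Multiset.map_congr rfl fun α _ => ?_
  simp; ring

variable (P) in
/-- The density `h(cosh 2πy) / ∏ cos π(iy - α)`. -/
def density (h : ℝ[X]) (y : ℝ) : ℝ :=
  h.eval (Real.cosh (2 * Real.pi * y)) * (cosProd P.poly.roots (y * Complex.I)).re⁻¹

variable (P) in
/-- The density `h(-cosh 2πy) ∏ (iy - α) / sin π(iy - α)`. -/
def shiftedDensity (h : ℝ[X]) (y : ℝ) : ℝ :=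
  h.eval (-Real.cosh (2 * Real.pi * y)) * (sincProd P.poly.roots (y * Complex.I)).re⁻¹

lemma cos_two_pi_mul_I (y : ℝ) :
    Complex.cos (2 * Real.pi * (y * Complex.I)) = (Real.cosh (2 * Real.pi * y) : ℝ) := by
  rw [← mul_assoc, Complex.cos_mul_I]; push_cast; rfl



end Tau

end Kleinian

end

noncomputable section

namespace Kleinian

open Polynomial MeasureTheory Filter Topology

/-! ### Functionals with densities on the imaginary axis: trace relation and positivity -/

section Tau

open ComplexOrder

variable {n : ℕ} {P : Parameter n}

variable (P) in
/-- All roots lie in the open strip `|Re α| < 1/2`. -/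
def RootsInStrip : Prop := ∀ α ∈ P.poly.roots, |α.re| < 1 / 2

lemma RootsInStrip.cosProd_re_pos (hs : RootsInStrip P) (y : ℝ) :
    0 < (cosProd P.poly.roots (y * Complex.I)).re :=
  (Complex.pos_iff.1 (cosProd_pos hs P.roots_neg_conj y)).1

lemma RootsInStrip.cosProd_eq (hs : RootsInStrip P) (y : ℝ) :
    cosProd P.poly.roots (y * Complex.I) = (cosProd P.poly.roots (y * Complex.I)).re :=
  Complex.ext rfl (by
    rw [← (Complex.pos_iff.1 (cosProd_pos hs P.roots_neg_conj y)).2, Complex.ofReal_im])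

lemma RootsInStrip.sincProd_re_pos (hs : RootsInStrip P) (y : ℝ) :
    0 < (sincProd P.poly.roots (y * Complex.I)).re :=
  (Complex.pos_iff.1 (sincProd_pos hs P.roots_neg_conj y)).1

lemma RootsInStrip.sincProd_eq (hs : RootsInStrip P) (y : ℝ) :
    sincProd P.poly.roots (y * Complex.I) = (sincProd P.poly.roots (y * Complex.I)).re :=
  Complex.ext rfl (by
    rw [← (Complex.pos_iff.1 (sincProd_pos hs P.roots_neg_conj y)).2, Complex.ofReal_im])

lemma aeval_ofReal_eq (h : ℝ[X]) (r : ℝ) : aeval (r : ℂ) h = ((h.eval r : ℝ) : ℂ) :=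
  aeval_algebraMap_apply_eq_algebraMap_eval r h

lemma ofReal_density (hs : RootsInStrip P) (h : ℝ[X]) (y : ℝ) :
    (density P h y : ℂ) = aeval (1 * Complex.cos (2 * Real.pi * (y * Complex.I))) h *
      (cosProd P.poly.roots (y * Complex.I))⁻¹ := by
  rw [one_mul, cos_two_pi_mul_I, aeval_ofReal_eq, hs.cosProd_eq, density]
  push_cast; rfl

lemma ofReal_shiftedDensity (hs : RootsInStrip P) (h : ℝ[X]) (y : ℝ) :
    (shiftedDensity P h y : ℂ) = aeval (-1 * Complex.cos (2 * Real.pi * (y * Complex.I))) h *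
      (sincProd P.poly.roots (y * Complex.I))⁻¹ := by
  rw [neg_one_mul, cos_two_pi_mul_I, ← Complex.ofReal_neg, aeval_ofReal_eq, hs.sincProd_eq,
    shiftedDensity]
  push_cast; rfl

lemma continuous_density (hs : RootsInStrip P) (h : ℝ[X]) : Continuous (density P h) := by
  have h1 : Continuous fun y : ℝ => (cosProd P.poly.roots (y * Complex.I)).re :=
    Complex.continuous_re.comp (differentiable_cosProd.continuous.comp (by fun_prop))
  have h2 : Continuous fun y : ℝ => h.eval (Real.cosh (2 * Real.pi * y)) :=
    h.continuous.comp (Real.continuous_cosh.comp (by fun_prop))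
  exact h2.mul (h1.inv₀ fun y => (hs.cosProd_re_pos y).ne')

lemma continuous_shiftedDensity (hs : RootsInStrip P) (h : ℝ[X]) :
    Continuous (shiftedDensity P h) := by
  have h1 : Continuous fun y : ℝ => (sincProd P.poly.roots (y * Complex.I)).re :=
    Complex.continuous_re.comp (differentiable_sincProd.continuous.comp (by fun_prop))
  have h2 : Continuous fun y : ℝ => h.eval (-Real.cosh (2 * Real.pi * y)) :=
    h.continuous.comp (Real.continuous_cosh.comp (by fun_prop)).neg
  exact h2.mul (h1.inv₀ fun y => (hs.sincProd_re_pos y).ne')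

/-- The holomorphic continuation of `S` times the shifted density to the strip. -/
def shiftedIntegrand (P : Parameter n) (h : ℝ[X]) (S : ℂ[X]) (z : ℂ) : ℂ :=
  S.eval z * (aeval (-1 * Complex.cos (2 * Real.pi * z)) h * (sincProd P.poly.roots z)⁻¹)

/-- With the choice δ = 1/(n+1), the n losses from the sinc factors and the one from the polynomial
add up to exactly 1. Since 2d - n ≤ -1, the total rate is at most 1 - π. -/
lemma kappa_neg {n d : ℕ} (h : 2 * d < n) :
    1 / (n + 1 : ℝ) + (2 * Real.pi * d + n * (-Real.pi + 1 / (n + 1))) < 0 := by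
  have hpi := Real.pi_gt_three
  have h1 : (2 * d + 1 : ℝ) ≤ n := by exact_mod_cast h
  have h2 : 1 / (n + 1 : ℝ) + (2 * Real.pi * d + n * (-Real.pi + 1 / (n + 1))) =
      1 + Real.pi * (2 * d - n) := by field_simp; ring
  rw [h2]
  nlinarith

lemma expBound_shiftedIntegrand (hs : RootsInStrip P) {h : ℝ[X]} (S : ℂ[X]) :
    ExpBound (strip (1 / 2)) (1 / (n + 1 : ℝ) + (2 * Real.pi * h.natDegree +
      n * (-Real.pi + 1 / (n + 1)))) (shiftedIntegrand P h S) := by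
  have hd : (0 : ℝ) < 1 / (n + 1) := by positivity
  have h1 := expBound_inv_sincProd (s := P.poly.roots) hs hd
  rw [P.card_roots] at h1
  exact (expBound_eval S _ hd).mul ((expBound_aeval_cos h le_rfl _ (-1) (by simp)).mul h1)

lemma differentiableOn_shiftedIntegrand (hs : RootsInStrip P) (h : ℝ[X]) (S : ℂ[X]) :
    DifferentiableOn ℂ (shiftedIntegrand P h S) (strip (1 / 2)) := by
  have h1 : Differentiable ℂ fun z : ℂ => aeval (-1 * Complex.cos (2 * Real.pi * z)) h := by
    have : Differentiable ℂ fun z : ℂ => aeval z h := by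
      simp only [aeval_def]
      simp only [← eval_map]
      exact Polynomial.differentiable _
    exact this.comp (by fun_prop)
  have h2 : DifferentiableOn ℂ (fun z => (sincProd P.poly.roots z)⁻¹) (strip (1 / 2)) :=
    differentiable_sincProd.differentiableOn.inv fun z hz => sincProd_ne_zero hs hz
  exact S.differentiable.differentiableOn.mul (h1.differentiableOn.mul h2)

lemma integrable_density (hs : RootsInStrip P) {h : ℝ[X]} (hh : 2 * h.natDegree < n) (R : ℂ[X]) :
    Integrable fun y : ℝ => R.eval (y * Complex.I) * (density P h y : ℂ) := by
  have hd : (0 : ℝ) < 1 / (n + 1) := by positivity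
  have h1 := expBound_inv_cosProd (s := P.poly.roots) hs
  rw [P.card_roots] at h1
  have h2 : {z : ℂ | z.re = 0} ⊆ strip (1 / 2) := fun z hz => by
    simp only [Set.mem_ofPred_eq] at hz
    simp [strip, hz]
  have h3 := ((expBound_eval R (1 / 2) hd).subset h2).mul
    ((expBound_aeval_cos h le_rfl _ 1 (by simp)).mul h1)
  have h4 : 1 / (n + 1 : ℝ) + (2 * Real.pi * h.natDegree + n * -Real.pi) < 0 := by
    have : (0 : ℝ) ≤ n * (1 / (n + 1)) := by positivity
    have := kappa_neg hh
    linarith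
  have hc : Continuous fun y : ℝ => R.eval (y * Complex.I) * (density P h y : ℂ) := by
    have := continuous_density hs h
    fun_prop
  simp only [ofReal_density hs] at hc ⊢
  have := h3.integrable h4 (a := 0) (by simp) (by simpa using hc)
  simpa using this

lemma integrable_shiftedDensity (hs : RootsInStrip P) {h : ℝ[X]} (hh : 2 * h.natDegree < n)
    (R : ℂ[X]) :
    Integrable fun y : ℝ => R.eval (y * Complex.I) * (shiftedDensity P h y : ℂ) := by
  have hc : Continuous fun y : ℝ => R.eval (y * Complex.I) * (shiftedDensity P h y : ℂ) := by
    have := continuous_shiftedDensity hs h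
    fun_prop
  simp only [ofReal_shiftedDensity hs] at hc ⊢
  have := (expBound_shiftedIntegrand hs R).integrable (kappa_neg hh) (a := 0)
    (by simp [strip]) (by simpa [shiftedIntegrand] using hc)
  simpa [shiftedIntegrand] using this

/-- The functional on `ℂ[z]` with density `h(cosh 2πy) / ∏ cos π(iy - α)` on the imaginary axis. -/
def momentFunctional (hs : RootsInStrip P) (h : ℝ[X]) (hh : 2 * h.natDegree < n) :
    ℂ[X] →ₗ[ℂ] ℂ where
  toFun R := ∫ y : ℝ, R.eval (y * Complex.I) * (density P h y : ℂ)
  map_add' R S := by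
    rw [← integral_add (integrable_density hs hh R) (integrable_density hs hh S)]
    simp only [eval_add, add_mul]
  map_smul' c R := by
    simp only [eval_smul, smul_eq_mul, mul_assoc, RingHom.id_apply]
    exact integral_const_mul _ _

lemma momentFunctional_apply (hs : RootsInStrip P) (h : ℝ[X]) (hh : 2 * h.natDegree < n)
    (R : ℂ[X]) : momentFunctional hs h hh R =
      ∫ y : ℝ, R.eval (y * Complex.I) * (density P h y : ℂ) := rfl

lemma shiftedIntegrand_add_half (hs : RootsInStrip P) (h : ℝ[X]) (S : ℂ[X]) (y : ℝ) :
    shiftedIntegrand P h S (1 / 2 + y * Complex.I) =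
      (taylor (1 / 2) (S * P.poly)).eval (y * Complex.I) * (density P h y : ℂ) := by
  have hc : Complex.cos (2 * Real.pi * (y * Complex.I + 1 / 2)) =
      -Complex.cos (2 * Real.pi * (y * Complex.I)) := by
    rw [← Complex.cos_add_pi]; congr 1; ring
  rw [add_comm, shiftedIntegrand, inv_sincProd_add_half hs (by simp), ofReal_density hs, hc,
    taylor_eval, eval_mul, ← P.eval_eq_prod]
  ring_nf

lemma shiftedIntegrand_sub_half (hs : RootsInStrip P) (h : ℝ[X]) (S : ℂ[X]) (y : ℝ) :
    shiftedIntegrand P h S (-(1 / 2) + y * Complex.I) = (-1) ^ n *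
      ((taylor (-(1 / 2)) (S * P.poly)).eval (y * Complex.I) * (density P h y : ℂ)) := by
  have hc : Complex.cos (2 * Real.pi * (y * Complex.I - 1 / 2)) =
      -Complex.cos (2 * Real.pi * (y * Complex.I)) := by
    rw [← Complex.cos_sub_pi]; congr 1; ring
  rw [neg_add_eq_sub, shiftedIntegrand, inv_sincProd_sub_half hs (by simp), ofReal_density hs, hc,
    taylor_eval, eval_mul, ← P.eval_eq_prod, P.card_roots]
  ring_nf

lemma integral_shiftedIntegrand (hs : RootsInStrip P) {h : ℝ[X]} (hh : 2 * h.natDegree < n)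
    (S : ℂ[X]) {a b : ℝ} (ha : |a| ≤ 1 / 2) (hb : |b| ≤ 1 / 2) :
    ∫ y : ℝ, shiftedIntegrand P h S (a + y * Complex.I) =
      ∫ y : ℝ, shiftedIntegrand P h S (b + y * Complex.I) :=
  integral_vertical_line_eq (differentiableOn_shiftedIntegrand hs h S)
    (expBound_shiftedIntegrand hs S) (kappa_neg hh) ha hb

/-- The left edge of the strip carries the shifted functional; moving the contour to the axis shows
the density governing positivity in weight 1. -/
lemma momentFunctional_shift (hs : RootsInStrip P) (h : ℝ[X]) (hh : 2 * h.natDegree < n)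
    (S : ℂ[X]) : (-1) ^ n * momentFunctional hs h hh (taylor (-(1 / 2)) (S * P.poly)) =
      ∫ y : ℝ, S.eval (y * Complex.I) * (shiftedDensity P h y : ℂ) := by
  have h1 := integral_shiftedIntegrand hs hh S (a := -(1 / 2)) (b := 0)
    (by norm_num [abs_of_pos]) (by norm_num)
  rw [momentFunctional_apply, ← integral_const_mul]
  simp only [← shiftedIntegrand_sub_half hs, ofReal_shiftedDensity hs]
  push_cast at h1
  rw [h1]
  simp [shiftedIntegrand]

/-- The two sides of the trace relation are integrals of one holomorphic function over the two edges
of the strip. Evenness comes from that of cosh and from the symmetry of the roots under α ↦ -α. -/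
lemma isEvenTrace_momentFunctional (hs : RootsInStrip P) (h : ℝ[X]) (hh : 2 * h.natDegree < n) :
    IsEvenTrace P (momentFunctional hs h hh) where
  trace S := by
    have h1 := integral_shiftedIntegrand hs hh S (a := 1 / 2) (b := -(1 / 2))
      (by norm_num [abs_of_pos]) (by norm_num [abs_of_pos])
    push_cast at h1
    rw [momentFunctional_apply, momentFunctional_apply, ← integral_const_mul]
    simp only [← shiftedIntegrand_sub_half hs, ← shiftedIntegrand_add_half hs]
    exact h1
  even R := by
    rw [momentFunctional_apply, momentFunctional_apply, ← integral_neg_eq_self]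
    congr 1
    ext y
    have : density P h (-y) = density P h y := by
      rw [density, density, mul_neg, Real.cosh_neg, Complex.ofReal_neg, neg_mul,
        cosProd_neg P.roots_neg]
    rw [this]
    simp

lemma momentFunctional_adj (hs : RootsInStrip P) (h : ℝ[X]) (hh : 2 * h.natDegree < n) (R : ℂ[X]) :
    momentFunctional hs h hh (adj R) = starRingEnd ℂ (momentFunctional hs h hh R) := by
  rw [momentFunctional_apply, momentFunctional_apply, ← integral_conj]
  congr 1
  ext y
  rw [eval_adj]
  simp

/-- The sign relating `ε` to the canonical sign. -/
def relSign (n : ℕ) (ε : ℤˣ) : ℝ := ((ε * canonicalSign n : ℤˣ) : ℤ)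

lemma re_momentFunctional (hs : RootsInStrip P) (h : ℝ[X]) (hh : 2 * h.natDegree < n) (M : ℂ[X]) :
    (momentFunctional hs h hh (M * adj M)).re =
      ∫ y : ℝ, ‖M.eval (y * Complex.I)‖ ^ 2 * density P h y := by
  rw [momentFunctional_apply, re_integral_mul_adj]

/-- The factor (-1)^n inside λ (`conjConst_eq`) cancels the one from the contour shift, so only the
sign relative to the canonical one survives. -/
lemma re_momentFunctional_shift (hs : RootsInStrip P) (h : ℝ[X]) (hh : 2 * h.natDegree < n)
    (ε : ℤˣ) (M : ℂ[X]) :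
    (conjConst n ε * momentFunctional hs h hh (taylor (-(1 / 2)) (M * adj M * P.poly))).re =
      relSign n ε * ∫ y : ℝ, ‖M.eval (y * Complex.I)‖ ^ 2 * shiftedDensity P h y := by
  rw [conjConst_eq, mul_assoc, momentFunctional_shift, ← re_integral_mul_adj, relSign]
  rw [show ((((ε * canonicalSign n : ℤˣ) : ℤ) : ℂ)) =
    (((((ε * canonicalSign n : ℤˣ) : ℤ) : ℝ)) : ℂ) by push_cast; rfl, Complex.re_ofReal_mul]

/-- Sufficient condition for positivity. -/
lemma isPositive_momentFunctional (hs : RootsInStrip P) {h : ℝ[X]} (hh : 2 * h.natDegree < n)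
    {ε : ℤˣ} (h1 : ∀ t, 1 ≤ t → 0 < h.eval t) (h2 : ∀ t, 1 ≤ t → 0 < relSign n ε * h.eval (-t)) :
    IsPositive P ε (momentFunctional hs h hh) where
  toIsEvenTrace := isEvenTrace_momentFunctional hs h hh
  hermitian := momentFunctional_adj hs h hh
  pos M hM := by
    rw [re_momentFunctional]
    exact integral_norm_sq_mul_pos (continuous_density hs h)
      (fun y => mul_pos (h1 _ (Real.one_le_cosh _)) (inv_pos.2 (hs.cosProd_re_pos y)))
      (integrable_density hs hh) hM
  pos_shift M hM := by
    rw [re_momentFunctional_shift, ← integral_const_mul]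
    have hint := fun R => (integrable_shiftedDensity hs hh R).const_mul (relSign n ε : ℂ)
    have := integral_norm_sq_mul_pos (k := fun y => relSign n ε * shiftedDensity P h y)
      ((continuous_shiftedDensity hs h).const_mul _)
      (fun y => by
        rw [shiftedDensity, ← mul_assoc]
        exact mul_pos (h2 _ (Real.one_le_cosh _)) (inv_pos.2 (hs.sincProd_re_pos y)))
      (fun R => (hint R).congr (Eventually.of_forall fun y => by push_cast; ring)) hM
    exact this.trans_eq (integral_congr_ae (Eventually.of_forall fun y => mul_left_comm _ _ _))

end Tau

end Kleinian

end

noncomputable section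

namespace Kleinian

open Polynomial MeasureTheory Filter Topology

section Tau

variable {n : ℕ} {P : Parameter n}

/-! ### Necessary conditions for positivity -/

lemma eventually_eval_pos {h : ℝ[X]} (hl : 0 < h.leadingCoeff) : ∀ᶠ t in atTop, 0 < h.eval t := by
  rcases lt_or_ge 0 h.degree with hd | hd
  · exact (h.tendsto_atTop_of_leadingCoeff_nonneg hd hl.le).eventually_gt_atTop 0
  · rw [eq_C_of_degree_le_zero hd] at hl ⊢
    exact Eventually.of_forall fun t => by simpa using hl

lemma exists_eval_cosh_pos {h : ℝ[X]} (hl : 0 < h.leadingCoeff) :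
    ∃ A : ℝ, ∀ y : ℝ, A ≤ |y| → 0 < h.eval (Real.cosh (2 * Real.pi * y)) := by
  obtain ⟨A, hA⟩ := eventually_atTop.1 (eventually_eval_pos hl)
  refine ⟨A, fun y hy => hA _ (hy.trans ?_)⟩
  have h1 : |2 * Real.pi * y| ≤ Real.sinh |2 * Real.pi * y| :=
    Real.self_le_sinh_iff.2 (abs_nonneg _)
  have h2 := Real.sinh_lt_cosh |2 * Real.pi * y|
  rw [Real.cosh_abs] at h2
  rw [abs_mul, abs_of_pos (by positivity : 0 < 2 * Real.pi)] at h1 h2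
  nlinarith [Real.pi_gt_three, abs_nonneg y]

lemma exists_moment_density_pos (hs : RootsInStrip P) {h : ℝ[X]} (hh : 2 * h.natDegree < n)
    (hl : 0 < h.leadingCoeff) :
    ∃ N : ℕ, 0 < ∫ y : ℝ, ‖((X : ℂ[X]) ^ N).eval (y * Complex.I)‖ ^ 2 * density P h y := by
  obtain ⟨A, hA⟩ := exists_eval_cosh_pos hl
  exact exists_moment_pos (continuous_density hs h)
    (fun y hy => mul_pos (hA y hy) (inv_pos.2 (hs.cosProd_re_pos y))) (integrable_density hs hh)

lemma exists_moment_shiftedDensity_pos (hs : RootsInStrip P) {h : ℝ[X]} (hh : 2 * h.natDegree < n)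
    (hl : 0 < (-1) ^ h.natDegree * h.leadingCoeff) :
    ∃ N : ℕ, 0 < ∫ y : ℝ, ‖((X : ℂ[X]) ^ N).eval (y * Complex.I)‖ ^ 2 * shiftedDensity P h y := by
  have hl' : 0 < (h.comp (-X)).leadingCoeff := by
    rw [comp_neg_X_leadingCoeff_eq]
    exact hl
  obtain ⟨A, hA⟩ := exists_eval_cosh_pos hl'
  refine exists_moment_pos (continuous_shiftedDensity hs h) (A := A)
    (fun y hy => mul_pos ?_ (inv_pos.2 (hs.sincProd_re_pos y))) (integrable_shiftedDensity hs hh)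
  simpa using hA y hy

lemma density_neg (h : ℝ[X]) (y : ℝ) : density P (-h) y = -density P h y := by simp [density]

lemma shiftedDensity_neg (h : ℝ[X]) (y : ℝ) :
    shiftedDensity P (-h) y = -shiftedDensity P h y := by simp [shiftedDensity]

lemma relSign_sq (n : ℕ) (ε : ℤˣ) : relSign n ε = 1 ∨ relSign n ε = -1 := by
  rw [relSign]
  rcases Int.units_eq_one_or (ε * canonicalSign n) with h | h <;> rw [h] <;> simp

/-- For large |y| the two densities have the signs of the leading coefficients of h(X) and h(-X). A
wrong sign would be detected by a high even moment, that is, by M = X^N in one of the positivity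
conditions. -/
lemma leadingCoeff_pos_of_isPositive (hs : RootsInStrip P) {h : ℝ[X]} (hh : 2 * h.natDegree < n)
    {ε : ℤˣ} (hp : IsPositive P ε (momentFunctional hs h hh)) :
    0 < h.leadingCoeff ∧ relSign n ε * (-1) ^ h.natDegree = 1 := by
  have hh' : 2 * (-h).natDegree < n := by rwa [natDegree_neg]
  have h1 : 0 < h.leadingCoeff := by
    by_contra hneg
    rcases (not_lt.1 hneg).lt_or_eq with hl | hl
    · obtain ⟨N, hN⟩ := exists_moment_density_pos hs hh' (by simpa using hl)
      have := hp.pos (X ^ N) (by simp)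
      rw [re_momentFunctional] at this
      simp only [density_neg, mul_neg, integral_neg] at hN
      linarith
    · rw [leadingCoeff_eq_zero] at hl
      have := hp.pos 1 one_ne_zero
      rw [re_momentFunctional] at this
      simp [hl, density] at this
  refine ⟨h1, ?_⟩
  have hcases : relSign n ε * (-1) ^ h.natDegree = 1 ∨ relSign n ε * (-1) ^ h.natDegree = -1 := by
    rcases relSign_sq n ε with h | h <;> rcases neg_one_pow_eq_or ℝ (natDegree ‹ℝ[X]›) with h' | h' <;>
      simp [h, h']
  refine hcases.resolve_right fun h2 => ?_
  rcases relSign_sq n ε with h3 | h3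
  · rw [h3, one_mul] at h2
    obtain ⟨N, hN⟩ := exists_moment_shiftedDensity_pos hs hh' (by
      rw [natDegree_neg, h2, leadingCoeff_neg]; simpa using h1)
    have := hp.pos_shift (X ^ N) (by simp)
    rw [re_momentFunctional_shift, h3] at this
    simp only [shiftedDensity_neg, mul_neg, integral_neg] at hN
    linarith
  · rw [h3, neg_one_mul, neg_inj] at h2
    obtain ⟨N, hN⟩ := exists_moment_shiftedDensity_pos hs hh (by rw [h2]; simpa using h1)
    have := hp.pos_shift (X ^ N) (by simp)
    rw [re_momentFunctional_shift, h3] at this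
    linarith

lemma momentFunctional_ne_zero (hs : RootsInStrip P) {h : ℝ[X]} (hh : 2 * h.natDegree < n)
    (h0 : h ≠ 0) : momentFunctional hs h hh ≠ 0 := by
  intro hzero
  rcases lt_or_gt_of_ne (leadingCoeff_ne_zero.2 h0) with hl | hl
  · have hh' : 2 * (-h).natDegree < n := by rwa [natDegree_neg]
    obtain ⟨N, hN⟩ := exists_moment_density_pos hs hh' (by simpa using hl)
    simp only [density_neg, mul_neg, integral_neg] at hN
    rw [← re_momentFunctional hs h hh, hzero] at hN
    simp at hN
  · obtain ⟨N, hN⟩ := exists_moment_density_pos hs hh hl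
    rw [← re_momentFunctional hs h hh, hzero] at hN
    simp at hN

/-! ### Even traces are determined by their low moments -/

lemma map_eq_coeff_mul {τ : ℂ[X] →ₗ[ℂ] ℂ} {d : ℕ} (h : ∀ i < d, τ (X ^ i) = 0) {Q : ℂ[X]}
    (hQ : Q.natDegree ≤ d) : τ Q = Q.coeff d * τ (X ^ d) := by
  conv_lhs => rw [Q.as_sum_range_C_mul_X_pow' (Nat.lt_succ_of_le hQ), map_sum,
    Finset.sum_range_succ]
  rw [Finset.sum_eq_zero, zero_add, ← smul_eq_C_mul, map_smul, smul_eq_mul]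
  intro i hi
  rw [← smul_eq_C_mul, map_smul, h i (Finset.mem_range.1 hi), smul_zero]

lemma coeff_taylor_of_natDegree_eq_succ {G : ℂ[X]} {d : ℕ} (hG : G.natDegree = d + 1) (a : ℂ) :
    (taylor a G).coeff d = G.coeff d + (d + 1) * G.coeff (d + 1) * a := by
  rw [taylor_coeff, eval_eq_sum_range' (n := 2)]
  · simp only [Finset.sum_range_succ, hasseDeriv_coeff]
    simp [add_comm 1 d, Nat.choose_succ_self_right]
  · have := natDegree_hasseDeriv_le G d
    omega

/-- Odd moments vanish by evenness. For even d ≥ n, some instance of the trace relation is the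
vanishing of τ on a polynomial of degree d, which expresses the d-th moment through lower ones. -/
lemma IsEvenTrace.eq_zero {τ : ℂ[X] →ₗ[ℂ] ℂ} (hτ : IsEvenTrace P τ)
    (h0 : ∀ j, 2 * j < n → τ (X ^ (2 * j)) = 0) : τ = 0 := by
  have key : ∀ d, τ (X ^ d) = 0 := by
    intro d
    induction d using Nat.strong_induction_on with
    | _ d ih =>
      rcases Nat.even_or_odd d with hd | hd
      · rcases lt_or_ge d n with hdn | hdn
        · obtain ⟨j, rfl⟩ := hd
          rw [← two_mul] at hdn ⊢
          exact h0 j hdn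
        · rcases Nat.even_or_odd n with hn | hn
          -- For n even the relation involves the difference G(z + 1/2) - G(z - 1/2), which drops
          -- one degree; so G has degree d + 1 and the top coefficient of the difference is d + 1.
          · set G := X ^ (d + 1 - n) * P.poly with hG
            have hGm : G.Monic := (monic_X_pow _).mul P.monic
            have hGd : G.natDegree = d + 1 := by
              rw [hG, (monic_X_pow _).natDegree_mul P.monic, natDegree_X_pow, P.natDegree_eq]
              omega
            have h1 := hτ.trace (X ^ (d + 1 - n))
            rw [hn.neg_one_pow, one_mul, ← sub_eq_zero, ← map_sub, ← hG] at h1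
            have hdeg : (taylor (1 / 2) G - taylor (-(1 / 2)) G).natDegree ≤ d := by
              have hlt : (taylor (1 / 2) G - taylor (-(1 / 2)) G).degree <
                  (taylor (1 / 2) G).degree := by
                refine degree_sub_lt_left ?_ (taylor_ne_zero hGm.ne_zero) ?_
                · simp
                · simp
              rw [degree_taylor, degree_eq_natDegree hGm.ne_zero, hGd] at hlt
              rw [natDegree_le_iff_degree_le]
              exact Order.le_of_lt_succ (by exact_mod_cast hlt)
            rw [map_eq_coeff_mul ih hdeg, coeff_sub, coeff_taylor_of_natDegree_eq_succ hGd,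
              coeff_taylor_of_natDegree_eq_succ hGd, ← hGd, hGm.coeff_natDegree, mul_eq_zero] at h1
            refine h1.resolve_left fun h2 => ?_
            have h3 : (d + 1 : ℂ) = 0 := by linear_combination h2
            exact absurd h3 (by exact_mod_cast Nat.succ_ne_zero d)
          -- For n odd it involves the sum, with no drop in degree; so G has degree d and the top
          -- coefficient of the sum is 2.
          · set G := X ^ (d - n) * P.poly with hG
            have hGm : G.Monic := (monic_X_pow _).mul P.monic
            have hGd : G.natDegree = d := by
              rw [hG, (monic_X_pow _).natDegree_mul P.monic, natDegree_X_pow, P.natDegree_eq]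
              omega
            have h1 := hτ.trace (X ^ (d - n))
            rw [hn.neg_one_pow, neg_one_mul, ← sub_eq_zero, sub_neg_eq_add, ← map_add, ← hG] at h1
            have hdeg : (taylor (1 / 2) G + taylor (-(1 / 2)) G).natDegree ≤ d := by
              refine (natDegree_add_le _ _).trans ?_
              simp [hGd]
            have hc : ∀ a : ℂ, (taylor a G).coeff d = 1 := by
              intro a
              have := leadingCoeff_taylor (f := G) (r := a)
              rw [leadingCoeff, natDegree_taylor, hGd, hGm.leadingCoeff] at this
              exact this
            rw [map_eq_coeff_mul ih hdeg, coeff_add, hc, hc, mul_eq_zero] at h1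
            exact h1.resolve_left (by norm_num)
      · have := hτ.even (X ^ d)
        rw [X_pow_comp, hd.neg_pow, map_neg] at this
        exact CharZero.neg_eq_self_iff.1 this
  refine Polynomial.lhom_ext' fun k => LinearMap.ext_ring ?_
  simpa [← X_pow_eq_monomial] using key k

end Tau

end Kleinian

end

noncomputable section

namespace Kleinian

open Polynomial MeasureTheory Filter Topology

section Cone

variable {n : ℕ} {P : Parameter n}

/-! ### The dimension of the cone of positive traces -/

lemma two_mul_natDegree_lt (hn : 1 ≤ n) {D : ℕ} (hD : 2 * D ≤ n + 1) {p : ℝ[X]}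
    (hp : p ∈ degreeLT ℝ D) : 2 * p.natDegree < n := by
  by_cases h0 : p = 0
  · simp [h0]; omega
  · have := (natDegree_lt_iff_degree_lt h0).2 (mem_degreeLT.1 hp)
    omega

lemma density_add (g h : ℝ[X]) (y : ℝ) : density P (g + h) y = density P g y + density P h y := by
  simp [density, add_mul]

lemma density_smul (c : ℝ) (h : ℝ[X]) (y : ℝ) : density P (c • h) y = c * density P h y := by
  simp [density, mul_assoc]

/-- The map `h ↦ ∫ R(iy) h(cosh 2πy) / ∏ cos π(iy - α) dy`. -/
def momentMap (hs : RootsInStrip P) (hn : 1 ≤ n) {D : ℕ} (hD : 2 * D ≤ n + 1) :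
    degreeLT ℝ D →ₗ[ℝ] (ℂ[X] →ₗ[ℂ] ℂ) where
  toFun p := momentFunctional hs p.1 (two_mul_natDegree_lt hn hD p.2)
  map_add' p q := by
    refine LinearMap.ext fun R => ?_
    rw [LinearMap.add_apply, momentFunctional_apply, momentFunctional_apply,
      momentFunctional_apply, ← integral_add
        (integrable_density hs (two_mul_natDegree_lt hn hD p.2) R)
        (integrable_density hs (two_mul_natDegree_lt hn hD q.2) R)]
    simp only [Submodule.coe_add, density_add, Complex.ofReal_add, mul_add]
  map_smul' c p := by
    refine LinearMap.ext fun R => ?_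
    rw [RingHom.id_apply, LinearMap.smul_apply, momentFunctional_apply, momentFunctional_apply,
      ← integral_smul]
    simp only [Submodule.coe_smul, density_smul, Complex.ofReal_mul, Complex.real_smul,
      mul_left_comm]

lemma momentMap_injective (hs : RootsInStrip P) (hn : 1 ≤ n) {D : ℕ} (hD : 2 * D ≤ n + 1) :
    Function.Injective (momentMap hs hn hD) := by
  rw [← LinearMap.ker_eq_bot, LinearMap.ker_eq_bot']
  intro p hp
  by_contra h0
  exact momentFunctional_ne_zero hs (two_mul_natDegree_lt hn hD p.2) (fun h => h0 (Subtype.ext h)) hp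

lemma conj_moment {τ : ℂ[X] →ₗ[ℂ] ℂ} (h : ∀ R, τ (adj R) = starRingEnd ℂ (τ R)) (j : ℕ) :
    ((τ (X ^ (2 * j))).re : ℂ) = τ (X ^ (2 * j)) := by
  have := h (X ^ (2 * j))
  rw [show adj (X ^ (2 * j)) = X ^ (2 * j) by simp [adj, pow_mul]] at this
  exact Complex.conj_eq_iff_re.1 this.symm

/-- A dimension count. The low even moments embed the D-dimensional real space of functionals τ_h
into ℝ^D, hence map it onto ℝ^D. So some τ_h has the same low moments as τ, which are real by
hermiticity, and the difference is an even trace without low moments. -/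
lemma IsPositive.exists_eq (hs : RootsInStrip P) (hn : 1 ≤ n) {ε : ℤˣ} {τ : ℂ[X] →ₗ[ℂ] ℂ}
    (hτ : IsPositive P ε τ) : ∃ h hh, τ = momentFunctional hs h hh := by
  -- The number of j with 2j < n, which is also the number of coefficients of an h with 2 deg h < n.
  set D := (n - 1) / 2 + 1
  have hD : 2 * D ≤ n + 1 := by omega
  let L : (ℂ[X] →ₗ[ℂ] ℂ) →ₗ[ℝ] (Fin D → ℝ) :=
    { toFun := fun τ j => (τ (X ^ (2 * (j : ℕ)))).re
      map_add' := fun _ _ => by ext; simp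
      map_smul' := fun _ _ => by ext; simp }
  have hL : ∀ σ : ℂ[X] →ₗ[ℂ] ℂ, IsEvenTrace P σ →
      (∀ j : ℕ, ((σ (X ^ (2 * j))).re : ℂ) = σ (X ^ (2 * j))) → L σ = 0 → σ = 0 := by
    intro σ h1 h2 h3
    refine h1.eq_zero fun j hj => ?_
    have := congrFun h3 ⟨j, by omega⟩
    rw [← h2]
    exact_mod_cast this
  let M := (L ∘ₗ momentMap hs hn hD) ∘ₗ (degreeLTEquiv ℝ D).symm.toLinearMap
  have hM : Function.Injective M := by
    rw [← LinearMap.ker_eq_bot, LinearMap.ker_eq_bot']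
    intro f hf
    have hh := two_mul_natDegree_lt hn hD ((degreeLTEquiv ℝ D).symm f).2
    have h1 := hL _ (isEvenTrace_momentFunctional hs _ hh)
      (conj_moment (momentFunctional_adj hs _ hh)) hf
    have h2 := momentMap_injective hs hn hD (h1.trans (map_zero (momentMap hs hn hD)).symm)
    simpa using h2
  obtain ⟨f, hf⟩ := LinearMap.injective_iff_surjective.1 hM (L τ)
  set p := (degreeLTEquiv ℝ D).symm f with hp
  have hh := two_mul_natDegree_lt hn hD p.2
  refine ⟨p.1, hh, sub_eq_zero.1 (hL _ ⟨fun S => ?_, fun R => ?_⟩ (fun j => ?_) ?_)⟩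
  · rw [LinearMap.sub_apply, LinearMap.sub_apply, hτ.trace,
      (isEvenTrace_momentFunctional hs _ hh).trace, mul_sub]
  · rw [LinearMap.sub_apply, LinearMap.sub_apply, hτ.even,
      (isEvenTrace_momentFunctional hs _ hh).even]
  · rw [LinearMap.sub_apply, Complex.sub_re, Complex.ofReal_sub, conj_moment hτ.hermitian,
      conj_moment (momentFunctional_adj hs _ hh)]
  · rw [map_sub, sub_eq_zero]
    exact hf.symm

lemma mem_positiveEvenTraces (hs : RootsInStrip P) (hn : 1 ≤ n) {ε : ℤˣ}
    {T : Quant P.poly →ₗ[ℂ] ℂ} (hT : T ∈ positiveEvenTraces P ε) :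
    ∃ h hh, T = extend P (momentFunctional hs h hh) ∧ relSign n ε * (-1) ^ h.natDegree = 1 := by
  obtain ⟨τ, rfl, hτ⟩ := isPositive_of_mem hT
  obtain ⟨h, hh, rfl⟩ := hτ.exists_eq hs hn
  exact ⟨h, hh, rfl, (leadingCoeff_pos_of_isPositive hs hh hτ).2⟩

lemma abs_eval_le {p : ℝ[X]} {m : ℕ} (hp : p.natDegree ≤ m) {t : ℝ} (ht : 1 ≤ |t|) :
    |p.eval t| ≤ (∑ i ∈ Finset.range (m + 1), |p.coeff i|) * |t| ^ m := by
  rw [eval_eq_sum_range' (Nat.lt_succ_of_le hp), Finset.sum_mul]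
  refine (Finset.abs_sum_le_sum_abs _ _).trans (Finset.sum_le_sum fun i hi => ?_)
  rw [abs_mul, abs_pow]
  gcongr
  exact Finset.mem_range_succ_iff.1 hi

/-- Polynomials dominated by `C X ^ m` give positive traces after adding `C X ^ m`. -/
lemma extend_momentFunctional_mem (hs : RootsInStrip P) {ε : ℤˣ} {m : ℕ}
    (hm : relSign n ε * (-1) ^ m = 1) {p : ℝ[X]} (hp : p.natDegree ≤ m) {c : ℝ}
    (hc : ∑ i ∈ Finset.range (m + 1), |p.coeff i| < c)
    (hh : 2 * (p + c • X ^ m).natDegree < n) :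
    extend P (momentFunctional hs (p + c • X ^ m) hh) ∈ positiveEvenTraces P ε := by
  have hr : |relSign n ε| = 1 := by rcases relSign_sq n ε with h | h <;> simp [h]
  refine extend_mem (isPositive_momentFunctional hs hh (fun t ht => ?_) fun t ht => ?_)
  · have habs : |t| = t := abs_of_pos (by linarith)
    have h1 := abs_eval_le hp (t := t) (by rwa [habs])
    rw [habs] at h1
    have h2 := neg_abs_le (p.eval t)
    have h3 : 0 < t ^ m := by positivity
    simp only [eval_add, eval_smul, eval_pow, eval_X, smul_eq_mul]
    nlinarith
  · have habs : |-t| = t := by rw [abs_neg, abs_of_pos (by linarith)]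
    have h1 := abs_eval_le hp (t := -t) (by rwa [habs])
    rw [habs] at h1
    have h2 := neg_abs_le (relSign n ε * p.eval (-t))
    rw [abs_mul, hr, one_mul] at h2
    have h3 : 0 < t ^ m := by positivity
    simp only [eval_add, eval_smul, eval_pow, eval_X, smul_eq_mul, mul_add]
    rw [neg_pow t m, show relSign n ε * (c * ((-1) ^ m * t ^ m)) =
      (relSign n ε * (-1) ^ m) * (c * t ^ m) by ring, hm, one_mul]
    nlinarith

lemma extend_injective : Function.Injective (extend P) := fun σ τ h => by
  refine LinearMap.ext fun R => ?_
  rw [← extend_zev, h, extend_zev]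

/-- The map from polynomials of degree less than `D` to traces. -/
def traceMap (hs : RootsInStrip P) (hn : 1 ≤ n) {D : ℕ} (hD : 2 * D ≤ n + 1) :
    degreeLT ℝ D →ₗ[ℝ] (Quant P.poly →ₗ[ℂ] ℂ) where
  toFun p := extend P (momentMap hs hn hD p)
  map_add' p q := by rw [map_add, extend, LinearMap.add_comp]; rfl
  map_smul' c p := by rw [map_smul, extend, LinearMap.smul_comp]; rfl

/-- The hypotheses say that D is at least the largest degree allowed for h and that degree D has the
wrong sign. Hence every positive trace comes from degree less than D, while degree D - 1, when it
exists, has the right sign. -/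
lemma span_positiveEvenTraces (hs : RootsInStrip P) (hn : 1 ≤ n) {ε : ℤˣ} {D : ℕ}
    (hD : 2 * D ≤ n + 1) (hD' : (n - 1) / 2 ≤ D) (hsign : relSign n ε * (-1) ^ D = -1) :
    Submodule.span ℝ (positiveEvenTraces P ε : Set (Quant P.poly →ₗ[ℂ] ℂ)) =
      LinearMap.range (traceMap hs hn hD) := by
  refine le_antisymm (Submodule.span_le.2 fun T hT => ?_) ?_
  · obtain ⟨h, hh, rfl, hsg⟩ := mem_positiveEvenTraces hs hn hT
    have hne : h.natDegree ≠ D := fun heq => by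
      rw [heq, hsign] at hsg
      norm_num at hsg
    -- From 2 deg h < n the degree is at most (n-1)/2 ≤ D, and D itself is excluded.
    have hlt : h.natDegree < D := by omega
    have hmem : h ∈ degreeLT ℝ D := mem_degreeLT.2
      (lt_of_le_of_lt degree_le_natDegree (by exact_mod_cast hlt))
    exact ⟨⟨h, hmem⟩, rfl⟩
  · rintro _ ⟨p, rfl⟩
    rcases D with _ | m
    · have : p = 0 := by
        by_contra h0
        exact absurd ((natDegree_lt_iff_degree_lt (fun h => h0 (Subtype.ext h))).2
          (mem_degreeLT.1 p.2)) (Nat.not_lt_zero _)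
      rw [this, map_zero]
      exact zero_mem _
    · have hsign' : relSign n ε * (-1) ^ m = 1 := by
        rw [pow_succ] at hsign
        linarith
      have hdeg : ∀ q : degreeLT ℝ (m + 1), q.1.natDegree ≤ m := fun q => by
        by_cases h0 : q.1 = 0
        · simp [h0]
        · exact Nat.lt_succ_iff.1 ((natDegree_lt_iff_degree_lt h0).2 (mem_degreeLT.1 q.2))
      have hX : (X ^ m : ℝ[X]) ∈ degreeLT ℝ (m + 1) := by
        rw [mem_degreeLT, degree_X_pow]
        exact_mod_cast Nat.lt_succ_self m
      -- For c large, p is the difference of p + c X^m and c X^m, both of which give positive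
      -- traces.
      set x : degreeLT ℝ (m + 1) := ⟨X ^ m, hX⟩
      have key : ∀ (q : degreeLT ℝ (m + 1)) (c : ℝ),
          ∑ i ∈ Finset.range (m + 1), |q.1.coeff i| < c →
          traceMap hs hn hD (q + c • x) ∈ Submodule.span ℝ
            (positiveEvenTraces P ε : Set (Quant P.poly →ₗ[ℂ] ℂ)) := fun q c hc =>
        Submodule.subset_span (extend_momentFunctional_mem hs hsign' (hdeg q) hc
          (two_mul_natDegree_lt hn hD (q + c • x).2))
      set c := ∑ i ∈ Finset.range (m + 1), |p.1.coeff i| + 1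
      have hc : 0 < c := by positivity
      have h1 := key p c (lt_add_one _)
      have h2 := key 0 c (by simpa using hc)
      have h3 := Submodule.sub_mem _ h1 h2
      rwa [← map_sub, show p + c • x - (0 + c • x) = p by abel] at h3

lemma hasDimModScaling_positiveEvenTraces (hs : RootsInStrip P) (hn : 1 ≤ n) {ε : ℤˣ} {D : ℕ}
    (hD : 2 * D ≤ n + 1) (hD' : (n - 1) / 2 ≤ D) (hsign : relSign n ε * (-1) ^ D = -1)
    {d : ℤ} (hd : d + 1 = D) : HasDimModScaling (positiveEvenTraces P ε) d := by
  have hfin : FiniteDimensional ℝ (degreeLT ℝ D) :=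
    Module.Finite.equiv (degreeLTEquiv ℝ D).symm
  have hinj : Function.Injective (traceMap hs hn hD) := fun p q h =>
    momentMap_injective hs hn hD (extend_injective h)
  have hspan := span_positiveEvenTraces hs hn hD hD' hsign
  refine ⟨?_, ?_, fun hneg => ?_⟩
  · rw [hspan]
    infer_instance
  · rw [hspan, LinearMap.finrank_range_of_inj hinj, (degreeLTEquiv ℝ D).finrank_eq, hd]
    simp
  · have hD0 : D = 0 := by omega
    refine Set.eq_empty_of_forall_notMem fun T hT => ?_
    obtain ⟨h, hh, rfl, hsg⟩ := mem_positiveEvenTraces hs hn hT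
    have h0 : h.natDegree = 0 := by omega
    rw [h0, ← hD0, hsign] at hsg
    norm_num at hsg

/-- The largest possible degree of h is (n-1)/2, rounded down. This says that ρ_+ admits it exactly
when n is odd; hence ρ_- admits it exactly when n is even. -/
lemma relSign_one (n : ℕ) (hn : 1 ≤ n) :
    relSign n 1 = if Odd n then (-1) ^ ((n - 1) / 2) else -(-1) ^ ((n - 1) / 2) := by
  obtain ⟨q, r, hr, rfl⟩ : ∃ q r, r < 4 ∧ n = 4 * q + r :=
    ⟨n / 4, n % 4, Nat.mod_lt _ (by norm_num), by omega⟩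
  have hm : (4 * q + r) % 4 = r := by omega
  have hodd : Odd (4 * q + r) ↔ Odd r := by
    rw [Nat.odd_add', iff_true_right (Even.mul_right (by decide) q)]
  rw [relSign, canonicalSign, hm]
  simp only [hodd]
  interval_cases r
  · obtain ⟨q, rfl⟩ : ∃ k, q = k + 1 := ⟨q - 1, by omega⟩
    rw [show (4 * (q + 1) + 0 - 1) / 2 = 2 * q + 1 by omega]
    simp [pow_succ, pow_mul]
  · rw [show (4 * q + 1 - 1) / 2 = 2 * q by omega]
    simp [pow_mul]
  · rw [show (4 * q + 2 - 1) / 2 = 2 * q by omega]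
    have : ¬ Odd 2 := by decide
    simp [this, pow_mul]
  · rw [show (4 * q + 3 - 1) / 2 = 2 * q + 1 by omega]
    have : Odd 3 := by decide
    simp [this, pow_succ, pow_mul]

lemma relSign_neg_one (n : ℕ) : relSign n (-1) = -relSign n 1 := by
  simp [relSign]

end Cone

end Kleinian

end

noncomputable section

namespace Kleinian

open Polynomial

/-! ### The filtration of `𝒜_P` and its associated graded algebra -/

section Filtration

/-- The degree of a word in the generators. -/
def wdeg (n : ℕ) (w : List Gen) : ℕ := (w.map (Gen.degree n)).sum

/-- The value of a word in `𝒜_P`. -/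
def word (P : ℂ[X]) (w : List Gen) : Quant P := (w.map (gen P)).prod

/-- The polynomials `p^n`, `q^n`, `pq`. -/
def genPoly (n : ℕ) : Gen → MvPolynomial (Fin 2) ℂ
  | Gen.u => MvPolynomial.X 0 ^ n
  | Gen.v => MvPolynomial.X 1 ^ n
  | Gen.z => MvPolynomial.X 0 * MvPolynomial.X 1

/-- The value of a word in `ℂ[p,q]`. -/
def wordPoly (n : ℕ) (w : List Gen) : MvPolynomial (Fin 2) ℂ := (w.map (genPoly n)).prod

lemma wdeg_append (n : ℕ) (w w' : List Gen) : wdeg n (w ++ w') = wdeg n w + wdeg n w' := by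
  simp [wdeg]

lemma word_append (P : ℂ[X]) (w w' : List Gen) : word P (w ++ w') = word P w * word P w' := by
  simp [word]

lemma wordPoly_append (n : ℕ) (w w' : List Gen) :
    wordPoly n (w ++ w') = wordPoly n w * wordPoly n w' := by
  simp [wordPoly]

lemma coe_prod_genInv (n : ℕ) (hn : 1 ≤ n) (w : List Gen) :
    ((w.map (genInv n hn)).prod : Inv n).1 = wordPoly n w := by
  induction w with
  | nil => rfl
  | cons g t ih =>
    rw [List.map_cons, List.prod_cons, wordPoly, List.map_cons, List.prod_cons, ← wordPoly, ← ih]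
    cases g <;> rfl

variable {n : ℕ} {P : ℂ[X]}

lemma word_mem_filtLT {w : List Gen} {d : ℕ} (h : wdeg n w < d) : word P w ∈ filtLT n P d :=
  Submodule.subset_span ⟨w, h, rfl⟩

lemma filtLT_mono {d e : ℕ} (h : d ≤ e) : filtLT n P d ≤ filtLT n P e :=
  Submodule.span_mono fun _ ⟨w, hw, ha⟩ => ⟨w, hw.trans_le h, ha⟩

lemma filtLT_zero : filtLT n P 0 = ⊥ := by
  rw [filtLT, Submodule.span_eq_bot]
  rintro a ⟨w, hw, _⟩
  exact absurd hw (Nat.not_lt_zero _)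

/-- Both bounds are strict, so concatenated words have degree at most i + j - 2; this allows the
extra 1. -/
lemma mul_mem_filtLT {i j d : ℕ} (hd : i + j ≤ d + 1) {a b : Quant P} (ha : a ∈ filtLT n P i)
    (hb : b ∈ filtLT n P j) : a * b ∈ filtLT n P d := by
  induction ha, hb using Submodule.span_induction₂ with
  | mem_mem a b ha hb =>
    obtain ⟨w, hw, rfl⟩ := ha
    obtain ⟨w', hw', rfl⟩ := hb
    change word P w * word P w' ∈ _
    rw [← word_append]
    refine word_mem_filtLT ?_
    change wdeg n w < i at hw
    change wdeg n w' < j at hw'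
    rw [wdeg_append]
    omega
  | zero_left => simp
  | zero_right => simp
  | add_left a b c _ _ _ h1 h2 => rw [add_mul]; exact add_mem h1 h2
  | add_right a b c _ _ _ h1 h2 => rw [mul_add]; exact add_mem h1 h2
  | smul_left r a b _ _ h => rw [smul_mul_assoc]; exact Submodule.smul_mem _ _ h
  | smul_right r a b _ _ h => rw [mul_smul_comm]; exact Submodule.smul_mem _ _ h

/-- The terms z^i e_k that occur have i ≤ e - 1, hence degree at most 2(e - 1) + n|k| < d. -/
lemma zev_mul_wt_mem {R : ℂ[X]} {e d : ℕ} {k : ℤ} (hR : R.degree < e)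
    (hd : (2 * e + |n * k| : ℤ) ≤ d + 1) : zev P R * wt P k ∈ filtLT n P d := by
  rw [zev, aeval_eq_sum_range, Finset.sum_mul]
  refine Submodule.sum_mem _ fun i hi => ?_
  by_cases hc : R.coeff i = 0
  · simp [hc]
  · rw [smul_mul_assoc]
    refine Submodule.smul_mem _ _ ?_
    have hi' : i < e := by
      have h1 := (le_degree_of_ne_zero hc).trans_lt hR
      exact_mod_cast h1
    have hw : gen P Gen.z ^ i * wt P k = word P (List.replicate i Gen.z ++
        (List.replicate k.toNat Gen.v ++ List.replicate (-k).toNat Gen.u)) := by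
      simp [word, wt]
    rw [hw]
    refine word_mem_filtLT ?_
    rw [wdeg_append, wdeg_append]
    simp only [wdeg, List.map_replicate, List.sum_replicate, Gen.degree, smul_eq_mul]
    have h1 : (k.toNat + (-k).toNat : ℤ) = |k| := by
      rw [← Int.natCast_natAbs]; omega
    rw [abs_mul, Nat.abs_cast, ← h1, mul_add] at hd
    rw [mul_comm _ n, mul_comm _ n]
    zify
    have h2 : (i : ℤ) < e := by exact_mod_cast hi'
    linarith

/-- The PBW element with symbol `p ^ i * q ^ j`. -/
def pbwElt (n : ℕ) (P : ℂ[X]) (i j : ℕ) : Quant P :=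
  if (n : ℤ) ∣ j - i then zev P (X ^ min i j) * wt P ((j - i : ℤ) / n) else 0

/-- The linear map sending `p ^ i * q ^ j` to the PBW element with this symbol. -/
def pbwMap (n : ℕ) (P : ℂ[X]) : MvPolynomial (Fin 2) ℂ →ₗ[ℂ] Quant P :=
  (MvPolynomial.basisMonomials (Fin 2) ℂ).constr ℂ fun m => pbwElt n P (m 0) (m 1)

lemma pbwMap_monomial (m : Fin 2 →₀ ℕ) (c : ℂ) :
    pbwMap n P (MvPolynomial.monomial m c) = c • pbwElt n P (m 0) (m 1) := by
  have h : MvPolynomial.monomial m c = c • MvPolynomial.basisMonomials (Fin 2) ℂ m := by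
    simp [MvPolynomial.smul_monomial]
  rw [h, map_smul, pbwMap, Module.Basis.constr_basis]

lemma X_pow_mul_X_pow (i j : ℕ) : (MvPolynomial.X 0 ^ i * MvPolynomial.X 1 ^ j :
    MvPolynomial (Fin 2) ℂ) =
    MvPolynomial.monomial (Finsupp.single 0 i + Finsupp.single 1 j) 1 := by
  rw [MvPolynomial.X_pow_eq_monomial, MvPolynomial.X_pow_eq_monomial, MvPolynomial.monomial_mul,
    one_mul]

lemma pbwMap_mono (i j : ℕ) :
    pbwMap n P (MvPolynomial.X 0 ^ i * MvPolynomial.X 1 ^ j) = pbwElt n P i j := by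
  rw [X_pow_mul_X_pow, pbwMap_monomial, one_smul]
  simp

/-- The two elements differ by (Q - R)(z) e_l with Q and R monic of equal degree, so the leading
terms cancel. Translations do not change leading terms, and a factor P produced by uv or vu leads
with z^n, the symbol p^n q^n. -/
lemma gen_mul_pbwElt (hn : 1 ≤ n) (hP : P.Monic) (hPn : P.natDegree = n) (g : Gen) {i j : ℕ}
    (h : (n : ℤ) ∣ j - i) :
    gen P g * pbwElt n P i j - pbwMap n P (genPoly n g *
      (MvPolynomial.X 0 ^ i * MvPolynomial.X 1 ^ j)) ∈ filtLT n P (g.degree n + (i + j)) := by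
  obtain ⟨k, hk⟩ := h
  have hn0 : (n : ℤ) ≠ 0 := by omega
  have hpos : (0 : ℤ) < n := by omega
  have hdiv : (j - i : ℤ) / n = k := by rw [hk, Int.mul_ediv_cancel_left _ hn0]
  have hlt : ∀ {Q R : ℂ[X]} {e : ℕ}, Q.Monic → Q.natDegree = e → R.Monic →
      R.natDegree = e → (Q - R).degree < e := by
    intro Q R e hQ hQe hR hRe
    have := degree_sub_lt_left (p := Q) (q := R) (by
      rw [degree_eq_natDegree hQ.ne_zero, degree_eq_natDegree hR.ne_zero, hQe, hRe]) hQ.ne_zero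
      (by rw [hQ.leadingCoeff, hR.leadingCoeff])
    rwa [degree_eq_natDegree hQ.ne_zero, hQe] at this
  have htm : ∀ (a : ℂ) {Q : ℂ[X]}, Q.Monic → (taylor a Q).Monic := by
    intro a Q hQ
    rw [Monic, leadingCoeff_taylor, hQ.leadingCoeff]
  cases g with
  | z =>
    have h1 : genPoly n Gen.z * (MvPolynomial.X 0 ^ i * MvPolynomial.X 1 ^ j) =
        MvPolynomial.X 0 ^ (i + 1) * MvPolynomial.X 1 ^ (j + 1) := by
      rw [genPoly]; ring
    have h2 : ((j + 1 : ℕ) - (i + 1 : ℕ) : ℤ) = j - i := by push_cast; ring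
    rw [h1, pbwMap_mono, pbwElt, pbwElt, h2, if_pos ⟨k, hk⟩, if_pos ⟨k, hk⟩, Nat.add_min_add_right,
      pow_succ', zev, zev, map_mul, aeval_X, mul_assoc, sub_self]
    exact zero_mem _
  | v =>
    have h1 : genPoly n Gen.v * (MvPolynomial.X 0 ^ i * MvPolynomial.X 1 ^ j) =
        MvPolynomial.X 0 ^ i * MvPolynomial.X 1 ^ (j + n) := by
      rw [genPoly]; ring
    have h2 : ((j + n : ℕ) - i : ℤ) = n * (k + 1) := by push_cast; linear_combination hk
    rw [h1, pbwMap_mono, pbwElt, pbwElt, h2, if_pos ⟨k, hk⟩, if_pos ⟨k + 1, rfl⟩, hdiv,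
      Int.mul_ediv_cancel_left _ hn0, ← mul_assoc, gen_v_mul_zev, mul_assoc, gen_v_mul_wt,
      ← mul_assoc, zev, zev, zev, ← map_mul, ← sub_mul, ← map_sub]
    rcases le_or_gt 0 k with hk0 | hk0
    · have hij : i ≤ j := by nlinarith
      rw [cocycleV, if_pos hk0, mul_one, min_eq_left hij, min_eq_left (by omega)]
      refine zev_mul_wt_mem (e := i) (hlt (htm _ (monic_X_pow i))
        (by rw [natDegree_taylor, natDegree_X_pow]) (monic_X_pow i) (natDegree_X_pow i)) ?_
      rw [← h2, abs_of_nonneg (by omega), Gen.degree]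
      push_cast
      linarith
    -- Here v cancels a u: the exponent of z rises from j to j + n, matching the degree n of P.
    · have hij : j + n ≤ i := by
        have : (n : ℤ) * k ≤ n * (-1) := by gcongr; omega
        omega
      rw [cocycleV, if_neg (by omega), min_eq_right (by omega), min_eq_right (by omega)]
      refine zev_mul_wt_mem (e := j + n) (hlt ((htm _ (monic_X_pow j)).mul (htm _ hP)) ?_
        (monic_X_pow _) (by simp)) ?_
      · rw [(htm _ (monic_X_pow j)).natDegree_mul (htm _ hP), natDegree_taylor,
          natDegree_taylor, natDegree_X_pow, hPn]
      rw [← h2, abs_of_nonpos (by omega), Gen.degree]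
      push_cast
      linarith
  | u =>
    have h1 : genPoly n Gen.u * (MvPolynomial.X 0 ^ i * MvPolynomial.X 1 ^ j) =
        MvPolynomial.X 0 ^ (i + n) * MvPolynomial.X 1 ^ j := by
      rw [genPoly]; ring
    have h2 : (j - (i + n : ℕ) : ℤ) = n * (k - 1) := by push_cast; linear_combination hk
    rw [h1, pbwMap_mono, pbwElt, pbwElt, h2, if_pos ⟨k, hk⟩, if_pos ⟨k - 1, rfl⟩, hdiv,
      Int.mul_ediv_cancel_left _ hn0, ← mul_assoc, gen_u_mul_zev, mul_assoc, gen_u_mul_wt,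
      ← mul_assoc, zev, zev, zev, ← map_mul, ← sub_mul, ← map_sub]
    rcases le_or_gt k 0 with hk0 | hk0
    · have hij : j ≤ i := by nlinarith
      rw [cocycleU, if_pos hk0, mul_one, min_eq_right hij, min_eq_right (by omega)]
      refine zev_mul_wt_mem (e := j) (hlt (htm _ (monic_X_pow j))
        (by rw [natDegree_taylor, natDegree_X_pow]) (monic_X_pow j) (natDegree_X_pow j)) ?_
      rw [← h2, abs_of_nonpos (by omega), Gen.degree]
      push_cast
      linarith
    · have hij : i + n ≤ j := by
        have : (n : ℤ) * 1 ≤ n * k := by gcongr; omega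
        omega
      rw [cocycleU, if_neg (by omega), min_eq_left (by omega), min_eq_left (by omega)]
      refine zev_mul_wt_mem (e := i + n) (hlt ((htm _ (monic_X_pow i)).mul (htm _ hP)) ?_
        (monic_X_pow _) (by simp)) ?_
      · rw [(htm _ (monic_X_pow i)).natDegree_mul (htm _ hP), natDegree_taylor,
          natDegree_taylor, natDegree_X_pow, hPn]
      rw [← h2, abs_of_nonneg (by omega), Gen.degree]
      push_cast
      linarith

lemma exists_wordPoly_eq (n : ℕ) (w : List Gen) : ∃ i j : ℕ, (n : ℤ) ∣ j - i ∧
    i + j = wdeg n w ∧ wordPoly n w = MvPolynomial.X 0 ^ i * MvPolynomial.X 1 ^ j := by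
  induction w with
  | nil => exact ⟨0, 0, by simp, rfl, by simp [wordPoly]⟩
  | cons g t ih =>
    obtain ⟨i, j, ⟨k, hk⟩, hd, h⟩ := ih
    have h1 : wordPoly n (g :: t) = genPoly n g * wordPoly n t := by simp [wordPoly]
    have h2 : wdeg n (g :: t) = g.degree n + wdeg n t := by simp [wdeg]
    rw [h1, h2, h, ← hd]
    cases g with
    | u => exact ⟨i + n, j, ⟨k - 1, by push_cast; linear_combination hk⟩,
        by rw [Gen.degree]; ring, by rw [genPoly]; ring⟩
    | v => exact ⟨i, j + n, ⟨k + 1, by push_cast; linear_combination hk⟩,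
        by rw [Gen.degree]; ring, by rw [genPoly]; ring⟩
    | z => exact ⟨i + 1, j + 1, ⟨k, by push_cast; linear_combination hk⟩,
        by rw [Gen.degree]; ring, by rw [genPoly]; ring⟩

lemma word_sub_pbwMap_mem (hn : 1 ≤ n) (hP : P.Monic) (hPn : P.natDegree = n) (w : List Gen) :
    word P w - pbwMap n P (wordPoly n w) ∈ filtLT n P (wdeg n w) := by
  induction w with
  | nil =>
    have h1 := pbwMap_mono (n := n) (P := P) 0 0
    rw [pow_zero, pow_zero, one_mul] at h1
    have h2 : pbwElt n P 0 0 = 1 := by simp [pbwElt, wt_zero, zev]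
    simp [word, wordPoly, h1, h2]
  | cons g t ih =>
    obtain ⟨i, j, hij, hd, h⟩ := exists_wordPoly_eq n t
    have h1 : wordPoly n (g :: t) = genPoly n g * wordPoly n t := by simp [wordPoly]
    have h2 : wdeg n (g :: t) = g.degree n + wdeg n t := by simp [wdeg]
    have h3 : word P (g :: t) = gen P g * word P t := by simp [word]
    have h4 : gen P g ∈ filtLT n P (g.degree n + 1) := by
      have := word_mem_filtLT (P := P) (n := n) (w := [g]) (d := g.degree n + 1) (by simp [wdeg])
      simpa [word] using this
    have h5 := gen_mul_pbwElt hn hP hPn g hij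
    rw [← pbwMap_mono, ← h, hd] at h5
    rw [h1, h2, h3]
    have h6 := add_mem (mul_mem_filtLT (d := g.degree n + wdeg n t) (by omega) h4 ih) h5
    rwa [mul_sub, sub_add_sub_cancel] at h6

/-! ### Symbols -/

variable (n P) in
/-- The pairs `(f, x)` with `f` homogeneous of degree `d` and `x` of degree at most `d` with symbol
`f`. -/
def Symb (d : ℤ) : Submodule ℂ (MvPolynomial (Fin 2) ℂ × Quant P) :=
  Submodule.span ℂ {p | ∃ w, (wdeg n w : ℤ) = d ∧ p = (wordPoly n w, word P w) ∨
    (wdeg n w : ℤ) < d ∧ p = (0, word P w)}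

lemma word_mem_symb (w : List Gen) {d : ℤ} (h : wdeg n w = d) :
    (wordPoly n w, word P w) ∈ Symb n P d := Submodule.subset_span ⟨w, Or.inl ⟨h, rfl⟩⟩

lemma zero_word_mem_symb (w : List Gen) {d : ℤ} (h : wdeg n w < d) :
    ((0 : MvPolynomial (Fin 2) ℂ), word P w) ∈ Symb n P d :=
  Submodule.subset_span ⟨w, Or.inr ⟨h, rfl⟩⟩

lemma zero_mem_symb {d : ℕ} {x : Quant P} (hx : x ∈ filtLT n P d) :
    ((0 : MvPolynomial (Fin 2) ℂ), x) ∈ Symb n P d := by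
  induction hx using Submodule.span_induction with
  | mem x hx =>
    obtain ⟨w, hw, rfl⟩ := hx
    exact zero_word_mem_symb w (by exact_mod_cast hw)
  | zero => exact zero_mem _
  | add x y _ _ h1 h2 => simpa using add_mem h1 h2
  | smul c x _ h => simpa using Submodule.smul_mem _ c h

lemma symb_zero_of_lt {d e : ℤ} (hde : d < e) {p : MvPolynomial (Fin 2) ℂ × Quant P}
    (hp : p ∈ Symb n P d) : ((0 : MvPolynomial (Fin 2) ℂ), p.2) ∈ Symb n P e := by
  induction hp using Submodule.span_induction with
  | mem x hx =>
    obtain ⟨w, ⟨hw, rfl⟩ | ⟨hw, rfl⟩⟩ := hx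
    · exact zero_word_mem_symb w (by omega)
    · exact zero_word_mem_symb w (by omega)
  | zero => exact zero_mem _
  | add x y _ _ h1 h2 => simpa using add_mem h1 h2
  | smul c x _ h => simpa using Submodule.smul_mem _ c h

lemma symb_mul {d e : ℤ} {p q : MvPolynomial (Fin 2) ℂ × Quant P} (hp : p ∈ Symb n P d)
    (hq : q ∈ Symb n P e) : p * q ∈ Symb n P (d + e) := by
  induction hp, hq using Submodule.span_induction₂ with
  | mem_mem a b ha hb =>
    obtain ⟨w, ⟨hw, rfl⟩ | ⟨hw, rfl⟩⟩ := ha <;> obtain ⟨w', ⟨hw', rfl⟩ | ⟨hw', rfl⟩⟩ := hb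
    · rw [Prod.mk_mul_mk, ← word_append, ← wordPoly_append]
      exact word_mem_symb _ (by rw [wdeg_append]; push_cast; omega)
    all_goals
      rw [Prod.mk_mul_mk, ← word_append]
      simp only [mul_zero, zero_mul]
      exact zero_word_mem_symb _ (by rw [wdeg_append]; push_cast; omega)
  | zero_left => simp
  | zero_right => simp
  | add_left a b c _ _ _ h1 h2 => rw [add_mul]; exact add_mem h1 h2
  | add_right a b c _ _ _ h1 h2 => rw [mul_add]; exact add_mem h1 h2
  | smul_left r a b _ _ h => rw [smul_mul_assoc]; exact Submodule.smul_mem _ _ h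
  | smul_right r a b _ _ h => rw [mul_smul_comm]; exact Submodule.smul_mem _ _ h

lemma sub_pbwMap_mem (hn : 1 ≤ n) (hP : P.Monic) (hPn : P.natDegree = n) {d : ℕ}
    {p : MvPolynomial (Fin 2) ℂ × Quant P} (hp : p ∈ Symb n P d) :
    p.2 - pbwMap n P p.1 ∈ filtLT n P d := by
  induction hp using Submodule.span_induction with
  | mem x hx =>
    obtain ⟨w, ⟨hw, rfl⟩ | ⟨hw, rfl⟩⟩ := hx
    · rw [← Nat.cast_inj.1 hw]
      exact word_sub_pbwMap_mem hn hP hPn w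
    · simpa using word_mem_filtLT (by exact_mod_cast hw)
  | zero => simp
  | add x y _ _ h1 h2 =>
    have := add_mem h1 h2
    rwa [sub_add_sub_comm, ← map_add] at this
  | smul c x _ h =>
    have := Submodule.smul_mem _ c h
    rwa [smul_sub, ← map_smul] at this

/-! ### The Poisson bracket -/

lemma bracket_swap (f g : MvPolynomial (Fin 2) ℂ) : bracket n f g = -bracket n g f := by
  rw [bracket, bracket, ← smul_neg]; congr 1; ring

lemma bracket_add_left (f g h : MvPolynomial (Fin 2) ℂ) :
    bracket n (f + g) h = bracket n f h + bracket n g h := by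
  rw [bracket, bracket, bracket, ← smul_add]; congr 1; simp only [map_add]; ring

lemma bracket_smul_left (c : ℂ) (f h : MvPolynomial (Fin 2) ℂ) :
    bracket n (c • f) h = c • bracket n f h := by
  simp only [bracket, Derivation.map_smul, smul_mul_assoc, ← smul_sub]
  rw [smul_comm]

lemma bracket_mul_left (f g h : MvPolynomial (Fin 2) ℂ) :
    bracket n (f * g) h = f * bracket n g h + bracket n f h * g := by
  simp only [bracket, mul_smul_comm, smul_mul_assoc, ← smul_add]
  congr 1
  simp only [Derivation.leibniz, smul_eq_mul]
  ring

lemma bracket_zero_left (f : MvPolynomial (Fin 2) ℂ) : bracket n 0 f = 0 := by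
  simp [bracket]

lemma bracket_zero_right (f : MvPolynomial (Fin 2) ℂ) : bracket n f 0 = 0 := by
  simp [bracket]

/-- The pair of a Poisson bracket and a commutator. -/
def pairBracket (n : ℕ) (p q : MvPolynomial (Fin 2) ℂ × Quant P) :
    MvPolynomial (Fin 2) ℂ × Quant P :=
  (bracket n p.1 q.1, p.2 * q.2 - q.2 * p.2)

lemma pairBracket_swap (p q : MvPolynomial (Fin 2) ℂ × Quant P) :
    pairBracket n p q = -pairBracket n q p := by
  rw [pairBracket, pairBracket, bracket_swap, Prod.neg_mk, neg_sub]

/-- Both brackets are derivations, so statements about pairs pass from generators to words. -/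
lemma pairBracket_mul (p q r : MvPolynomial (Fin 2) ℂ × Quant P) :
    pairBracket n (p * q) r = p * pairBracket n q r + pairBracket n p r * q := by
  refine Prod.ext (bracket_mul_left _ _ _) ?_
  simp only [pairBracket, Prod.snd_mul, Prod.snd_add]
  noncomm_ring

lemma pairBracket_zero_left (p : MvPolynomial (Fin 2) ℂ × Quant P) : pairBracket n 0 p = 0 := by
  refine Prod.ext (bracket_zero_left _) ?_
  simp [pairBracket]

lemma pairBracket_add_left (p q r : MvPolynomial (Fin 2) ℂ × Quant P) :
    pairBracket n (p + q) r = pairBracket n p r + pairBracket n q r := by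
  refine Prod.ext (bracket_add_left _ _ _) ?_
  simp only [pairBracket, Prod.snd_add, add_mul, mul_add]
  abel

lemma pairBracket_smul_left (c : ℂ) (p r : MvPolynomial (Fin 2) ℂ × Quant P) :
    pairBracket n (c • p) r = c • pairBracket n p r := by
  refine Prod.ext (bracket_smul_left _ _ _) ?_
  simp only [pairBracket, Prod.smul_snd, smul_mul_assoc, mul_smul_comm, smul_sub]

lemma pairBracket_self (p : MvPolynomial (Fin 2) ℂ × Quant P) : pairBracket n p p = 0 := by
  refine Prod.ext ?_ ?_
  · simp [pairBracket, bracket, mul_comm]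
  · simp [pairBracket]

lemma gen_mem_symb (g : Gen) : (genPoly n g, gen P g) ∈ Symb n P (g.degree n) := by
  have := word_mem_symb (n := n) (P := P) [g] (d := g.degree n) (by simp [wdeg])
  simpa [wordPoly, word] using this

lemma pairBracket_zu (hn : 1 ≤ n) : pairBracket n (genPoly n Gen.z, gen P Gen.z)
    (genPoly n Gen.u, gen P Gen.u) = -(genPoly n Gen.u, gen P Gen.u) := by
  obtain ⟨n, rfl⟩ : ∃ k, n = k + 1 := ⟨n - 1, by omega⟩
  refine Prod.ext ?_ (gen_zu P)
  simp only [pairBracket, bracket, genPoly, Prod.neg_mk, MvPolynomial.smul_eq_C_mul]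
  simp [MvPolynomial.pderiv_X]
  have h : MvPolynomial.C (σ := Fin 2) ((n : ℂ) + 1)⁻¹ * ((n : MvPolynomial (Fin 2) ℂ) + 1) = 1 := by
    rw [← map_natCast (MvPolynomial.C (σ := Fin 2) (R := ℂ)), ← map_one (MvPolynomial.C (σ := Fin 2)),
      ← map_add, ← map_mul, inv_mul_cancel₀ (by exact_mod_cast Nat.succ_ne_zero n)]
  linear_combination (MvPolynomial.X 0 ^ (n + 1)) * h

lemma pairBracket_zv (hn : 1 ≤ n) : pairBracket n (genPoly n Gen.z, gen P Gen.z)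
    (genPoly n Gen.v, gen P Gen.v) = (genPoly n Gen.v, gen P Gen.v) := by
  obtain ⟨n, rfl⟩ : ∃ k, n = k + 1 := ⟨n - 1, by omega⟩
  refine Prod.ext ?_ (gen_zv P)
  simp only [pairBracket, bracket, genPoly, MvPolynomial.smul_eq_C_mul]
  simp [MvPolynomial.pderiv_X]
  have h : MvPolynomial.C (σ := Fin 2) ((n : ℂ) + 1)⁻¹ * ((n : MvPolynomial (Fin 2) ℂ) + 1) = 1 := by
    rw [← map_natCast (MvPolynomial.C (σ := Fin 2) (R := ℂ)), ← map_one (MvPolynomial.C (σ := Fin 2)),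
      ← map_add, ← map_mul, inv_mul_cancel₀ (by exact_mod_cast Nat.succ_ne_zero n)]
  linear_combination (MvPolynomial.X 1 ^ (n + 1)) * h

/-- The commutator [u,v] = P(z + 1/2) - P(z - 1/2) leads with n z^(n-1), and {p^n, q^n} = n
(pq)^(n-1) by the normalization {p,q} = 1/n. -/
lemma pairBracket_uv_mem (hn : 1 ≤ n) (hP : P.Monic) (hPn : P.natDegree = n) :
    pairBracket n (genPoly n Gen.u, gen P Gen.u) (genPoly n Gen.v, gen P Gen.v) ∈
      Symb n P (n + n - 2 : ℤ) := by
  set D : ℂ[X] := taylor (1 / 2) P - taylor (-(1 / 2)) P with hD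
  have h1 : pairBracket n (genPoly n Gen.u, gen P Gen.u) (genPoly n Gen.v, gen P Gen.v) =
      (n : ℂ) • (wordPoly n (List.replicate (n - 1) Gen.z), word P (List.replicate (n - 1) Gen.z)) +
      (0, zev P (D - C (n : ℂ) * X ^ (n - 1)) * wt P 0) := by
    refine Prod.ext ?_ ?_
    · obtain ⟨n, rfl⟩ : ∃ k, n = k + 1 := ⟨n - 1, by omega⟩
      simp only [pairBracket, bracket, genPoly, wordPoly, List.map_replicate, List.prod_replicate,
        Prod.fst_add, Prod.smul_fst, add_zero, MvPolynomial.smul_eq_C_mul]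
      simp [MvPolynomial.pderiv_X]
      have h : MvPolynomial.C (σ := Fin 2) ((n : ℂ) + 1)⁻¹ *
          ((n : MvPolynomial (Fin 2) ℂ) + 1) = 1 := by
        rw [← map_natCast (MvPolynomial.C (σ := Fin 2) (R := ℂ)),
          ← map_one (MvPolynomial.C (σ := Fin 2)),
          ← map_add, ← map_mul, inv_mul_cancel₀ (by exact_mod_cast Nat.succ_ne_zero n)]
      linear_combination (MvPolynomial.X 0 ^ n * MvPolynomial.X 1 ^ n *
        ((n : MvPolynomial (Fin 2) ℂ) + 1)) * h
    · simp only [pairBracket, word, List.map_replicate, List.prod_replicate, Prod.snd_add,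
        Prod.smul_snd, wt_zero, mul_one]
      rw [gen_uv', gen_vu', hD, zev, zev, zev]
      simp [Algebra.smul_def]
  rw [h1]
  refine add_mem (Submodule.smul_mem _ _ (word_mem_symb _ ?_)) ?_
  · simp only [wdeg, List.map_replicate, List.sum_replicate, Gen.degree, smul_eq_mul]
    omega
  · have h2 : (n + n - 2 : ℤ) = (2 * (n - 1) : ℕ) := by omega
    rw [h2]
    refine zero_mem_symb (zev_mul_wt_mem (e := n - 1) ?_ (by simp))
    rw [degree_lt_iff_coeff_zero]
    intro m hm
    rw [hD, coeff_sub, coeff_sub, coeff_C_mul, coeff_X_pow]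
    rcases eq_or_lt_of_le hm with rfl | hm
    · have h3 : P.coeff (n - 1 + 1) = 1 := by
        rw [Nat.sub_add_cancel hn, ← hPn, hP.coeff_natDegree]
      have h4 : ((n - 1 : ℕ) : ℂ) + 1 = n := by
        rw [← Nat.cast_add_one, Nat.sub_add_cancel hn]
      rw [coeff_taylor_of_natDegree_eq_succ (by omega), coeff_taylor_of_natDegree_eq_succ
        (by omega), h3, h4, if_pos rfl]
      ring
    · rw [if_neg hm.ne', mul_zero, sub_zero]
      rcases eq_or_lt_of_le (show n ≤ m by omega) with rfl | hm'
      · have h3 : ∀ a : ℂ, (taylor a P).coeff n = 1 := fun a => by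
          rw [← hPn, coeff_taylor_natDegree, hP.leadingCoeff]
        rw [h3, h3, sub_self]
      · rw [coeff_eq_zero_of_natDegree_lt (by rwa [natDegree_taylor, hPn]),
          coeff_eq_zero_of_natDegree_lt (by rwa [natDegree_taylor, hPn]), sub_self]

lemma pairBracket_gen_mem (hn : 1 ≤ n) (hP : P.Monic) (hPn : P.natDegree = n) (g g' : Gen) :
    pairBracket n (genPoly n g, gen P g) (genPoly n g', gen P g') ∈
      Symb n P (g.degree n + g'.degree n - 2 : ℤ) := by
  have h1 : (2 + n - 2 : ℤ) = n := by ring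
  have h2 : (n + 2 - 2 : ℤ) = n := by ring
  have hu := gen_mem_symb (n := n) (P := P) Gen.u
  have hv := gen_mem_symb (n := n) (P := P) Gen.v
  cases g <;> cases g' <;> simp only [Gen.degree, Nat.cast_ofNat, h1, h2]
  · rw [pairBracket_self]; exact zero_mem _
  · exact pairBracket_uv_mem hn hP hPn
  · rw [pairBracket_swap, pairBracket_zu hn, neg_neg]; exact hu
  · rw [pairBracket_swap]; exact neg_mem (pairBracket_uv_mem hn hP hPn)
  · rw [pairBracket_self]; exact zero_mem _
  · rw [pairBracket_swap, pairBracket_zv hn]; exact neg_mem hv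
  · rw [pairBracket_zu hn]; exact neg_mem hu
  · rw [pairBracket_zv hn]; exact hv
  · rw [pairBracket_self]; exact zero_mem _

/-- If a pair has a small bracket with all generators on the right, then so it has with words. -/
lemma pairBracket_word_mem {q : MvPolynomial (Fin 2) ℂ × Quant P} {d : ℤ}
    (h : ∀ g, pairBracket n (genPoly n g, gen P g) q ∈ Symb n P (g.degree n + d - 2 : ℤ))
    (w : List Gen) : pairBracket n (wordPoly n w, word P w) q ∈ Symb n P (wdeg n w + d - 2) := by
  induction w with
  | nil =>
    have : pairBracket n (wordPoly n [], word P []) q = 0 := by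
      simp [pairBracket, bracket, wordPoly, word]
    rw [this]
    exact zero_mem _
  | cons g t ih =>
    have h1 : (wordPoly n (g :: t), word P (g :: t)) =
        (genPoly n g, gen P g) * (wordPoly n t, word P t) := by
      simp [wordPoly, word]
    have h2 : wdeg n (g :: t) = g.degree n + wdeg n t := by simp [wdeg]
    rw [h1, pairBracket_mul]
    refine add_mem ?_ ?_
    · convert symb_mul (gen_mem_symb g) ih using 2
      rw [h2]; push_cast; ring
    · convert symb_mul (h g) (word_mem_symb t rfl) using 2
      rw [h2]; push_cast; ring

/-- Commutators drop the degree by two and have the Poisson bracket as symbol. The derivation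
property in each argument reduces this to generators. Integer degrees allow d + e - 2 to be
negative, in which case there are no nonzero symbols. -/
lemma pairBracket_mem (hn : 1 ≤ n) (hP : P.Monic) (hPn : P.natDegree = n) {d e : ℤ}
    {p q : MvPolynomial (Fin 2) ℂ × Quant P} (hp : p ∈ Symb n P d) (hq : q ∈ Symb n P e) :
    pairBracket n p q ∈ Symb n P (d + e - 2) := by
  have hw : ∀ w w', pairBracket n (wordPoly n w, word P w) (wordPoly n w', word P w') ∈
      Symb n P (wdeg n w + wdeg n w' - 2 : ℤ) := by
    intro w w'
    refine pairBracket_word_mem (fun g => ?_) w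
    rw [pairBracket_swap]
    convert neg_mem (pairBracket_word_mem (fun g' =>
      pairBracket_gen_mem hn hP hPn g' g) w') using 2
    ring
  -- If one entry has too small a degree, its symbol component is zero and the commutator falls
  -- below the degree in question.
  have h0 : ∀ w w' f g, bracket n f g = 0 → (wdeg n w + wdeg n w' : ℤ) < d + e →
      pairBracket n (f, word P w) (g, word P w') ∈ Symb n P (d + e - 2) := by
    intro w w' f g hfg hd
    have h1 := symb_zero_of_lt (e := d + e - 2) (by linarith) (hw w w')
    have h2 : pairBracket n (f, word P w) (g, word P w') = (0, (pairBracket n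
        (wordPoly n w, word P w) (wordPoly n w', word P w')).2) := Prod.ext hfg rfl
    rwa [h2]
  induction hp, hq using Submodule.span_induction₂ with
  | mem_mem a b ha hb =>
    obtain ⟨w, ⟨hd, rfl⟩ | ⟨hd, rfl⟩⟩ := ha <;> obtain ⟨w', ⟨he, rfl⟩ | ⟨he, rfl⟩⟩ := hb
    · rw [← hd, ← he]
      exact hw w w'
    · exact h0 w w' _ _ (bracket_zero_right _) (by omega)
    · exact h0 w w' _ _ (bracket_zero_left _) (by omega)
    · exact h0 w w' _ _ (bracket_zero_left _) (by omega)
  | zero_left y _ => rw [pairBracket_zero_left]; exact zero_mem _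
  | zero_right y _ => rw [pairBracket_swap, pairBracket_zero_left, neg_zero]; exact zero_mem _
  | add_left a b c _ _ _ h1 h2 => rw [pairBracket_add_left]; exact add_mem h1 h2
  | add_right a b c _ _ _ h1 h2 =>
    rw [pairBracket_swap, pairBracket_add_left, neg_add, ← pairBracket_swap, ← pairBracket_swap]
    exact add_mem h1 h2
  | smul_left r a b _ _ h => rw [pairBracket_smul_left]; exact Submodule.smul_mem _ _ h
  | smul_right r a b _ _ h =>
    rw [pairBracket_swap, pairBracket_smul_left, ← smul_neg, ← pairBracket_swap]
    exact Submodule.smul_mem _ _ h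

end Filtration

end Kleinian

end

noncomputable section

namespace Kleinian

open Polynomial

/-! ### Invariants -/

section Invariants

variable {n : ℕ}

lemma coeff_rot (m : Fin 2 →₀ ℕ) (f : MvPolynomial (Fin 2) ℂ) :
    MvPolynomial.coeff m (rot n f) = zeta n ^ m 0 * (zeta n)⁻¹ ^ m 1 * MvPolynomial.coeff m f := by
  induction f using MvPolynomial.induction_on' with
  | monomial s c =>
    have h : rot n (MvPolynomial.monomial s c) =
        MvPolynomial.monomial s (zeta n ^ s 0 * (zeta n)⁻¹ ^ s 1 * c) := by
      rw [rot, MvPolynomial.aeval_monomial, Finsupp.prod_fintype _ _ (by simp),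
        MvPolynomial.monomial_eq, Finsupp.prod_fintype _ _ (by simp)]
      simp only [Fin.prod_univ_two, Matrix.cons_val_zero, Matrix.cons_val_one,
        MvPolynomial.smul_eq_C_mul, MvPolynomial.algebraMap_eq, map_mul, map_pow]
      ring
    rw [h, MvPolynomial.coeff_monomial, MvPolynomial.coeff_monomial]
    split_ifs with hs
    · rw [hs]
    · rw [mul_zero]
  | add p q hp hq => rw [map_add, MvPolynomial.coeff_add, hp, hq, MvPolynomial.coeff_add, mul_add]

lemma zeta_pow_mul_eq_one_iff (hn : 1 ≤ n) (i j : ℕ) :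
    zeta n ^ i * (zeta n)⁻¹ ^ j = 1 ↔ (n : ℤ) ∣ j - i := by
  have h : IsPrimitiveRoot (zeta n) n := Complex.isPrimitiveRoot_exp n (by omega)
  have h0 : zeta n ≠ 0 := Complex.exp_ne_zero _
  rw [← neg_sub, dvd_neg, ← h.zpow_eq_one_iff_dvd, zpow_sub₀ h0, zpow_natCast, zpow_natCast,
    inv_pow, div_eq_mul_inv]

lemma mem_inv_iff (hn : 1 ≤ n) {f : MvPolynomial (Fin 2) ℂ} :
    f ∈ Inv n ↔ ∀ m, MvPolynomial.coeff m f ≠ 0 → (n : ℤ) ∣ m 1 - m 0 := by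
  change rot n f = f ↔ _
  rw [MvPolynomial.ext_iff]
  refine forall_congr' fun m => ?_
  rw [coeff_rot, ← zeta_pow_mul_eq_one_iff hn, mul_left_eq_self₀]
  tauto

/-- The homogeneous components of an element of `A`. -/
def invComp (hn : 1 ≤ n) (d : ℕ) : Inv n →ₗ[ℂ] Inv n :=
  ((MvPolynomial.homogeneousComponent d).comp (Subalgebra.toSubmodule (Inv n)).subtype).codRestrict
    (Subalgebra.toSubmodule (Inv n)) fun f => by
      refine (mem_inv_iff hn).2 fun m hm => (mem_inv_iff hn).1 f.2 m ?_
      rw [LinearMap.comp_apply, MvPolynomial.coeff_homogeneousComponent] at hm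
      exact fun h => hm (by rw [← h]; split_ifs <;> simp_all)

lemma coe_invComp (hn : 1 ≤ n) (d : ℕ) (f : Inv n) :
    (invComp hn d f).1 = MvPolynomial.homogeneousComponent d f.1 := rfl

lemma invComp_isHomogeneous (hn : 1 ≤ n) (d : ℕ) (f : Inv n) :
    (invComp hn d f).1.IsHomogeneous d := MvPolynomial.homogeneousComponent_isHomogeneous _ _

lemma invComp_self (hn : 1 ≤ n) {d : ℕ} {f : Inv n} (hf : f.1.IsHomogeneous d) :
    invComp hn d f = f := Subtype.ext (MvPolynomial.homogeneousComponent_eq_self hf)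

lemma invComp_of_ne (hn : 1 ≤ n) {d e : ℕ} (h : e ≠ d) {f : Inv n} (hf : f.1.IsHomogeneous d) :
    invComp hn e f = 0 := by
  refine Subtype.ext ?_
  rw [coe_invComp, MvPolynomial.homogeneousComponent_of_mem hf, if_neg h]
  rfl

lemma sum_invComp (hn : 1 ≤ n) {f : Inv n} {N : ℕ} (h : ∀ e, N ≤ e → invComp hn e f = 0) :
    ∑ e ∈ Finset.range N, invComp hn e f = f := by
  have h1 : ∑ e ∈ Finset.range (f.1.totalDegree + 1), invComp hn e f = f := by
    refine Subtype.ext ?_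
    rw [← Subalgebra.coe_val, map_sum]
    exact MvPolynomial.sum_homogeneousComponent f.1
  rcases le_total N (f.1.totalDegree + 1) with h2 | h2
  · refine Eq.trans ?_ h1
    refine Finset.sum_subset (Finset.range_subset_range.2 h2) fun e _ he => h e ?_
    simpa using he
  · refine Eq.trans ?_ h1
    refine (Finset.sum_subset (Finset.range_subset_range.2 h2) fun e _ he => ?_).symm
    refine Subtype.ext (MvPolynomial.homogeneousComponent_eq_zero _ _ ?_)
    have h3 := mt Finset.mem_range.2 he
    change f.1.totalDegree < e
    omega

lemma exists_invComp_eq_zero (hn : 1 ≤ n) (f : Inv n) : ∃ N, ∀ e, N ≤ e → invComp hn e f = 0 :=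
  ⟨f.1.totalDegree + 1, fun e he => Subtype.ext
    (MvPolynomial.homogeneousComponent_eq_zero e f.1 (by omega))⟩

/-- Induction on homogeneous elements. -/
lemma inv_induction (hn : 1 ≤ n) {p : Inv n → Prop} (h0 : p 0)
    (ha : ∀ f g, p f → p g → p (f + g)) (hh : ∀ d (f : Inv n), f.1.IsHomogeneous d → p f)
    (f : Inv n) : p f := by
  obtain ⟨N, hN⟩ := exists_invComp_eq_zero hn f
  rw [← sum_invComp hn hN]
  exact Finset.sum_induction _ p ha h0 fun e _ => hh e _ (invComp_isHomogeneous hn e f)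

lemma quatHom_C (c : ℂ) : quatHom (MvPolynomial.C c) = MvPolynomial.C (starRingEnd ℂ c) := by
  simp [quatHom]

lemma quatHom_isHomogeneous {d : ℕ} {f : MvPolynomial (Fin 2) ℂ} (hf : f.IsHomogeneous d) :
    (quatHom f).IsHomogeneous d := by
  have := (hf.map (starRingEnd ℂ)).aeval (S := ℂ) (n := 1)
    (![MvPolynomial.X 1, -MvPolynomial.X 0] : Fin 2 → MvPolynomial (Fin 2) ℂ) (by
      intro i
      fin_cases i
      · exact MvPolynomial.isHomogeneous_X _ _
      · exact (MvPolynomial.isHomogeneous_X _ _).neg)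
  rwa [one_mul] at this

end Invariants

/-! ### Existence and uniqueness of symbols -/

section Symbols

variable {n : ℕ} {P : ℂ[X]}

lemma exists_word_eq (hn : 1 ≤ n) {i j : ℕ} (h : (n : ℤ) ∣ j - i) : ∃ w, wdeg n w = i + j ∧
    wordPoly n w = MvPolynomial.X 0 ^ i * MvPolynomial.X 1 ^ j ∧ word P w = pbwElt n P i j := by
  obtain ⟨k, hk⟩ := h
  have hdiv : (j - i : ℤ) / n = k := by rw [hk, Int.mul_ediv_cancel_left _ (by omega)]
  refine ⟨List.replicate (min i j) Gen.z ++
    (List.replicate k.toNat Gen.v ++ List.replicate (-k).toNat Gen.u), ?_, ?_, ?_⟩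
  · rw [wdeg_append, wdeg_append]
    simp only [wdeg, List.map_replicate, List.sum_replicate, Gen.degree, smul_eq_mul]
    obtain ⟨m, rfl | rfl⟩ := k.eq_nat_or_neg
    · have : j = i + n * m := by zify; linarith
      subst this
      simp
      ring
    · have : i = j + n * m := by zify; linarith
      subst this
      simp
      ring
  · rw [wordPoly_append, wordPoly_append]
    simp only [wordPoly, List.map_replicate, List.prod_replicate, genPoly]
    obtain ⟨m, rfl | rfl⟩ := k.eq_nat_or_neg
    · have : j = i + n * m := by zify; linarith
      subst this
      simp
      ring
    · have : i = j + n * m := by zify; linarith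
      subst this
      simp
      ring
  · rw [pbwElt, if_pos ⟨k, hk⟩, hdiv]
    simp [word, wt, zev]

lemma wordPoly_isHomogeneous (w : List Gen) : (wordPoly n w).IsHomogeneous (wdeg n w) := by
  induction w with
  | nil => exact MvPolynomial.isHomogeneous_one _ _
  | cons g t ih =>
    have h1 : wordPoly n (g :: t) = genPoly n g * wordPoly n t := by simp [wordPoly]
    have h2 : wdeg n (g :: t) = g.degree n + wdeg n t := by simp [wdeg]
    rw [h1, h2]
    refine MvPolynomial.IsHomogeneous.mul ?_ ih
    cases g
    · exact MvPolynomial.isHomogeneous_X_pow _ _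
    · exact MvPolynomial.isHomogeneous_X_pow _ _
    · exact (MvPolynomial.isHomogeneous_X _ _).mul (MvPolynomial.isHomogeneous_X _ _)

lemma symb_fst_isHomogeneous {d : ℕ} {p : MvPolynomial (Fin 2) ℂ × Quant P}
    (hp : p ∈ Symb n P d) : p.1.IsHomogeneous d := by
  induction hp using Submodule.span_induction with
  | mem x hx =>
    obtain ⟨w, ⟨hw, rfl⟩ | ⟨hw, rfl⟩⟩ := hx
    · rw [← Nat.cast_inj.1 hw]
      exact wordPoly_isHomogeneous w
    · exact MvPolynomial.isHomogeneous_zero _ _ _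
  | zero => exact MvPolynomial.isHomogeneous_zero _ _ _
  | add x y _ _ h1 h2 => exact h1.add h2
  | smul c x _ h =>
    rw [Prod.smul_fst, MvPolynomial.smul_eq_C_mul]
    exact h.C_mul c

lemma symb_fst_mem_inv (hn : 1 ≤ n) {d : ℤ} {p : MvPolynomial (Fin 2) ℂ × Quant P}
    (hp : p ∈ Symb n P d) : p.1 ∈ Inv n := by
  induction hp using Submodule.span_induction with
  | mem x hx =>
    obtain ⟨w, ⟨hw, rfl⟩ | ⟨hw, rfl⟩⟩ := hx
    · rw [← coe_prod_genInv n hn]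
      exact Subtype.prop _
    · exact zero_mem _
  | zero => exact zero_mem _
  | add x y _ _ h1 h2 => exact add_mem h1 h2
  | smul c x _ h => exact Subalgebra.smul_mem _ h c

lemma mem_symb_of_inv (hn : 1 ≤ n) {φ : MvPolynomial (Fin 2) ℂ →ₗ[ℂ] Quant P} {d : ℕ}
    (hφ : ∀ m, m.degree = d → (n : ℤ) ∣ m 1 - m 0 →
      (MvPolynomial.monomial m 1, φ (MvPolynomial.monomial m 1)) ∈ Symb n P d)
    {f : MvPolynomial (Fin 2) ℂ} (hf : f ∈ Inv n) (hd : f.IsHomogeneous d) :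
    (f, φ f) ∈ Symb n P d := by
  have h : (f, φ f) = ∑ m ∈ f.support, MvPolynomial.coeff m f •
      (MvPolynomial.monomial m (1 : ℂ), φ (MvPolynomial.monomial m 1)) := by
    have h1 : f = ∑ m ∈ f.support, MvPolynomial.coeff m f • MvPolynomial.monomial m (1 : ℂ) := by
      conv_lhs => rw [f.as_sum]
      simp [MvPolynomial.smul_monomial]
    refine Prod.ext ?_ ?_
    · rw [Prod.fst_sum]
      exact h1
    · rw [Prod.snd_sum]
      conv_lhs => rw [h1]
      simp [map_sum]
  rw [h]
  refine sum_mem fun m hm => Submodule.smul_mem _ _ (hφ m ?_ ?_)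
  · by_contra hc
    exact MvPolynomial.mem_support_iff.1 hm (hd.coeff_eq_zero hc)
  · exact (mem_inv_iff hn).1 hf m (MvPolynomial.mem_support_iff.1 hm)

lemma monomial_pbwElt_mem_symb (hn : 1 ≤ n) {m : Fin 2 →₀ ℕ} (h : (n : ℤ) ∣ m 1 - m 0) :
    (MvPolynomial.monomial m 1, pbwElt n P (m 0) (m 1)) ∈ Symb n P (m.degree : ℕ) := by
  obtain ⟨w, h1, h2, h3⟩ := exists_word_eq (P := P) hn h
  have h4 : m = Finsupp.single 0 (m 0) + Finsupp.single 1 (m 1) := by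
    ext i; fin_cases i <;> simp
  have h5 : m.degree = m 0 + m 1 := by
    rw [Finsupp.degree_eq_sum, Fin.sum_univ_two]
  have h6 : MvPolynomial.monomial m (1 : ℂ) = wordPoly n w := by
    rw [h2, X_pow_mul_X_pow, ← h4]
  rw [h5, ← h1, ← h3, h6]
  exact word_mem_symb w rfl

variable (n P) in
/-- The inverse of `pbwMap` on invariants. -/
def totalSymbol : Quant P →ₗ[ℂ] MvPolynomial (Fin 2) ℂ :=
  (Finsupp.lsum ℂ fun k : ℤ => LinearMap.mulRight ℂ
    (MvPolynomial.X 0 ^ (n * (-k).toNat) * MvPolynomial.X 1 ^ (n * k.toNat)) ∘ₗ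
    (aeval (MvPolynomial.X 0 * MvPolynomial.X 1 : MvPolynomial (Fin 2) ℂ)).toLinearMap) ∘ₗ
    (coeffs P).toLinearMap

lemma totalSymbol_pbwElt (hn : 1 ≤ n) {i j : ℕ} (h : (n : ℤ) ∣ j - i) :
    totalSymbol n P (pbwElt n P i j) = MvPolynomial.X 0 ^ i * MvPolynomial.X 1 ^ j := by
  obtain ⟨k, hk⟩ := h
  have hdiv : (j - i : ℤ) / n = k := by rw [hk, Int.mul_ediv_cancel_left _ (by omega)]
  rw [pbwElt, if_pos ⟨k, hk⟩, hdiv, totalSymbol, LinearMap.comp_apply, LinearEquiv.coe_coe,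
    coeffs_zev_mul_wt, Finsupp.lsum_single]
  simp only [LinearMap.comp_apply, AlgHom.toLinearMap_apply, map_pow, aeval_X,
    LinearMap.mulRight_apply]
  obtain ⟨m, rfl | rfl⟩ := k.eq_nat_or_neg
  · have : j = i + n * m := by zify; linarith
    subst this
    simp
    ring
  · have : i = j + n * m := by zify; linarith
    subst this
    simp
    ring

lemma totalSymbol_pbwMap (hn : 1 ≤ n) {f : MvPolynomial (Fin 2) ℂ} (hf : f ∈ Inv n) :
    totalSymbol n P (pbwMap n P f) = f := by
  conv_rhs => rw [f.as_sum]
  conv_lhs => rw [f.as_sum]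
  rw [map_sum, map_sum]
  refine Finset.sum_congr rfl fun m hm => ?_
  have h4 : m = Finsupp.single 0 (m 0) + Finsupp.single 1 (m 1) := by
    ext i; fin_cases i <;> simp
  rw [pbwMap_monomial, map_smul, totalSymbol_pbwElt hn
    ((mem_inv_iff hn).1 hf m (MvPolynomial.mem_support_iff.1 hm)), X_pow_mul_X_pow, ← h4,
    MvPolynomial.smul_monomial, smul_eq_mul, mul_one]

lemma wordPoly_mem_inv (hn : 1 ≤ n) (w : List Gen) : wordPoly n w ∈ Inv n := by
  rw [← coe_prod_genInv n hn]
  exact Subtype.prop _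

/-- By induction on d: modulo lower filtration a word equals the PBW element of its own symbol,
whose total symbol has the degree of the word. So the filtration by words contains nothing beyond
what the PBW basis predicts. -/
lemma homogeneousComponent_totalSymbol (hn : 1 ≤ n) (hP : P.Monic) (hPn : P.natDegree = n)
    {d e : ℕ} (hde : d ≤ e) {x : Quant P} (hx : x ∈ filtLT n P d) :
    MvPolynomial.homogeneousComponent e (totalSymbol n P x) = 0 := by
  induction d generalizing x with
  | zero =>
    rw [filtLT_zero, Submodule.mem_bot] at hx
    rw [hx, map_zero, map_zero]
  | succ d ih =>
    induction hx using Submodule.span_induction with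
    | mem x hx =>
      obtain ⟨w, hw, rfl⟩ := hx
      change MvPolynomial.homogeneousComponent e (totalSymbol n P (word P w)) = 0
      change wdeg n w < d + 1 at hw
      rw [← sub_add_cancel (word P w) (pbwMap n P (wordPoly n w)), map_add, map_add,
        ih (by omega) (filtLT_mono (by omega) (word_sub_pbwMap_mem hn hP hPn w)), zero_add,
        totalSymbol_pbwMap hn (wordPoly_mem_inv hn w),
        MvPolynomial.homogeneousComponent_of_mem (wordPoly_isHomogeneous w), if_neg (by omega)]
    | zero => rw [map_zero, map_zero]
    | add x y _ _ h1 h2 => rw [map_add, map_add, h1, h2, add_zero]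
    | smul c x _ h => rw [map_smul, map_smul, h, smul_zero]

/-- Symbols are unique. -/
lemma symb_unique (hn : 1 ≤ n) (hP : P.Monic) (hPn : P.natDegree = n) {d : ℕ}
    {f g : MvPolynomial (Fin 2) ℂ} {x : Quant P} (hf : (f, x) ∈ Symb n P d)
    (hg : (g, x) ∈ Symb n P d) : f = g := by
  have h := sub_mem hf hg
  rw [Prod.mk_sub_mk, sub_self] at h
  have h1 := sub_pbwMap_mem hn hP hPn h
  rw [zero_sub] at h1
  have h2 := homogeneousComponent_totalSymbol hn hP hPn le_rfl (neg_mem h1)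
  rw [neg_neg, totalSymbol_pbwMap hn (symb_fst_mem_inv hn h),
    MvPolynomial.homogeneousComponent_eq_self (symb_fst_isHomogeneous h)] at h2
  exact sub_eq_zero.1 h2

lemma zero_mem_symb_iff (hn : 1 ≤ n) (hP : P.Monic) (hPn : P.natDegree = n) {d : ℕ}
    {x : Quant P} : ((0 : MvPolynomial (Fin 2) ℂ), x) ∈ Symb n P d ↔ x ∈ filtLT n P d := by
  refine ⟨fun h => ?_, zero_mem_symb⟩
  have := sub_pbwMap_mem hn hP hPn h
  rwa [map_zero, sub_zero] at this

lemma symb_snd_mem {d : ℕ} {p : MvPolynomial (Fin 2) ℂ × Quant P} (hp : p ∈ Symb n P d) :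
    p.2 ∈ filtLT n P (d + 1) := by
  induction hp using Submodule.span_induction with
  | mem x hx =>
    obtain ⟨w, ⟨hw, rfl⟩ | ⟨hw, rfl⟩⟩ := hx <;> exact word_mem_filtLT (by omega)
  | zero => exact zero_mem _
  | add x y _ _ h1 h2 => exact add_mem h1 h2
  | smul c x _ h => exact Submodule.smul_mem _ c h

lemma exists_mem_symb {d : ℕ} {x : Quant P} (hx : x ∈ filtLT n P (d + 1)) :
    ∃ f, (f, x) ∈ Symb n P d := by
  induction hx using Submodule.span_induction with
  | mem x hx =>
    obtain ⟨w, hw, rfl⟩ := hx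
    change wdeg n w < d + 1 at hw
    rcases eq_or_lt_of_le (Nat.lt_succ_iff.1 hw) with h | h
    · exact ⟨_, word_mem_symb w (by rw [h])⟩
    · exact ⟨_, zero_word_mem_symb w (by exact_mod_cast h)⟩
  | zero => exact ⟨0, zero_mem _⟩
  | add x y _ _ h1 h2 =>
    obtain ⟨f, hf⟩ := h1
    obtain ⟨g, hg⟩ := h2
    exact ⟨_, add_mem hf hg⟩
  | smul c x _ h =>
    obtain ⟨f, hf⟩ := h
    exact ⟨_, Submodule.smul_mem _ c hf⟩

lemma one_mem_filtLT : (1 : Quant P) ∈ filtLT n P 1 :=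
  word_mem_filtLT (w := []) (by simp [wdeg])

lemma exists_mem_filtLT (x : Quant P) : ∃ d, x ∈ filtLT n P d := by
  induction x using Quant.induction with
  | hs c =>
    refine ⟨1, ?_⟩
    rw [Algebra.algebraMap_eq_smul_one]
    exact Submodule.smul_mem _ _ one_mem_filtLT
  | hg g =>
    have := word_mem_filtLT (P := P) (n := n) (w := [g]) (lt_add_one _)
    exact ⟨_, by simpa [word] using this⟩
  | hm a b h1 h2 =>
    obtain ⟨i, hi⟩ := h1
    obtain ⟨j, hj⟩ := h2
    exact ⟨i + j, mul_mem_filtLT (by omega) hi hj⟩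
  | ha a b h1 h2 =>
    obtain ⟨i, hi⟩ := h1
    obtain ⟨j, hj⟩ := h2
    exact ⟨max i j, add_mem (filtLT_mono (le_max_left _ _) hi)
      (filtLT_mono (le_max_right _ _) hj)⟩

/-- Every generator has degree at least 1, so only finitely many words have bounded degree. -/
lemma finiteDimensional_filtLT (hn : 1 ≤ n) (d : ℕ) : FiniteDimensional ℂ (filtLT n P d) := by
  have : Finite Gen := Finite.of_surjective (![Gen.u, Gen.v, Gen.z] : Fin 3 → Gen) fun g => by
    cases g
    exacts [⟨0, rfl⟩, ⟨1, rfl⟩, ⟨2, rfl⟩]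
  have hl : ∀ w : List Gen, w.length ≤ wdeg n w := by
    intro w
    induction w with
    | nil => simp
    | cons g t ih =>
      have h2 : wdeg n (g :: t) = g.degree n + wdeg n t := by simp [wdeg]
      have h3 : 1 ≤ g.degree n := by cases g <;> simp only [Gen.degree] <;> omega
      rw [h2, List.length_cons]
      omega
  refine FiniteDimensional.span_of_finite ℂ
    (((List.finite_length_lt Gen d).image (word P)).subset ?_)
  rintro x ⟨w, hw, rfl⟩
  exact ⟨w, (hl w).trans_lt hw, rfl⟩

end Symbols

/-! ### Symbols and the symmetries of `𝒜_P` -/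

section Symmetries

variable {n : ℕ} {P : Parameter n}

lemma sigma_word (w : List Gen) :
    (sigma P (word P.poly w)).unop = Complex.I ^ wdeg n w • word P.poly w.reverse := by
  induction w with
  | nil => simp [word, wdeg]
  | cons g t ih =>
    have h1 : word P.poly (g :: t) = gen P.poly g * word P.poly t := by simp [word]
    have h2 : wdeg n (g :: t) = g.degree n + wdeg n t := by simp [wdeg]
    have h3 : word P.poly [g] = gen P.poly g := by simp [word]
    have h4 : (sigma P (gen P.poly g)).unop = Complex.I ^ g.degree n • gen P.poly g := by
      rw [sigma_gen]
      cases g <;> simp [sigmaGen, Gen.degree]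
    rw [h1, sigma_mul, ih, h4, h2, List.reverse_cons, word_append, h3, smul_mul_smul_comm,
      ← pow_add, add_comm]

/-- On a word σ is reversal times a power of i, and reversal does not change the commutative symbol.
-/
lemma sigma_mem_symb {d : ℕ} {p : MvPolynomial (Fin 2) ℂ × Quant P.poly}
    (hp : p ∈ Symb n P.poly d) :
    (Complex.I ^ d • p.1, (sigma P p.2).unop) ∈ Symb n P.poly d := by
  have hr1 : ∀ w, wdeg n w.reverse = wdeg n w := fun w => by simp [wdeg]
  have hr2 : ∀ w, wordPoly n w.reverse = wordPoly n w := fun w => by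
    rw [wordPoly, wordPoly, List.map_reverse, List.prod_reverse]
  induction hp using Submodule.span_induction with
  | mem x hx =>
    obtain ⟨w, ⟨hw, rfl⟩ | ⟨hw, rfl⟩⟩ := hx <;> simp only [sigma_word]
    · obtain rfl := Nat.cast_inj.1 hw
      have := word_mem_symb (P := P.poly) w.reverse (d := wdeg n w) (by rw [hr1])
      rw [hr2] at this
      simpa using Submodule.smul_mem _ (Complex.I ^ wdeg n w) this
    · have := zero_word_mem_symb (P := P.poly) w.reverse (d := d) (by rwa [hr1])
      simpa using Submodule.smul_mem _ (Complex.I ^ wdeg n w) this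
  | zero =>
    simp only [Prod.fst_zero, Prod.snd_zero, map_zero, smul_zero, MulOpposite.unop_zero]
    exact zero_mem _
  | add x y _ _ h1 h2 => simpa using add_mem h1 h2
  | smul c x _ h => simpa [smul_comm c] using Submodule.smul_mem _ c h

/-- For the canonical sign λ = (-1)^n, so ρ sends u to v, v to (-1)^n u and z to -z, exactly as the
canonical conjugation does on p^n, q^n and pq. -/
lemma rho_word_mem_symb (w : List Gen) :
    (quatHom (wordPoly n w), rho P (canonicalSign n) (word P.poly w)) ∈
      Symb n P.poly (wdeg n w) := by
  have hc : conjConst n (canonicalSign n) = (-1) ^ n := by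
    rw [conjConst_eq, Int.units_mul_self]; simp
  induction w with
  | nil => simpa [word, wordPoly, rho_one] using word_mem_symb (P := P.poly) (n := n) [] rfl
  | cons g t ih =>
    have h1 : word P.poly (g :: t) = gen P.poly g * word P.poly t := by simp [word]
    have h2 : wordPoly n (g :: t) = genPoly n g * wordPoly n t := by simp [wordPoly]
    have h3 : wdeg n (g :: t) = g.degree n + wdeg n t := by simp [wdeg]
    have h4 : (quatHom (genPoly n g), rho P (canonicalSign n) (gen P.poly g)) ∈
        Symb n P.poly (g.degree n) := by
      rw [rho_gen]
      cases g with
      | u => simpa [conjGen, conjConst_inv, hc, ← mul_pow, genPoly, quatHom, Gen.degree] using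
          gen_mem_symb (P := P.poly) (n := n) Gen.v
      | v =>
        have := Submodule.smul_mem _ ((-1 : ℂ) ^ n)
          (gen_mem_symb (P := P.poly) (n := n) Gen.u)
        rw [Prod.smul_mk] at this
        have h5 : quatHom (genPoly n Gen.v) = (-1 : ℂ) ^ n • genPoly n Gen.u := by
          simp [genPoly, quatHom, neg_pow (MvPolynomial.X 0 : MvPolynomial (Fin 2) ℂ),
            MvPolynomial.smul_eq_C_mul]
        rw [h5, hc]
        exact this
      | z =>
        have := neg_mem (gen_mem_symb (P := P.poly) (n := n) Gen.z)
        convert this using 1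
        simp [conjGen, genPoly, quatHom, mul_comm]
    have h5 := symb_mul h4 ih
    rwa [Prod.mk_mul_mk, ← rho_mul, ← map_mul, ← h1, ← h2, ← Nat.cast_add, ← h3] at h5

lemma rho_mem_symb {d : ℕ} {p : MvPolynomial (Fin 2) ℂ × Quant P.poly}
    (hp : p ∈ Symb n P.poly d) :
    (quatHom p.1, rho P (canonicalSign n) p.2) ∈ Symb n P.poly d := by
  induction hp using Submodule.span_induction with
  | mem x hx =>
    obtain ⟨w, ⟨h, rfl⟩ | ⟨h, rfl⟩⟩ := hx
    · rw [← h]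
      exact rho_word_mem_symb w
    · simpa using symb_zero_of_lt h (rho_word_mem_symb w)
  | zero =>
    rw [Prod.fst_zero, Prod.snd_zero, map_zero, map_zero, ← Prod.zero_eq_mk]
    exact zero_mem _
  | add x y _ _ h1 h2 => simpa using add_mem h1 h2
  | smul c x _ h =>
    have := Submodule.smul_mem _ (starRingEnd ℂ c) h
    rwa [Prod.smul_mk, ← map_smulₛₗ (rho P (canonicalSign n)), MvPolynomial.smul_eq_C_mul,
      ← quatHom_C, ← map_mul, ← MvPolynomial.smul_eq_C_mul] at this

variable (hn : 1 ≤ n)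
include hn

lemma sigma_mem_filtLT {d : ℕ} {x : Quant P.poly} (hx : x ∈ filtLT n P.poly d) :
    (sigma P x).unop ∈ filtLT n P.poly d := by
  have := sigma_mem_symb (zero_mem_symb hx)
  rw [smul_zero] at this
  exact (zero_mem_symb_iff hn P.monic P.natDegree_eq).1 this

lemma sAut_mem_filtLT {d : ℕ} {x : Quant P.poly} (hx : x ∈ filtLT n P.poly d) :
    sAut P x ∈ filtLT n P.poly d := by
  rw [← sAut_eq_sigma_sigma]
  exact sigma_mem_filtLT hn (sigma_mem_filtLT hn hx)

lemma rho_mem_filtLT {d : ℕ} {x : Quant P.poly} (hx : x ∈ filtLT n P.poly d) :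
    rho P (canonicalSign n) x ∈ filtLT n P.poly d := by
  have := rho_mem_symb (zero_mem_symb hx)
  rw [map_zero] at this
  exact (zero_mem_symb_iff hn P.monic P.natDegree_eq).1 this

end Symmetries

end Kleinian

end

noncomputable section

namespace Kleinian

open Polynomial

/-! ### Quantization maps -/

section QuantizationMap

variable {n : ℕ} {P : Parameter n}

/-- The linear maps `φ : A → 𝒜_P` with `gr φ = id`. -/
def IsSymbolic (φ : Inv n →ₗ[ℂ] Quant P.poly) : Prop :=
  ∀ (d : ℕ) (a : Inv n), a.1.IsHomogeneous d → (a.1, φ a) ∈ Symb n P.poly d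

namespace IsSymbolic

variable {φ : Inv n →ₗ[ℂ] Quant P.poly} (hφ : IsSymbolic φ) (hn : 1 ≤ n)
include hφ hn

lemma invComp_mem_symb {c : Inv n} {N : ℕ} (h : ∀ e, N < e → invComp hn e c = 0) :
    ((invComp hn N c).1, φ c) ∈ Symb n P.poly N := by
  have h1 : φ c = ∑ e ∈ Finset.range N, φ (invComp hn e c) + φ (invComp hn N c) := by
    conv_lhs => rw [← sum_invComp hn (N := N + 1) h]
    rw [map_sum, Finset.sum_range_succ]
  have h2 : (0, ∑ e ∈ Finset.range N, φ (invComp hn e c)) ∈ Symb n P.poly N := by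
    rw [zero_mem_symb_iff hn P.monic P.natDegree_eq]
    refine sum_mem fun e he => ?_
    rw [← zero_mem_symb_iff hn P.monic P.natDegree_eq]
    exact symb_zero_of_lt (by exact_mod_cast Finset.mem_range.1 he)
      (hφ e _ (invComp_isHomogeneous hn e c))
  have h3 := add_mem h2 (hφ N _ (invComp_isHomogeneous hn N c))
  rwa [Prod.mk_add_mk, zero_add, ← h1] at h3

/-- The highest component of c is a symbol of φ(c), but above degree d the only symbol is 0. The
induction descends from a degree beyond which c has no components. -/
lemma invComp_eq_zero {c : Inv n} {d : ℕ} {f : MvPolynomial (Fin 2) ℂ}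
    (h : (f, φ c) ∈ Symb n P.poly d) {e : ℕ} (he : d < e) : invComp hn e c = 0 := by
  obtain ⟨N, hN⟩ := exists_invComp_eq_zero hn c
  have key : ∀ k e, d < e → N ≤ e + k → invComp hn e c = 0 := by
    intro k
    induction k with
    | zero => exact fun e _ h => hN e h
    | succ k ih =>
      intro e he hk
      have h1 := hφ.invComp_mem_symb hn (N := e) fun e' he' => ih e' (by omega) (by omega)
      exact Subtype.ext (symb_unique hn P.monic P.natDegree_eq h1
        (symb_zero_of_lt (by exact_mod_cast he) h))
  exact key N e he (by omega)

lemma invComp_eq {c : Inv n} {d : ℕ} {f : MvPolynomial (Fin 2) ℂ}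
    (h : (f, φ c) ∈ Symb n P.poly d) : (invComp hn d c).1 = f :=
  symb_unique hn P.monic P.natDegree_eq
    (hφ.invComp_mem_symb hn fun _ he => hφ.invComp_eq_zero hn h he) h

lemma eq_zero_of_mem_filtLT {c : Inv n} {d : ℕ} (h : φ c ∈ filtLT n P.poly d) {e : ℕ}
    (he : d ≤ e) : invComp hn e c = 0 := by
  have h1 := zero_mem_symb h
  rcases eq_or_lt_of_le he with rfl | he
  · exact Subtype.ext (hφ.invComp_eq hn h1)
  · exact hφ.invComp_eq_zero hn h1 he

/-- A filtered map that is the identity on symbols: injective because the symbols of 0 vanish,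
surjective by removing the leading symbol repeatedly. -/
lemma bijective : Function.Bijective φ := by
  constructor
  · rw [injective_iff_map_eq_zero]
    intro c hc
    have h : φ c ∈ filtLT n P.poly 0 := by rw [hc]; exact zero_mem _
    rw [← sum_invComp hn (f := c) (N := 0) fun e he => hφ.eq_zero_of_mem_filtLT hn h he]
    simp
  · intro x
    obtain ⟨d, hd⟩ := exists_mem_filtLT (n := n) x
    induction d generalizing x with
    | zero =>
      rw [filtLT_zero, Submodule.mem_bot] at hd
      exact ⟨0, by rw [map_zero, hd]⟩
    | succ d ih =>
      obtain ⟨f, hf⟩ := exists_mem_symb hd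
      have hfi := symb_fst_mem_inv hn hf
      obtain ⟨a, rfl⟩ : ∃ a : Inv n, a.1 = f := ⟨⟨f, hfi⟩, rfl⟩
      have h1 := sub_mem hf (hφ d a (symb_fst_isHomogeneous hf))
      rw [Prod.mk_sub_mk, sub_self, zero_mem_symb_iff hn P.monic P.natDegree_eq] at h1
      obtain ⟨c, hc⟩ := ih _ h1
      exact ⟨c + a, by rw [map_add, hc, sub_add_cancel]⟩

lemma map_one : φ 1 = 1 := by
  have h1 := sub_mem (hφ 0 1 (MvPolynomial.isHomogeneous_one _ _))
    (word_mem_symb (P := P.poly) (n := n) [] rfl)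
  have h2 : ((1 : Inv n).1, φ 1) - (wordPoly n [], word P.poly []) = (0, φ 1 - 1) := by
    simp [wordPoly, word]
  rw [h2, Nat.cast_zero, ← Nat.cast_zero, zero_mem_symb_iff hn P.monic P.natDegree_eq] at h1
  change φ 1 - 1 ∈ filtLT n P.poly 0 at h1
  rw [filtLT_zero, Submodule.mem_bot] at h1
  exact sub_eq_zero.1 h1

lemma sub_word_mem (w : List Gen) :
    φ (w.map (genInv n hn)).prod - word P.poly w ∈ filtLT n P.poly (wdeg n w) := by
  have h1 := coe_prod_genInv n hn w
  have h2 := sub_mem (hφ (wdeg n w) (w.map (genInv n hn)).prod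
    (by rw [h1]; exact wordPoly_isHomogeneous w)) (word_mem_symb (P := P.poly) w rfl)
  rwa [h1, Prod.mk_sub_mk, sub_self, zero_mem_symb_iff hn P.monic P.natDegree_eq] at h2

end IsSymbolic

lemma isSymbolic_of_sub_word_mem (hn : 1 ≤ n) {φ : Inv n →ₗ[ℂ] Quant P.poly}
    (h : ∀ w : List Gen, φ (w.map (genInv n hn)).prod - word P.poly w ∈
      filtLT n P.poly (wdeg n w)) : IsSymbolic φ := by
  intro d a ha
  -- An arbitrary extension to ℂ[p,q] allows an invariant to be decomposed into monomials there.
  obtain ⟨φ', hφ'⟩ := LinearMap.exists_extend (p := Subalgebra.toSubmodule (Inv n)) φ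
  have h1 : ∀ a : Inv n, φ a = φ' a.1 := fun a => by rw [← hφ']; rfl
  rw [h1]
  refine mem_symb_of_inv hn (fun m hm hdvd => ?_) a.2 ha
  obtain ⟨w, hw1, hw2, -⟩ := exists_word_eq (P := P.poly) hn hdvd
  have h4 : m = Finsupp.single 0 (m 0) + Finsupp.single 1 (m 1) := by
    ext i; fin_cases i <;> simp
  have h5 : m.degree = m 0 + m 1 := by
    rw [Finsupp.degree_eq_sum, Fin.sum_univ_two]
  have h6 : MvPolynomial.monomial m (1 : ℂ) = wordPoly n w := by
    rw [hw2, X_pow_mul_X_pow, ← h4]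
  have h7 := add_mem (zero_mem_symb (h w)) (word_mem_symb (P := P.poly) w rfl)
  rw [Prod.mk_add_mk, zero_add, sub_add_cancel, h1, coe_prod_genInv] at h7
  rwa [h6, ← hm, h5, ← hw1]

end QuantizationMap

/-! ### The quantization map of a positive trace -/

section Orthogonal

variable {n : ℕ} {P : Parameter n} {T : Quant P.poly →ₗ[ℂ] ℂ}

/-- The quantization maps under which the homogeneous components of `A` are orthogonal with respect
to `T`. -/
def IsOrthogonal (T : Quant P.poly →ₗ[ℂ] ℂ) (φ : Inv n →ₗ[ℂ] Quant P.poly) : Prop :=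
  IsSymbolic φ ∧ ∀ (d : ℕ) (a : Inv n), a.1.IsHomogeneous d → ∀ v ∈ filtLT n P.poly d,
    T (φ a * v) = 0

lemma trace_rho {ε : ℤˣ} (hT : T ∈ positiveEvenTraces P ε) (a : Quant P.poly) :
    T (rho P ε a) = starRingEnd ℂ (T a) := by
  have := hT.2.2.1 a 1
  rwa [one_mul, rho_one, mul_one] at this

variable (hn : 1 ≤ n) (hT : T ∈ positiveEvenTraces P (canonicalSign n))
include hn hT

/-- The filtration is stable under ρ, so ρ(x) is an admissible test vector and definiteness applies.
-/
lemma eq_zero_of_trace_eq_zero {d : ℕ} {x : Quant P.poly} (hx : x ∈ filtLT n P.poly d)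
    (h : ∀ v ∈ filtLT n P.poly d, T (x * v) = 0) : x = 0 := by
  by_contra hx0
  have h1 := hT.2.2.2 x hx0
  rw [h _ (rho_mem_filtLT hn hx)] at h1
  exact lt_irrefl _ h1

/-- The pairing is nondegenerate on the finite-dimensional F_{<d}, so some y in it represents the
functional v ↦ T(xv). -/
lemma exists_sub_orthogonal (d : ℕ) (x : Quant P.poly) : ∃ y ∈ filtLT n P.poly d,
    ∀ v ∈ filtLT n P.poly d, T ((x - y) * v) = 0 := by
  have := finiteDimensional_filtLT (P := P.poly) hn d
  set B : Quant P.poly →ₗ[ℂ] Module.Dual ℂ (filtLT n P.poly d) :=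
    ((LinearMap.mul ℂ (Quant P.poly)).compr₂ T).compl₂ (filtLT n P.poly d).subtype with hB
  have hinj : Function.Injective (B ∘ₗ (filtLT n P.poly d).subtype) := by
    rw [injective_iff_map_eq_zero]
    intro y hy
    exact Subtype.ext (eq_zero_of_trace_eq_zero hn hT y.2 fun v hv =>
      LinearMap.congr_fun hy ⟨v, hv⟩)
  obtain ⟨y, hy⟩ := (LinearMap.injective_iff_surjective_of_finrank_eq_finrank
    (Subspace.dual_finrank_eq (K := ℂ)).symm).1 hinj (B x)
  refine ⟨y.1, y.2, fun v hv => ?_⟩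
  have h1 := LinearMap.congr_fun hy ⟨v, hv⟩
  change T (y.1 * v) = T (x * v) at h1
  rw [sub_mul, map_sub, h1, sub_self]

/-- With equal symbols the difference lies in F_{<d}, and it is also orthogonal to F_{<d}. Every
compatibility of φ below comes from this uniqueness. -/
lemma orthogonal_unique {d : ℕ} {f : MvPolynomial (Fin 2) ℂ} {x y : Quant P.poly}
    (hx : (f, x) ∈ Symb n P.poly d) (hy : (f, y) ∈ Symb n P.poly d)
    (hx' : ∀ v ∈ filtLT n P.poly d, T (x * v) = 0)
    (hy' : ∀ v ∈ filtLT n P.poly d, T (y * v) = 0) : x = y := by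
  have h := sub_mem hx hy
  rw [Prod.mk_sub_mk, sub_self, zero_mem_symb_iff hn P.monic P.natDegree_eq] at h
  refine sub_eq_zero.1 (eq_zero_of_trace_eq_zero hn hT h fun v hv => ?_)
  rw [sub_mul, map_sub, hx' v hv, hy' v hv, sub_zero]

/-- Gram-Schmidt: each PBW element is corrected by its projection to lower filtration, which leaves
its symbol unchanged. -/
lemma exists_isOrthogonal : ∃ φ : Inv n →ₗ[ℂ] Quant P.poly, IsOrthogonal T φ := by
  choose proj hproj horth using exists_sub_orthogonal hn hT
  set φ' : MvPolynomial (Fin 2) ℂ →ₗ[ℂ] Quant P.poly :=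
    (MvPolynomial.basisMonomials (Fin 2) ℂ).constr ℂ fun m =>
      pbwElt n P.poly (m 0) (m 1) - proj m.degree (pbwElt n P.poly (m 0) (m 1)) with hφ'
  have hmon : ∀ m, φ' (MvPolynomial.monomial m 1) =
      pbwElt n P.poly (m 0) (m 1) - proj m.degree (pbwElt n P.poly (m 0) (m 1)) := by
    intro m
    have := (MvPolynomial.basisMonomials (Fin 2) ℂ).constr_basis ℂ (fun m =>
      pbwElt n P.poly (m 0) (m 1) - proj m.degree (pbwElt n P.poly (m 0) (m 1))) m
    rwa [MvPolynomial.coe_basisMonomials] at this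
  refine ⟨φ' ∘ₗ (Subalgebra.toSubmodule (Inv n)).subtype, fun d a ha => ?_,
    fun d a ha v hv => ?_⟩
  · refine mem_symb_of_inv hn (φ := φ') (fun m hm hdvd => ?_) a.2 ha
    have h1 := sub_mem (monomial_pbwElt_mem_symb (P := P.poly) hn hdvd)
      (zero_mem_symb (hproj m.degree (pbwElt n P.poly (m 0) (m 1))))
    rwa [Prod.mk_sub_mk, sub_zero, ← hmon, hm] at h1
  · change T (φ' a.1 * v) = 0
    rw [a.1.as_sum, map_sum, Finset.sum_mul, map_sum]
    refine Finset.sum_eq_zero fun m hm => ?_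
    have h1 : MvPolynomial.monomial m (MvPolynomial.coeff m a.1) =
        MvPolynomial.coeff m a.1 • MvPolynomial.monomial m (1 : ℂ) := by
      simp [MvPolynomial.smul_monomial]
    have h2 : m.degree = d := by
      by_contra hc
      exact MvPolynomial.mem_support_iff.1 hm (ha.coeff_eq_zero hc)
    rw [h1, map_smul, smul_mul_assoc, map_smul, hmon, h2, horth d _ v hv, smul_zero]

variable {φ : Inv n →ₗ[ℂ] Quant P.poly} (hφ : IsOrthogonal T φ)
include hφ

lemma orthogonal_map_unique {φ' : Inv n →ₗ[ℂ] Quant P.poly} (hφ' : IsOrthogonal T φ') :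
    φ = φ' := by
  ext a
  induction a using inv_induction hn with
  | h0 => rw [map_zero, map_zero]
  | ha f g hf hg => rw [map_add, map_add, hf, hg]
  | hh d a ha =>
    exact orthogonal_unique hn hT (hφ.1 d a ha) (hφ'.1 d a ha) (hφ.2 d a ha) (hφ'.2 d a ha)

lemma orthogonal_left {d : ℕ} {a : Inv n} (ha : a.1.IsHomogeneous d) {v : Quant P.poly}
    (hv : v ∈ filtLT n P.poly d) : T (v * φ a) = 0 := by
  rw [hT.1]
  exact hφ.2 d a ha _ (sAut_mem_filtLT hn hv)

lemma sigma_orthogonal {d : ℕ} {a : Inv n} (ha : a.1.IsHomogeneous d) :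
    (sigma P (φ a)).unop = Complex.I ^ d • φ a := by
  refine orthogonal_unique hn hT (sigma_mem_symb (hφ.1 d a ha))
    (Submodule.smul_mem _ (Complex.I ^ d) (hφ.1 d a ha)) (fun v hv => ?_) fun v hv => ?_
  -- Writing v as a value of σ turns σ(φ a) v into σ of a reversed product, where the σ-invariance
  -- of T applies.
  · have h1 : v = (sigma P (sigma P (sAut P v)).unop).unop := by
      rw [sAut_eq_sigma_sigma, sAut_sAut]
    rw [h1, ← sigma_mul, hT.2.1]
    exact orthogonal_left hn hT hφ ha (sigma_mem_filtLT hn (sAut_mem_filtLT hn hv))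
  · rw [smul_mul_assoc, map_smul, hφ.2 d a ha v hv, smul_zero]

lemma rho_orthogonal (a : Inv n) : rho P (canonicalSign n) (φ a) = φ (quat n a) := by
  have hadd : ∀ f g, quat n (f + g) = quat n f + quat n g := fun f g =>
    Subtype.ext (map_add quatHom f.1 g.1)
  induction a using inv_induction hn with
  | h0 =>
    have h0 : quat n 0 = 0 := Subtype.ext (map_zero quatHom)
    rw [h0, map_zero, map_zero]
  | ha f g hf hg => rw [hadd, map_add, map_add, map_add, hf, hg]
  | hh d a ha =>
    have hq : (quat n a).1.IsHomogeneous d := quatHom_isHomogeneous ha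
    refine orthogonal_unique hn hT (rho_mem_symb (hφ.1 d a ha)) (hφ.1 d _ hq) (fun v hv => ?_)
      (hφ.2 d _ hq)
    -- Likewise v is written as a value of ρ, so that the trace becomes a conjugate of one that
    -- vanishes by orthogonality.
    have h1 : v = rho P (canonicalSign n) (rho P (canonicalSign n) (sAut P v)) := by
      rw [rho_rho, sAut_sAut]
    rw [h1, ← rho_mul, trace_rho hT,
      hφ.2 d a ha _ (rho_mem_filtLT hn (sAut_mem_filtLT hn hv)), map_zero]

lemma trace_mul_eq_zero {i j : ℕ} (hij : i ≠ j) {a b : Inv n} (ha : a.1.IsHomogeneous i)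
    (hb : b.1.IsHomogeneous j) : T (φ a * φ b) = 0 := by
  rcases lt_or_gt_of_ne hij with h | h
  · exact orthogonal_left hn hT hφ hb (filtLT_mono h (symb_snd_mem (hφ.1 i a ha)))
  · exact hφ.2 i a ha _ (filtLT_mono h (symb_snd_mem (hφ.1 j b hb)))

lemma trace_mul_homogeneous {d : ℕ} (c : Inv n) {b : Inv n} (hb : b.1.IsHomogeneous d) :
    T (φ c * φ b) = T (φ (invComp hn d c) * φ b) := by
  induction c using inv_induction hn with
  | h0 => rw [map_zero (invComp hn d)]
  | ha f g hf hg => simp only [map_add, add_mul, hf, hg]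
  | hh e a ha =>
    by_cases hed : e = d
    · rw [← hed, invComp_self hn ha]
    · rw [invComp_of_ne hn (Ne.symm hed) ha, trace_mul_eq_zero hn hT hφ hed ha hb, map_zero,
        zero_mul, map_zero]

omit hT in
-- Homogeneous elements of positive degree are orthogonal to 1, so T sees only the constant term.
lemma trace_orthogonal (h1 : T 1 = 1) (a : Inv n) :
    T (φ a) = MvPolynomial.constantCoeff a.1 := by
  induction a using inv_induction hn with
  | h0 => simp
  | ha f g hf hg => rw [map_add, map_add, hf, hg, Subalgebra.coe_add, map_add]
  | hh d a ha =>
    rcases Nat.eq_zero_or_pos d with rfl | hd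
    · have h2 : a = MvPolynomial.constantCoeff a.1 • (1 : Inv n) := by
        refine Subtype.ext ?_
        have h3 := MvPolynomial.homogeneousComponent_eq_self ha
        rw [MvPolynomial.homogeneousComponent_zero] at h3
        rw [Subalgebra.coe_smul, MvPolynomial.smul_eq_C_mul]
        simpa [MvPolynomial.constantCoeff_eq] using h3.symm
      rw [h2, map_smul, map_smul, hφ.1.map_one hn, h1, Subalgebra.coe_smul,
        MvPolynomial.smul_eq_C_mul]
      simp
    · have h2 := hφ.2 d a ha 1 (filtLT_mono hd one_mem_filtLT)
      rw [mul_one] at h2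
      rw [h2, MvPolynomial.constantCoeff_eq, ha.coeff_eq_zero (by simpa using hd.ne)]

end Orthogonal

end Kleinian

end

noncomputable section

namespace Kleinian

open Polynomial

/-! ### Star-products and positive traces -/

section StarProducts

variable {n : ℕ} {P : Parameter n}

/-- The quantization maps of a star-product, as in the definition of `StarProduct.Quantizes`. -/
def IsQuantizationMap (hn : 1 ≤ n) (S : StarProduct n) (φ : Inv n ≃ₗ[ℂ] Quant P.poly) : Prop :=
  (∀ w : List Gen, φ (w.map (genInv n hn)).prod - (w.map (gen P.poly)).prod ∈
    filtLT n P.poly (w.map (Gen.degree n)).sum) ∧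
  (∀ a b, φ (S.mul a b) = φ a * φ b) ∧
  (∀ (d : ℕ) (a : Inv n), a.1.IsHomogeneous d →
    (sigma P (φ a)).unop = Complex.I ^ d • φ a) ∧
  (∀ a, rho P (canonicalSign n) (φ a) = φ (quat n a))

/-- The constant term as a functional on `𝒜_P`. -/
def constantTerm (φ : Inv n ≃ₗ[ℂ] Quant P.poly) : Quant P.poly →ₗ[ℂ] ℂ :=
  (MvPolynomial.lcoeff ℂ 0 ∘ₗ (Subalgebra.toSubmodule (Inv n)).subtype) ∘ₗ φ.symm.toLinearMap

lemma constantTerm_apply (φ : Inv n ≃ₗ[ℂ] Quant P.poly) (a : Inv n) :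
    constantTerm φ (φ a) = MvPolynomial.constantCoeff a.1 := by
  rw [constantTerm, LinearMap.comp_apply, LinearEquiv.coe_coe, LinearEquiv.symm_apply_apply]
  rfl

lemma IsQuantizationMap.isSymbolic {hn : 1 ≤ n} {S : StarProduct n}
    {φ : Inv n ≃ₗ[ℂ] Quant P.poly} (hφ : IsQuantizationMap hn S φ) :
    IsSymbolic φ.toLinearMap := isSymbolic_of_sub_word_mem hn hφ.1

/-- The transport of the product of `𝒜_P` to `A`. -/
def transportMul (φ : Inv n ≃ₗ[ℂ] Quant P.poly) : Inv n →ₗ[ℂ] Inv n →ₗ[ℂ] Inv n :=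
  ((LinearMap.mul ℂ (Quant P.poly)).compl₁₂ φ.toLinearMap φ.toLinearMap).compr₂
    φ.symm.toLinearMap

lemma map_transportMul (φ : Inv n ≃ₗ[ℂ] Quant P.poly) (a b : Inv n) :
    φ (transportMul φ a b) = φ a * φ b := by
  change φ (φ.symm (φ a * φ b)) = φ a * φ b
  rw [LinearEquiv.apply_symm_apply]

lemma neg_one_pow_cancel {d m : ℕ} (hd : d ≤ m) (h : (-1 : ℂ) ^ d = (-1) ^ m) :
    ∃ k, d + 2 * k = m := by
  have h1 : (-1 : ℂ) ^ (m - d) = 1 := by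
    have h2 : (-1 : ℂ) ^ d * (-1) ^ (m - d) = (-1) ^ d * 1 := by
      rw [← pow_add, Nat.add_sub_cancel' hd, h, mul_one]
    exact mul_left_cancel₀ (pow_ne_zero _ (by norm_num)) h2
  obtain ⟨k, hk⟩ := (neg_one_pow_eq_one_iff_even (by norm_num)).1 h1
  exact ⟨k, by omega⟩

/-! ### From a positive trace to a star-product -/

section Existence

variable (hn : 1 ≤ n) {T : Quant P.poly →ₗ[ℂ] ℂ}
  (hT : T ∈ positiveEvenTraces P (canonicalSign n)) {φ : Inv n ≃ₗ[ℂ] Quant P.poly}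
  (hφ : IsOrthogonal T φ.toLinearMap)
include hT hφ

lemma invComp_sigma (d : ℕ) {c c' : Inv n} (h : φ c' = (sigma P (φ c)).unop) :
    invComp hn d c' = Complex.I ^ d • invComp hn d c := by
  induction c using inv_induction hn generalizing c' with
  | h0 =>
    rw [map_zero, map_zero, MulOpposite.unop_zero, map_eq_zero_iff φ φ.injective] at h
    rw [h, map_zero, smul_zero]
  | ha f g hf hg =>
    rw [map_add, map_add, MulOpposite.unop_add] at h
    have h1 := hf (φ.apply_symm_apply _)
    have h2 := hg (φ.apply_symm_apply _)
    have h3 : c' = φ.symm (sigma P (φ f)).unop + φ.symm (sigma P (φ g)).unop := by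
      rw [← map_add, ← h, φ.symm_apply_apply]
    rw [h3, map_add, h1, h2, map_add, smul_add]
  | hh e a ha =>
    have h1 := sigma_orthogonal hn hT hφ ha
    change (sigma P (φ a)).unop = Complex.I ^ e • φ a at h1
    rw [h1, ← map_smul, φ.injective.eq_iff] at h
    rw [h, map_smul]
    by_cases hed : d = e
    · rw [hed]
    · rw [invComp_of_ne hn hed ha, smul_zero, smul_zero]

/-- The antiautomorphism σ reverses φ(b)φ(a) and acts by i^d on degree d. For d = i + j - 2k the
ratio of the two powers of the imaginary unit is (-1)^k, which is evenness. -/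
lemma invComp_mul_swap {i j : ℕ} {a b : Inv n} (ha : a.1.IsHomogeneous i)
    (hb : b.1.IsHomogeneous j) (d : ℕ) :
    Complex.I ^ d • invComp hn d (transportMul φ a b) =
      Complex.I ^ (i + j) • invComp hn d (transportMul φ b a) := by
  rw [← map_smul (invComp hn d) (Complex.I ^ (i + j))]
  refine (invComp_sigma hn hT hφ d ?_).symm
  have h1 := sigma_orthogonal hn hT hφ ha
  have h2 := sigma_orthogonal hn hT hφ hb
  change (sigma P (φ a)).unop = _ • φ a at h1
  change (sigma P (φ b)).unop = _ • φ b at h2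
  rw [map_smul, map_transportMul, map_transportMul, sigma_mul, h1, h2, smul_mul_smul_comm,
    ← pow_add, add_comm]

omit hT in
lemma transportMul_mem_symb {i j : ℕ} {a b : Inv n} (ha : a.1.IsHomogeneous i)
    (hb : b.1.IsHomogeneous j) :
    (a.1 * b.1, φ (transportMul φ a b)) ∈ Symb n P.poly ((i + j : ℕ) : ℤ) := by
  have h := symb_mul (hφ.1 i a ha) (hφ.1 j b hb)
  rw [Prod.mk_mul_mk] at h
  rw [map_transportMul, Nat.cast_add]
  exact h

/-- Swapping the factors twice multiplies a nonzero component by (-1)^d and by (-1)^(i+j) alike, so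
d and i + j have the same parity. -/
lemma exists_degree_eq {i j : ℕ} {a b : Inv n} (ha : a.1.IsHomogeneous i)
    (hb : b.1.IsHomogeneous j) {d : ℕ} (hd : invComp hn d (transportMul φ a b) ≠ 0) :
    ∃ k, d + 2 * k = i + j := by
  have hle : d ≤ i + j := by
    by_contra hc
    exact hd (hφ.1.invComp_eq_zero hn (transportMul_mem_symb hφ ha hb) (not_le.1 hc))
  refine neg_one_pow_cancel hle ?_
  have h1 := invComp_mul_swap hn hT hφ ha hb d
  have h2 := invComp_mul_swap hn hT hφ hb ha d
  have h3 := congrArg (fun x => Complex.I ^ d • x) h1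
  rw [smul_comm _ (Complex.I ^ (i + j)), h2, smul_smul, smul_smul, add_comm j i, ← mul_pow,
    ← mul_pow, Complex.I_mul_I] at h3
  exact smul_left_injective ℂ hd h3

/-- Let c be the component in question. By orthogonality T(φ(c) ρ(φ(c))) = T(φ(a) φ(b) φ(ρ(c))).
Here k > min(i,j) means d + min(i,j) < max(i,j), so the factor of larger degree is paired with
something of lower filtration and the value is 0; definiteness gives c = 0. -/
lemma invComp_eq_zero_of_min_lt {i j : ℕ} {a b : Inv n} (ha : a.1.IsHomogeneous i)
    (hb : b.1.IsHomogeneous j) {k d : ℕ} (hd : d + 2 * k = i + j) (hk : min i j < k) :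
    invComp hn d (transportMul φ a b) = 0 := by
  set c := invComp hn d (transportMul φ a b) with hc
  have hcd : c.1.IsHomogeneous d := invComp_isHomogeneous hn d _
  have hq : (quat n c).1.IsHomogeneous d := quatHom_isHomogeneous hcd
  have hrho := rho_orthogonal hn hT hφ c
  have hFq := symb_snd_mem (hφ.1 d _ hq)
  have hFa := symb_snd_mem (hφ.1 i _ ha)
  have hFb := symb_snd_mem (hφ.1 j _ hb)
  have h0 : T (φ c * rho P (canonicalSign n) (φ c)) = 0 := by
    have h1 := trace_mul_homogeneous hn hT hφ (transportMul φ a b) hq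
    change T (φ (transportMul φ a b) * φ (quat n c)) = T (φ c * φ (quat n c)) at h1
    change rho P (canonicalSign n) (φ c) = φ (quat n c) at hrho
    rw [hrho, ← h1, map_transportMul, mul_assoc]
    -- If j is the larger degree, φ(a) is first moved to the right by the trace property, so that
    -- φ(b) comes first.
    rcases le_or_gt i j with hij | hij
    · rw [hT.1, mul_assoc]
      refine hφ.2 j b hb _ (mul_mem_filtLT ?_ hFq (sAut_mem_filtLT hn hFa))
      rw [min_eq_left hij] at hk
      omega
    · refine hφ.2 i a ha _ (mul_mem_filtLT ?_ hFb hFq)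
      rw [min_eq_right hij.le] at hk
      omega
  by_contra hne
  have h1 := hT.2.2.2 (φ c) fun h => hne ((map_eq_zero_iff φ φ.injective).1 h)
  rw [h0] at h1
  exact lt_irrefl _ h1

end Existence

/-- A normalized positive trace defines a unitary even short star-product. -/
theorem exists_starProduct (hn : 1 ≤ n) {T : Quant P.poly →ₗ[ℂ] ℂ}
    (hT : T ∈ positiveEvenTraces P (canonicalSign n)) (h1 : T 1 = 1) :
    ∃ (S : StarProduct n) (φ : Inv n ≃ₗ[ℂ] Quant P.poly), S.IsUnitaryEvenShort hn P ∧
      IsQuantizationMap hn S φ ∧ constantTerm φ = T := by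
  obtain ⟨φ₀, hφ₀⟩ := exists_isOrthogonal hn hT
  set φ := LinearEquiv.ofBijective φ₀ (hφ₀.1.bijective hn) with hφdef
  have hφ : IsOrthogonal T φ.toLinearMap := hφ₀
  have htr : ∀ a, T (φ a) = MvPolynomial.constantCoeff a.1 := trace_orthogonal hn hφ h1
  have hrho : ∀ a, rho P (canonicalSign n) (φ a) = φ (quat n a) := rho_orthogonal hn hT hφ
  let S : StarProduct n :=
    { mul := transportMul φ
      assoc := fun a b c => φ.injective (by simp only [map_transportMul, mul_assoc])
      degree := fun i j a b ha hb d hd => exists_degree_eq hn hT hφ ha hb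
        fun h => hd (congrArg Subtype.val h)
      leading := fun i j a b ha hb => hφ.1.invComp_eq hn (transportMul_mem_symb hφ ha hb)
      poisson := fun i j a b ha hb d hd => by
        have h2 := pairBracket_mem hn P.monic P.natDegree_eq (hφ.1 i a ha) (hφ.1 j b hb)
        have h3 : (i + j - 2 : ℤ) = (d : ℕ) := by omega
        have h4 : φ (transportMul φ a b - transportMul φ b a) = φ a * φ b - φ b * φ a := by
          rw [map_sub, map_transportMul, map_transportMul]
        rw [h3] at h2
        change (bracket n a.1 b.1, φ a * φ b - φ b * φ a) ∈ _ at h2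
        rw [← h4] at h2
        have h5 := hφ.1.invComp_eq hn h2
        rwa [map_sub] at h5 }
  have hS : IsQuantizationMap hn S φ := ⟨hφ.1.sub_word_mem hn, map_transportMul φ,
    fun d a ha => sigma_orthogonal hn hT hφ ha, hrho⟩
  refine ⟨S, φ, ⟨⟨φ, hS⟩, ?_, ?_, ?_, ?_, ?_⟩, hS, ?_⟩
  · intro i j a b ha hb k d hd hk
    exact congrArg Subtype.val (invComp_eq_zero_of_min_lt hn hT hφ ha hb hd hk)
  · intro i j a b ha hb k d hd
    have h2 := invComp_mul_swap hn hT hφ ha hb d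
    rw [← hd, pow_add, pow_mul, Complex.I_sq, mul_smul] at h2
    have h3 := smul_right_injective _ (pow_ne_zero d Complex.I_ne_zero) h2
    have h4 := congrArg Subtype.val h3
    rw [Subalgebra.coe_smul, coe_invComp, coe_invComp, MvPolynomial.smul_eq_C_mul, map_pow,
      map_neg, map_one] at h4
    exact h4
  · intro a b
    refine φ.injective ?_
    change φ (quat n (transportMul φ a b)) = φ (transportMul φ (quat n a) (quat n b))
    rw [← hrho, map_transportMul, map_transportMul, rho_mul, hrho, hrho]
  · intro a b
    change MvPolynomial.constantCoeff (transportMul φ b (quat n a)).1 =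
      starRingEnd ℂ (MvPolynomial.constantCoeff (transportMul φ a (quat n b)).1)
    rw [← htr, ← htr, map_transportMul, map_transportMul, ← hrho, ← hrho]
    exact hT.2.2.1 _ _
  · intro a ha
    change 0 < (MvPolynomial.constantCoeff (transportMul φ a (quat n a)).1).re
    rw [← htr, map_transportMul, ← hrho]
    exact hT.2.2.2 _ fun h => ha ((map_eq_zero_iff φ φ.injective).1 h)
  · ext x
    obtain ⟨a, rfl⟩ := φ.surjective x
    rw [constantTerm_apply, htr]

/-! ### From a star-product back to its trace -/

section Converse

variable {hn : 1 ≤ n} {S : StarProduct n} {φ : Inv n ≃ₗ[ℂ] Quant P.poly}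

lemma constantCoeff_eq_zero {d : ℕ} (hd : d ≠ 0) {a : Inv n} (ha : a.1.IsHomogeneous d) :
    MvPolynomial.constantCoeff a.1 = 0 := by
  rw [MvPolynomial.constantCoeff_eq, ha.coeff_eq_zero (by simpa using hd.symm)]

lemma constantCoeff_eq_zero_of_component {f : MvPolynomial (Fin 2) ℂ}
    (h : MvPolynomial.homogeneousComponent 0 f = 0) : MvPolynomial.constantCoeff f = 0 := by
  rw [MvPolynomial.homogeneousComponent_zero] at h
  simpa [MvPolynomial.constantCoeff_eq] using h

lemma StarProduct.IsShort.constantCoeff_mul (hS : S.IsShort) {i j : ℕ} (hij : i ≠ j)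
    {a b : Inv n} (ha : a.1.IsHomogeneous i) (hb : b.1.IsHomogeneous j) :
    MvPolynomial.constantCoeff (S.mul a b).1 = 0 := by
  refine constantCoeff_eq_zero_of_component ?_
  by_contra h
  obtain ⟨k, hk⟩ := S.degree i j a b ha hb 0 h
  exact h (hS i j a b ha hb k 0 hk (by omega))

variable (hS : S.IsUnitaryEvenShort hn P) (hφ : IsQuantizationMap hn S φ)
include hS hφ

/-- In different degrees both constant terms vanish by shortness. In equal degree i the constant
term is C_i, and evenness gives (-1)^i, the eigenvalue of s = σ² in degree i. -/
lemma constantTerm_mul_comm (x y : Quant P.poly) :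
    constantTerm φ (x * y) = constantTerm φ (y * sAut P x) := by
  obtain ⟨a, rfl⟩ := φ.surjective x
  obtain ⟨b, rfl⟩ := φ.surjective y
  induction a using inv_induction hn with
  | h0 => simp
  | ha f g hf hg => simp only [map_add, add_mul, mul_add, hf, hg]
  | hh i a ha =>
    have hs : sAut P (φ a) = (-1 : ℂ) ^ i • φ a := by
      rw [← sAut_eq_sigma_sigma, hφ.2.2.1 i a ha, map_smul, MulOpposite.unop_smul,
        hφ.2.2.1 i a ha, smul_smul, ← mul_pow, Complex.I_mul_I]
    rw [hs, mul_smul_comm, map_smul]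
    induction b using inv_induction hn with
    | h0 => simp
    | ha f g hf hg => simp only [map_add, add_mul, mul_add, hf, hg, smul_add]
    | hh j b hb =>
      rw [← hφ.2.1, ← hφ.2.1, constantTerm_apply, constantTerm_apply]
      by_cases hij : i = j
      · subst hij
        have h := hS.2.2.1 i i a b ha hb i 0 (by omega)
        rw [MvPolynomial.homogeneousComponent_zero, MvPolynomial.homogeneousComponent_zero,
          ← MvPolynomial.C_1, ← MvPolynomial.C_neg, ← MvPolynomial.C_pow, ← MvPolynomial.C_mul,
          MvPolynomial.C_inj] at h
        exact h
      · rw [hS.2.1.constantCoeff_mul hij ha hb, hS.2.1.constantCoeff_mul (Ne.symm hij) hb ha,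
          smul_zero]

lemma constantTerm_mem : constantTerm φ ∈ positiveEvenTraces P (canonicalSign n) := by
  refine ⟨constantTerm_mul_comm hS hφ, fun x => ?_, fun x y => ?_, fun x hx => ?_⟩
  · obtain ⟨a, rfl⟩ := φ.surjective x
    induction a using inv_induction hn with
    | h0 => simp
    | ha f g hf hg => simp only [map_add, MulOpposite.unop_add, hf, hg]
    | hh i a ha =>
      rw [hφ.2.2.1 i a ha, map_smul, constantTerm_apply]
      rcases Nat.eq_zero_or_pos i with rfl | hi
      · rw [pow_zero, one_smul]
      · rw [constantCoeff_eq_zero hi.ne' ha, smul_zero]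
  · obtain ⟨a, rfl⟩ := φ.surjective x
    obtain ⟨b, rfl⟩ := φ.surjective y
    rw [hφ.2.2.2, hφ.2.2.2, ← hφ.2.1, ← hφ.2.1, constantTerm_apply, constantTerm_apply]
    exact hS.2.2.2.2.1 a b
  · obtain ⟨a, rfl⟩ := φ.surjective x
    rw [hφ.2.2.2, ← hφ.2.1, constantTerm_apply]
    exact hS.2.2.2.2.2 a fun h => hx (by rw [h, map_zero])

omit hS in
lemma constantTerm_one : constantTerm φ 1 = 1 := by
  have h : φ 1 = 1 := hφ.isSymbolic.map_one hn
  rw [← h, constantTerm_apply]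
  exact map_one MvPolynomial.constantCoeff

/-- Shortness is exactly the orthogonality of different degrees under the constant term, so φ must
be the Gram-Schmidt map of its own trace. -/
lemma constantTerm_isOrthogonal : IsOrthogonal (constantTerm φ) φ.toLinearMap := by
  refine ⟨hφ.isSymbolic, fun d a ha v hv => ?_⟩
  obtain ⟨c, rfl⟩ := φ.surjective v
  have h1 : ∀ e, d ≤ e → invComp hn e c = 0 := fun e he =>
    hφ.isSymbolic.eq_zero_of_mem_filtLT hn hv he
  change constantTerm φ (φ a * φ c) = 0
  rw [← sum_invComp hn h1, map_sum, Finset.mul_sum, map_sum]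
  refine Finset.sum_eq_zero fun e he => ?_
  rw [← hφ.2.1, constantTerm_apply]
  exact hS.2.1.constantCoeff_mul (Finset.mem_range.1 he).ne' ha (invComp_isHomogeneous hn e c)

/-- A unitary even short star-product is determined by its trace. -/
lemma starProduct_eq_of_constantTerm_eq {S' : StarProduct n} {φ' : Inv n ≃ₗ[ℂ] Quant P.poly}
    (hS' : S'.IsUnitaryEvenShort hn P) (hφ' : IsQuantizationMap hn S' φ')
    (h : constantTerm φ = constantTerm φ') : S = S' := by
  have h1 := constantTerm_isOrthogonal hS' hφ'
  rw [← h] at h1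
  have h2 : φ = φ' := LinearEquiv.toLinearMap_injective (orthogonal_map_unique hn
    (constantTerm_mem hS hφ) (constantTerm_isOrthogonal hS hφ) h1)
  subst h2
  refine StarProduct.ext (LinearMap.ext₂ fun a b => φ.injective ?_)
  rw [hφ.2.1, hφ'.2.1]

omit hS

/-- For n ≥ 2 the only word of degree less than 2 is the empty one, so φ(z) - z is a scalar and
fixed by σ. But σ negates both terms, so the scalar is 0. -/
lemma map_genInv_z (hn2 : 2 ≤ n) : φ (genInv n hn Gen.z) = gen P.poly Gen.z := by
  set x := φ (genInv n hn Gen.z) - gen P.poly Gen.z with hx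
  have h1 : x ∈ filtLT n P.poly 2 := by
    have := hφ.1 [Gen.z]
    simpa [Gen.degree] using this
  have h2 : ∀ y ∈ filtLT n P.poly 2, (sigma P y).unop = y := by
    intro y hy
    induction hy using Submodule.span_induction with
    | mem y hy =>
      obtain ⟨w, hw, rfl⟩ := hy
      cases w with
      | nil => simp
      | cons g t => cases g <;> simp [Gen.degree] at hw <;> omega
    | zero => simp
    | add x y _ _ h1 h2 => rw [map_add, MulOpposite.unop_add, h1, h2]
    | smul c x _ h => rw [map_smul, MulOpposite.unop_smul, h]
  have h3 : (sigma P x).unop = -x := by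
    have h4 := hφ.2.2.1 2 (genInv n hn Gen.z)
      ((MvPolynomial.isHomogeneous_X _ _).mul (MvPolynomial.isHomogeneous_X _ _))
    rw [hx, map_sub, MulOpposite.unop_sub, h4, sigma_gen, sigmaGen, MulOpposite.unop_op,
      Complex.I_sq, neg_one_smul]
    abel
  have h5 : (2 : ℂ) • x = 0 := by
    rw [two_smul]
    nth_rewrite 1 [← h2 x h1]
    rw [h3, neg_add_cancel]
  exact sub_eq_zero.1 ((smul_eq_zero.1 h5).resolve_left two_ne_zero)

/-- A star-product determines the restriction of its trace to `ℂ[z]`. -/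
lemma constantTerm_zev_eq (hn2 : 2 ≤ n) {φ' : Inv n ≃ₗ[ℂ] Quant P.poly}
    (hφ' : IsQuantizationMap hn S φ') (R : ℂ[X]) :
    constantTerm φ (zev P.poly R) = constantTerm φ' (zev P.poly R) := by
  have key : ∀ k : ℕ, ∃ c : Inv n, φ c = gen P.poly Gen.z ^ k ∧ φ' c = gen P.poly Gen.z ^ k := by
    intro k
    induction k with
    | zero =>
      exact ⟨1, (hφ.isSymbolic.map_one hn).trans (pow_zero _).symm,
        (hφ'.isSymbolic.map_one hn).trans (pow_zero _).symm⟩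
    | succ k ih =>
      obtain ⟨c, h1, h2⟩ := ih
      refine ⟨S.mul (genInv n hn Gen.z) c, ?_, ?_⟩
      · rw [hφ.2.1, map_genInv_z hφ hn2, h1, pow_succ']
      · rw [hφ'.2.1, map_genInv_z hφ' hn2, h2, pow_succ']
  rw [zev, aeval_eq_sum_range, map_sum, map_sum]
  refine Finset.sum_congr rfl fun k _ => ?_
  obtain ⟨c, h1, h2⟩ := key k
  rw [map_smul, map_smul]
  congr 1
  conv_lhs => rw [← h1]
  rw [← h2, constantTerm_apply, constantTerm_apply]

end Converse

/-! ### Normalized positive traces -/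

lemma exists_smul_mem {ε : ℤˣ} {T : Quant P.poly →ₗ[ℂ] ℂ} (hT : T ∈ positiveEvenTraces P ε) :
    ∃ c : ℝ, 0 < c ∧ c • T ∈ positiveEvenTraces P ε ∧ (c • T) 1 = 1 := by
  have : Nontrivial (Quant P.poly) := by
    refine (coeffs P.poly).toEquiv.nontrivial
  have h1 := hT.2.2.2 1 one_ne_zero
  rw [rho_one, mul_one] at h1
  have h2 : ((T 1).re : ℂ) = T 1 := by
    have := trace_rho hT 1
    rw [rho_one] at this
    exact Complex.conj_eq_iff_re.1 this.symm
  refine ⟨(T 1).re⁻¹, inv_pos.2 h1, (positiveEvenTraces P ε).smul_mem (inv_pos.2 h1) hT, ?_⟩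
  rw [LinearMap.smul_apply, ← h2, Complex.real_smul, ← Complex.ofReal_mul, Complex.ofReal_re,
    inv_mul_cancel₀ h1.ne', Complex.ofReal_one]

lemma relSign_canonicalSign (n : ℕ) : relSign n (canonicalSign n) = 1 := by
  simp [relSign]

lemma exists_mem_positiveEvenTraces (hs : RootsInStrip P) {m : ℕ} (hm : Even m)
    (hmn : 2 * m < n) : ∃ hh, extend P (momentFunctional hs (X ^ m) hh) ∈
      positiveEvenTraces P (canonicalSign n) := by
  have h1 : (0 : ℝ[X]) + (1 : ℝ) • X ^ m = X ^ m := by simp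
  have hh : 2 * ((0 : ℝ[X]) + (1 : ℝ) • X ^ m).natDegree < n := by
    rwa [h1, natDegree_X_pow]
  have h2 := extend_momentFunctional_mem (m := m) hs (ε := canonicalSign n) (p := 0) (c := 1)
    (by rw [relSign_canonicalSign, hm.neg_one_pow, one_mul]) (by simp) (by simp) hh
  refine ⟨by rwa [natDegree_X_pow], ?_⟩
  simp only [h1] at h2
  exact h2

/-- From 2 deg h < n ≤ 4 the degree is at most 1, and the canonical sign forces it to be even. So h
is constant, and normalization fixes it. -/
lemma trace_unique (hs : RootsInStrip P) (hn : 1 ≤ n) (hn4 : n ≤ 4)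
    {T T' : Quant P.poly →ₗ[ℂ] ℂ} (hT : T ∈ positiveEvenTraces P (canonicalSign n))
    (hT' : T' ∈ positiveEvenTraces P (canonicalSign n)) (h : T 1 = 1) (h' : T' 1 = 1) :
    T = T' := by
  have key : ∀ T ∈ positiveEvenTraces P (canonicalSign n), ∃ c : ℝ, T =
      c • traceMap hs hn (D := 1) (by omega) ⟨1, by simp [mem_degreeLT]⟩ := by
    intro T hT
    obtain ⟨h, hh, rfl, hsg⟩ := mem_positiveEvenTraces hs hn hT
    rw [relSign_canonicalSign, one_mul] at hsg
    have hd : h.natDegree = 0 := by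
      have : h.natDegree ≠ 1 := fun h1 => by rw [h1] at hsg; norm_num at hsg
      omega
    have hmem : h ∈ degreeLT ℝ 1 := by
      rw [mem_degreeLT]
      exact (natDegree_eq_zero_iff_degree_le_zero.1 hd).trans_lt (by norm_num)
    have h1 : (⟨h, hmem⟩ : degreeLT ℝ 1) = h.coeff 0 • ⟨1, by simp [mem_degreeLT]⟩ := by
      refine Subtype.ext ?_
      rw [Submodule.coe_smul, smul_eq_C_mul, mul_one]
      exact eq_C_of_natDegree_eq_zero hd
    refine ⟨h.coeff 0, ?_⟩
    rw [← map_smul, ← h1]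
    rfl
  obtain ⟨c, hc⟩ := key T hT
  obtain ⟨c', hc'⟩ := key T' hT'
  set T₁ := traceMap hs hn (D := 1) (by omega) ⟨1, by simp [mem_degreeLT]⟩
  rw [hc, LinearMap.smul_apply] at h
  rw [hc', LinearMap.smul_apply, ← h, ← sub_eq_zero, ← sub_smul, smul_eq_zero] at h'
  rcases h' with h' | h'
  · rw [hc, hc', sub_eq_zero.1 h']
  · rw [h', smul_zero] at h
    exact absurd h zero_ne_one

/-- The traces of h = 1 and h = X², the latter integrable because 4 < n. They are not proportional,
since h is determined by its moments. -/
lemma exists_two_traces (hs : RootsInStrip P) (hn : 1 ≤ n) (hn5 : 5 ≤ n) :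
    ∃ T ∈ positiveEvenTraces P (canonicalSign n), ∃ T' ∈ positiveEvenTraces P (canonicalSign n),
      T 1 = 1 ∧ T' 1 = 1 ∧ ∃ R, T (zev P.poly R) ≠ T' (zev P.poly R) := by
  obtain ⟨hh, hT⟩ := exists_mem_positiveEvenTraces hs (m := 0) (by decide) (by omega)
  obtain ⟨hh', hT'⟩ := exists_mem_positiveEvenTraces hs (m := 2) (by decide) (by omega)
  obtain ⟨c, hc, hcT, hc1⟩ := exists_smul_mem hT
  obtain ⟨c', hc', hcT', hc1'⟩ := exists_smul_mem hT'
  refine ⟨_, hcT, _, hcT', hc1, hc1', ?_⟩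
  by_contra! heq
  have h1 : momentMap hs hn (D := 3) (by omega)
      (c • ⟨X ^ 0, by rw [mem_degreeLT, degree_X_pow]; norm_num⟩) =
      momentMap hs hn (D := 3) (by omega)
      (c' • ⟨X ^ 2, by rw [mem_degreeLT, degree_X_pow]; norm_num⟩) := by
    rw [map_smul, map_smul]
    refine LinearMap.ext fun R => ?_
    have h2 := heq R
    rw [LinearMap.smul_apply, LinearMap.smul_apply, extend_zev, extend_zev] at h2
    exact h2
  have h3 := congrArg (fun p : degreeLT ℝ 3 => p.1.coeff 0) (momentMap_injective hs hn _ h1)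
  simp at h3
  exact hc.ne' h3

end StarProducts

end Kleinian

end

/-! ### Assembly -/

theorem mainTheorem6 (n : ℕ) (hn : 1 ≤ n) (P : Kleinian.Parameter n)
    (hstrip : ∀ α : ℂ, P.poly.IsRoot α → |α.re| < 1 / 2) :
    (Odd n → Kleinian.HasDimModScaling (Kleinian.positiveEvenTraces P (-1)) (((n : ℤ) - 3) / 2)) ∧
    (Odd n → Kleinian.HasDimModScaling (Kleinian.positiveEvenTraces P 1) (((n : ℤ) - 1) / 2)) ∧
    (Even n → Kleinian.HasDimModScaling (Kleinian.positiveEvenTraces P (-1)) (((n : ℤ) - 2) / 2)) ∧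
    (Even n → Kleinian.HasDimModScaling (Kleinian.positiveEvenTraces P 1) (((n : ℤ) - 4) / 2)) ∧
    (n ≤ 4 → ∃! S : Kleinian.StarProduct n, S.IsUnitaryEvenShort hn P) ∧
    (5 ≤ n → ∃ S S' : Kleinian.StarProduct n,
      S.IsUnitaryEvenShort hn P ∧ S'.IsUnitaryEvenShort hn P ∧ S ≠ S') := by
  have hs : Kleinian.RootsInStrip P := fun α hα => hstrip α (Polynomial.isRoot_of_mem_roots hα)
  have hsq : ((-1 : ℝ) ^ ((n - 1) / 2)) * (-1) ^ ((n - 1) / 2) = 1 := by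
    rw [← mul_pow]; norm_num
  refine ⟨fun h => ?_, fun h => ?_, fun h => ?_, fun h => ?_, fun h4 => ?_, fun h5 => ?_⟩
  -- The top degree (n-1)/2 itself has the wrong sign, so it is the first excluded degree D.
  · refine Kleinian.hasDimModScaling_positiveEvenTraces hs hn (D := (n - 1) / 2) (by omega) le_rfl
      ?_ ?_
    · rw [Kleinian.relSign_neg_one, Kleinian.relSign_one n hn, if_pos h, neg_mul, hsq]
    · obtain ⟨k, rfl⟩ := h
      omega
  -- The top degree is admissible here, so D is one more.
  · refine Kleinian.hasDimModScaling_positiveEvenTraces hs hn (D := (n - 1) / 2 + 1) ?_ (by omega)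
      ?_ ?_
    · obtain ⟨k, rfl⟩ := h
      omega
    · rw [Kleinian.relSign_one n hn, if_pos h, pow_succ, ← mul_assoc, hsq, one_mul]
    · obtain ⟨k, rfl⟩ := h
      omega
  · have h' : ¬ Odd n := Nat.not_odd_iff_even.2 h
    refine Kleinian.hasDimModScaling_positiveEvenTraces hs hn (D := (n - 1) / 2 + 1) ?_ (by omega)
      ?_ ?_
    · obtain ⟨k, rfl⟩ := h
      omega
    · rw [Kleinian.relSign_neg_one, Kleinian.relSign_one n hn, if_neg h', neg_neg, pow_succ,
        ← mul_assoc, hsq, one_mul]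
    · obtain ⟨k, rfl⟩ := h
      omega
  · have h' : ¬ Odd n := Nat.not_odd_iff_even.2 h
    refine Kleinian.hasDimModScaling_positiveEvenTraces hs hn (D := (n - 1) / 2) (by omega) le_rfl
      ?_ ?_
    · rw [Kleinian.relSign_one n hn, if_neg h', neg_mul, hsq]
    · obtain ⟨k, rfl⟩ := h
      omega
  · obtain ⟨hh, hT⟩ := Kleinian.exists_mem_positiveEvenTraces hs (m := 0) (by decide) (by omega)
    obtain ⟨c, -, hcT, hc1⟩ := Kleinian.exists_smul_mem hT
    obtain ⟨S, φ, hS, hφ, -⟩ := Kleinian.exists_starProduct hn hcT hc1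
    refine ⟨S, hS, fun S' hS' => ?_⟩
    obtain ⟨φ', hφ'⟩ := hS'.1
    exact Kleinian.starProduct_eq_of_constantTerm_eq hS' hφ' hS hφ
      (Kleinian.trace_unique hs hn h4 (Kleinian.constantTerm_mem hS' hφ')
        (Kleinian.constantTerm_mem hS hφ) (Kleinian.constantTerm_one hφ')
        (Kleinian.constantTerm_one hφ))
  · obtain ⟨T, hT, T', hT', h1, h1', R, hR⟩ := Kleinian.exists_two_traces hs hn h5
    obtain ⟨S, φ, hS, hφ, rfl⟩ := Kleinian.exists_starProduct hn hT h1
    obtain ⟨S', φ', hS', hφ', rfl⟩ := Kleinian.exists_starProduct hn hT' h1'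
    refine ⟨S, S', hS, hS', ?_⟩
    -- If the products agreed, their two quantization maps would give the same trace on ℂ[z].
    rintro rfl
    exact hR (Kleinian.constantTerm_zev_eq hφ (by omega) hφ' R)
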